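/- **Proposition 2.3.** Let $X$ be a complex manifold of dimension $n$ (Hausdorff, second countable), $F$ a holomorphic line bundle on $X$, and $\Phi\colon X\to\mathbb R$ a smooth function; for $d\in\mathbb R$ put $X_d:=\{x\in X\mid \Phi(x)<d\}$. Let $c\in\mathbb R$ be such that $X_{c'}$ is relatively compact in $X$ for some $c'>c$, and $d\Phi\neq 0$ at every point of $\{\Phi=c\}$. Then there is a number $a>0$ (depending only on $X$, $\Phi$ and $c$) with the following properties. * $d\Phi\neq0$ on $\partial X_d$ for every $d\in(c-a,c+a)$. * Let $Y\subset X$ be a Zariski open set (the complement of an analytic subset), $h$ a smooth hermitian metric on $F|_Y$, and $\widetilde\omega$ a smooth positive $(1,1)$-form on $Y$ which is complete on $Y$ and satisfies $\widetilde\omega\ge\overline\omega$ on $Y$ for some smooth positive $(1,1)$-form $\overline\omega$ on $X$. Let $u$ be a smooth $F$-valued $(p,q-1)$-form and $v$ a smooth $F$-valued $(p,q)$-form on $Y$ ($p\ge0$, $q\ge1$) such that $\|u\|_{h,\widetilde\omega}$, $\|v\|_{h,\widetilde\omega}$, $\|\overline\partial u\|_{h,\widetilde\omega}$, $\|\overline\partial^{*}_{h,\widetilde\omega}v\|_{h,\widetilde\omega}$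 are finite. Then for almost every $d\in(c-a,c+a)$ $$\int_{X_d\cap Y}\langle\overline\partial u,v\rangle_{h,\widetilde\omega}\,dV_{\widetilde\omega}=\int_{X_d\cap Y}\langle u,\overline\partial^{*}_{h,\widetilde\omega}v\rangle_{h,\widetilde\omega}\,dV_{\widetilde\omega}+\int_{\partial X_d\cap Y}\langle u,(\overline\partial\Phi)^{*}v\rangle_{h,\widetilde\omega}\,dS_{\widetilde\omega},$$ where all three integrals converge absolutely. Here $\langle\cdot,\cdot\rangle_{h,\widetilde\omega}$ is the pointwise inner product, $dV_{\widetilde\omega}=\widetilde\omega^n/n!$, $\|u\|^2_{h,\widetilde\omega}=\int_Y\langle u,u\rangle_{h,\widetilde\omega}\,dV_{\widetilde\omega}$, $\overline\partial^{*}_{h,\widetilde\omega}$ is the formal adjoint of $\overline\partial$ on $Y$, $(\overline\partial\Phi)^{*}$ is the adjoint of $\overline\partial\Phi\wedge\cdot$ for the pointwise inner products, and $dS_{\widetilde\omega}=\ast\, d\Phi/|d\Phi|^2_{\widetilde\omega}$ is the volume form on $\partial X_d$, so that $dV_{\widetilde\omega}=d\Phi\wedge dS_{\widetilde\omega}$.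 -/

import Mathlib

open Set Filter Topology MeasureTheory Bundle
open scoped Manifold ContDiff ENNReal ComplexConjugate

noncomputable section

namespace DbarBoundary

/-- The model space `ℂⁿ` of an `n`-dimensional complex manifold. The tangent space of such a
manifold at `x` is identified with `ℂⁿ` through the preferred holomorphic chart at `x` (this is
the convention of `TangentSpace`); multiplication by `Complex.I` is the complex structure. -/
abbrev Cn (n : ℕ) : Type := Fin n → ℂ

/-- The real basis `∂/∂x₁, …, ∂/∂xₙ, ∂/∂y₁, …, ∂/∂yₙ` of `ℂⁿ`, where `zⱼ = xⱼ + i yⱼ`. -/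
def realBasis (n : ℕ) : Fin n ⊕ Fin n → Cn n
  | .inl j => Pi.single j 1
  | .inr j => Pi.single j Complex.I

/-! ### Linear algebra of complex valued forms on `ℂⁿ` -/

section Pointwise

variable {n k : ℕ}

/-- The `ℂ`-antilinear part `v ↦ (A v + i A (i v)) / 2` of a real linear map into a complex
vector space. -/
def antilinearPart {V : Type*} [NormedAddCommGroup V] [NormedSpace ℂ V] (A : Cn n →L[ℝ] V) :
    Cn n →L[ℝ] V :=
  (2⁻¹ : ℂ) • (A + Complex.I • A.comp
    ((Complex.I • ContinuousLinearMap.id ℂ (Cn n)).restrictScalars ℝ))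

/-- A form (with values in a complex vector space) is of type `(p, q)`: it is `ℂ`-homogeneous of
bidegree `(p, q)` under complex scalar multiplication of its arguments. On forms of degree
`p + q` this says exactly that it is a combination of `dz_I ∧ dz̄_J`, `|I| = p`, `|J| = q`. -/
def IsOfType {V : Type*} [AddCommGroup V] [Module ℂ V] [TopologicalSpace V] (p q : ℕ)
    (α : Cn n [⋀^Fin k]→L[ℝ] V) : Prop :=
  ∀ (ζ : ℂ) (m : Fin k → Cn n), α (fun i => ζ • m i) = (ζ ^ p * conj ζ ^ q) • α m

/-- Wedge product `θ ∧ α` of a `1`-form with a `k`-form: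
`(θ ∧ α)(v₀, …, v_k) = ∑ᵢ (-1)ⁱ θ(vᵢ) α(v₀, …, v̂ᵢ, …, v_k)`. -/
def wedge (θ : Cn n →L[ℝ] ℂ) (α : Cn n [⋀^Fin k]→L[ℝ] ℂ) : Cn n [⋀^Fin (k + 1)]→L[ℝ] ℂ :=
  ContinuousAlternatingMap.alternatizeUncurryFin (θ.smulRight α)

/-- The Gram matrix of a bilinear function `g` in the real basis of `ℂⁿ`. -/
def gram (g : Cn n → Cn n → ℝ) : Matrix (Fin n ⊕ Fin n) (Fin n ⊕ Fin n) ℝ :=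
  Matrix.of fun i j => g (realBasis n i) (realBasis n j)

/-- The pointwise inner product of two `k`-forms with values in a complex line `V`, induced by a
real scalar product `g` on `ℂⁿ` (compatible with the complex structure) and a hermitian product
`h` on `V`. If `e₁, …, eₙ` are complex linear forms with `g = ∑ |eⱼ|²`, then the forms
`e_I ∧ ē_J` are orthonormal; equivalently the inner product is `2⁻ᵏ / k!` times the sum of
`h (α (f_{s 1}, …, f_{s k})) (β (f_{s 1}, …, f_{s k}))` over all sequences of vectors of a
`g`-orthonormal real basis `f`. The formula below expresses this in the fixed basis, through the
inverse Gram matrix. -/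
def formInner {V : Type*} [AddCommGroup V] [Module ℂ V] [TopologicalSpace V]
    (g : Cn n → Cn n → ℝ) (h : V →ₗ[ℂ] V →ₗ⋆[ℂ] ℂ) (α β : Cn n [⋀^Fin k]→L[ℝ] V) : ℂ :=
  ((2 : ℂ) ^ k * (k.factorial : ℂ))⁻¹ * ∑ s : Fin k → Fin n ⊕ Fin n, ∑ t : Fin k → Fin n ⊕ Fin n,
    ((∏ a, (gram g)⁻¹ (s a) (t a) : ℝ) : ℂ) *
      h (α fun a => realBasis n (s a)) (β fun a => realBasis n (t a))

/-- The adjoint `θ^*` of the wedge product by `θ` for the pointwise inner products: contraction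
with the vector dual to `θ`. See `formInner_wedge`. -/
def wedgeAdj (g : Cn n → Cn n → ℝ) (θ : Cn n →L[ℝ] ℂ) (β : Cn n [⋀^Fin (k + 1)]→L[ℝ] ℂ) :
    Cn n [⋀^Fin k]→L[ℝ] ℂ :=
  (2⁻¹ : ℂ) • ∑ i, ∑ j, (((gram g)⁻¹ i j : ℂ) * conj (θ (realBasis n i))) •
    β.curryLeft (realBasis n j)

/-- `wedgeAdj g θ` is the adjoint of the wedge product by `θ`. -/
theorem formInner_wedge (g : Cn n → Cn n → ℝ) (h : ℂ →ₗ[ℂ] ℂ →ₗ⋆[ℂ] ℂ) (θ : Cn n →L[ℝ] ℂ)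
    (α : Cn n [⋀^Fin k]→L[ℝ] ℂ) (β : Cn n [⋀^Fin (k + 1)]→L[ℝ] ℂ) :
    formInner g h (wedge θ α) β = formInner g h α (wedgeAdj g θ β) := by
  set b := realBasis n with hb
  set G : Fin n ⊕ Fin n → Fin n ⊕ Fin n → ℂ := fun i j => (((gram g)⁻¹ i j : ℝ) : ℂ) with hG
  set S : ℂ := ∑ s : Fin k → Fin n ⊕ Fin n, ∑ t : Fin k → Fin n ⊕ Fin n, ∑ i, ∑ j,
    (∏ a, G (s a) (t a)) * (G i j * θ (b i)) *
      h (α fun a => b (s a)) (β (Fin.cons (b j) fun a => b (t a))) with hS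
  have hsm : ∀ ξ c η : ℂ, h ξ (c * η) = conj c * h ξ η := fun ξ c η => by
    simpa using (h ξ).map_smulₛₗ c η
  have key : ∀ r : Fin (k + 1),
      ∑ s : Fin (k + 1) → Fin n ⊕ Fin n, ∑ t : Fin (k + 1) → Fin n ⊕ Fin n,
        (∏ a, G (s a) (t a)) * ((-1) ^ (r : ℕ) * (θ (b (s r)) *
          h (α (r.removeNth fun a => b (s a))) (β fun a => b (t a)))) = S := by
    intro r
    rw [← (Fin.insertNthEquiv (fun _ => Fin n ⊕ Fin n) r).sum_comp, Fintype.sum_prod_type_right]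
    rw [hS]
    refine Finset.sum_congr rfl fun s _ => ?_
    have : ∀ i, ∑ t : Fin (k + 1) → Fin n ⊕ Fin n,
        (∏ a, G ((Fin.insertNthEquiv (fun _ => Fin n ⊕ Fin n) r) (i, s) a) (t a)) *
        ((-1) ^ (r : ℕ) * (θ (b ((Fin.insertNthEquiv (fun _ => Fin n ⊕ Fin n) r) (i, s) r)) *
          h (α (r.removeNth fun a => b ((Fin.insertNthEquiv (fun _ => Fin n ⊕ Fin n) r) (i, s) a)))
            (β fun a => b (t a)))) =
        ∑ t : Fin k → Fin n ⊕ Fin n, ∑ j, (∏ a, G (s a) (t a)) * (G i j * θ (b i)) *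
          h (α fun a => b (s a)) (β (Fin.cons (b j) fun a => b (t a))) := by
      intro i
      rw [← (Fin.insertNthEquiv (fun _ => Fin n ⊕ Fin n) r).sum_comp, Fintype.sum_prod_type_right]
      refine Finset.sum_congr rfl fun t _ => Finset.sum_congr rfl fun j _ => ?_
      have h1 : (fun a => b ((Fin.insertNthEquiv (fun _ => Fin n ⊕ Fin n) r) (j, t) a)) =
          r.insertNth (b j) (fun a => b (t a)) := by
        ext1 a
        refine Fin.succAboveCases r ?_ (fun a => ?_) a <;> simp
      have h2 : (r.removeNth fun a => b ((Fin.insertNthEquiv (fun _ => Fin n ⊕ Fin n) r) (i, s) a))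
          = fun a => b (s a) := by
        ext1 a
        simp [Fin.removeNth]
      have h3 : β (r.insertNth (b j) (fun a => b (t a))) =
          (-1 : ℂ) ^ (r : ℕ) * β (Fin.cons (b j) fun a => b (t a)) := by
        have := β.toAlternatingMap.map_insertNth r (b j) (fun a => b (t a))
        simpa [Matrix.vecCons] using this
      rw [h1, h2, h3, Fin.prod_univ_succAbove _ r]
      have h4 : h (α fun a => b (s a)) ((-1 : ℂ) ^ (r : ℕ) * β (Fin.cons (b j) fun a => b (t a))) =
          (-1 : ℂ) ^ (r : ℕ) * h (α fun a => b (s a)) (β (Fin.cons (b j) fun a => b (t a))) := by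
        rw [hsm]
        simp
      rw [h4]
      have h5 : ((-1 : ℂ) ^ (r : ℕ)) * (-1) ^ (r : ℕ) = 1 := by
        rw [← mul_pow]; simp
      simp only [Fin.insertNthEquiv_apply, Fin.insertNth_apply_same, Fin.insertNth_apply_succAbove]
      linear_combination (G i j * (∏ a, G (s a) (t a)) * θ (b i) *
        h (α fun a => b (s a)) (β (Fin.cons (b j) fun a => b (t a)))) * h5
    simp_rw [this]
    rw [Finset.sum_comm]
  have lhs : formInner g h (wedge θ α) β =
      ((2 : ℂ) ^ (k + 1) * ((k + 1).factorial : ℂ))⁻¹ * ((k + 1 : ℕ) * S) := by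
    have : ((k + 1 : ℕ) : ℂ) * S = ∑ r : Fin (k + 1),
        ∑ s : Fin (k + 1) → Fin n ⊕ Fin n, ∑ t : Fin (k + 1) → Fin n ⊕ Fin n,
          (∏ a, G (s a) (t a)) * ((-1) ^ (r : ℕ) * (θ (b (s r)) *
            h (α (r.removeNth fun a => b (s a))) (β fun a => b (t a)))) := by
      rw [Finset.sum_congr rfl fun r _ => key r]
      simp
    rw [this, formInner]
    congr 1
    conv_rhs => rw [Finset.sum_comm]
    refine Finset.sum_congr rfl fun s _ => ?_
    conv_rhs => rw [Finset.sum_comm]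
    refine Finset.sum_congr rfl fun t _ => ?_
    simp only [← Finset.mul_sum]
    push_cast
    congr 1
    rw [wedge, ContinuousAlternatingMap.alternatizeUncurryFin_apply, map_sum, LinearMap.sum_apply]
    refine Finset.sum_congr rfl fun r _ => ?_
    have e1 : ((-1 : ℤ) ^ (r : ℕ)) • (θ.smulRight α) (b (s r)) (r.removeNth fun a => b (s a)) =
        ((-1 : ℂ) ^ (r : ℕ) * θ (b (s r))) • (α (r.removeNth fun a => b (s a))) := by
      simp [mul_assoc]
    rw [e1, map_smul, LinearMap.smul_apply, smul_eq_mul, mul_assoc]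
  have rhs : formInner g h α (wedgeAdj g θ β) =
      ((2 : ℂ) ^ k * (k.factorial : ℂ))⁻¹ * (2⁻¹ * S) := by
    rw [formInner]
    congr 1
    rw [hS, Finset.mul_sum]
    refine Finset.sum_congr rfl fun s _ => ?_
    rw [Finset.mul_sum]
    refine Finset.sum_congr rfl fun t _ => ?_
    have e2 : wedgeAdj g θ β (fun a => b (t a)) =
        (2⁻¹ : ℂ) • ∑ i, ∑ j, (G i j * conj (θ (b i))) • β (Fin.cons (b j) fun a => b (t a)) := by
      simp [wedgeAdj, Matrix.vecCons, ContinuousAlternatingMap.sum_apply, hG, hb,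
        -Fintype.sum_sum_type]
    rw [e2]
    simp only [map_sum, smul_eq_mul, Finset.mul_sum, hsm]
    refine Finset.sum_congr rfl fun i _ => Finset.sum_congr rfl fun j _ => ?_
    simp only [map_mul, map_inv₀, hG, Complex.conj_ofReal, Complex.conj_conj, Complex.ofReal_prod,
      map_ofNat]
    ring
  rw [lhs, rhs, Nat.factorial_succ]
  have hk : ((k.factorial : ℕ) : ℂ) ≠ 0 := by exact_mod_cast k.factorial_ne_zero
  have hk' : ((k + 1 : ℕ) : ℂ) ≠ 0 := by exact_mod_cast k.succ_ne_zero
  push_cast at hk' ⊢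
  field_simp
  ring

end Pointwise

/-! ### Complex manifolds: positive forms, metrics, volume -/

section Manifold

variable {n : ℕ} {X : Type*} [TopologicalSpace X] [ChartedSpace (Cn n) X]

/-- `Z` is an analytic subset (subvariety) of `X`: near every point of `X` it is the set of common
zeros of finitely many holomorphic functions. -/
def IsAnalyticSubset (Z : Set X) : Prop :=
  ∀ x : X, ∃ U : Set X, IsOpen U ∧ x ∈ U ∧ ∃ (r : ℕ) (f : Fin r → X → ℂ),
    (∀ i, ContMDiffOn 𝓘(ℂ, Cn n) 𝓘(ℂ, ℂ) ω (f i) U) ∧ Z ∩ U = {y ∈ U | ∀ i, f i y = 0}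

/-- `Y` is a Zariski open subset of `X`: the complement of an analytic subset. -/
def IsZariskiOpen (Y : Set X) : Prop := IsAnalyticSubset (n := n) Yᶜ

/-- The derivative at `z` of the inverse of the chart centred at `x₀`, as a map from `ℂⁿ` to the
tangent space at the image point. -/
def chartSymmDeriv (x₀ : X) (z : Cn n) : Cn n →L[ℝ] Cn n :=
  mfderiv 𝓘(ℝ, Cn n) 𝓘(ℝ, Cn n) (chartAt (Cn n) x₀).symm z

/-- The metric `g(a, b) = ω(a, i b)` associated with a `(1,1)`-form. For
`ω = (i/2) ∑ dzⱼ ∧ dz̄ⱼ` it is the Euclidean scalar product. -/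
def metricOf (om : X → Cn n [⋀^Fin 2]→L[ℝ] ℝ) (x : X) (a b : Cn n) : ℝ :=
  om x ![a, Complex.I • b]

/-- `om` is a smooth positive `(1,1)`-form on the open set `Y` (values outside `Y` are ignored). -/
structure IsPositiveForm (Y : Set X) (om : X → Cn n [⋀^Fin 2]→L[ℝ] ℝ) : Prop where
  smooth : ∀ x₀ : X, ContDiffOn ℝ ∞
    (fun z => (om ((chartAt (Cn n) x₀).symm z)).compContinuousLinearMap (chartSymmDeriv x₀ z))
    {z ∈ (chartAt (Cn n) x₀).target | (chartAt (Cn n) x₀).symm z ∈ Y}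
  type_one_one : ∀ x ∈ Y, ∀ a b : Cn n, om x ![Complex.I • a, Complex.I • b] = om x ![a, b]
  pos : ∀ x ∈ Y, ∀ a : Cn n, a ≠ 0 → 0 < om x ![a, Complex.I • a]

/-- The length of a path `γ : [0, 1] → X` for the metric of `om`. -/
def pathLength (om : X → Cn n [⋀^Fin 2]→L[ℝ] ℝ) (γ : ℝ → X) : ℝ≥0∞ :=
  ∫⁻ t in Icc (0 : ℝ) 1,
    let γ' : Cn n := mfderivWithin 𝓘(ℝ, ℝ) 𝓘(ℝ, Cn n) γ (Icc 0 1) t (1 : ℝ)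
    ENNReal.ofReal √(metricOf om (γ t) γ' γ')

/-- The geodesic distance of the metric of `om` on `Y`: the infimum of the lengths of `C¹` paths
in `Y` (so it is infinite between different components of `Y`). -/
def geodesicDist (Y : Set X) (om : X → Cn n [⋀^Fin 2]→L[ℝ] ℝ) (x y : X) : ℝ≥0∞ :=
  ⨅ (γ : ℝ → X) (_ : ContMDiffOn 𝓘(ℝ, ℝ) 𝓘(ℝ, Cn n) 1 γ (Icc 0 1) ∧
    MapsTo γ (Icc 0 1) Y ∧ γ 0 = x ∧ γ 1 = y), pathLength om γ

/-- `om` is complete on `Y`: every sequence in `Y` which is Cauchy for the geodesic distance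
converges to a point of `Y`. -/
def IsCompleteForm (Y : Set X) (om : X → Cn n [⋀^Fin 2]→L[ℝ] ℝ) : Prop :=
  ∀ s : ℕ → X, (∀ i, s i ∈ Y) →
    (∀ ε : ℝ≥0∞, 0 < ε → ∃ N, ∀ i ≥ N, ∀ j ≥ N, geodesicDist Y om (s i) (s j) < ε) →
    ∃ y ∈ Y, Tendsto (fun i => geodesicDist Y om (s i) y) atTop (𝓝 0)

/-- The volume density `√(det g(∂f/∂cᵢ, ∂f/∂cⱼ))` of the metric of `om` in a parametrization
`f : W → X`, with respect to vectors `cᵢ` of `W`. -/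
def volDensity {W ι : Type*} [NormedAddCommGroup W] [NormedSpace ℝ W] [Fintype ι] [DecidableEq ι]
    (om : X → Cn n [⋀^Fin 2]→L[ℝ] ℝ) (f : W → X) (c : ι → W) (w : W) : ℝ :=
  let D : W →L[ℝ] Cn n := mfderiv 𝓘(ℝ, W) 𝓘(ℝ, Cn n) f w
  √(Matrix.of fun i j => metricOf om (f w) (D (c i)) (D (c j))).det

variable [MeasurableSpace X]

/-- The volume measure `dV = ωⁿ / n!` on `Y`, which is the Riemannian volume `√(det g) dx dy` of
the associated metric: the least measure which dominates, for every chart, the measure that has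
the density `√(det g)` with respect to Lebesgue measure in this chart. (These agree on overlaps,
so the restriction to every chart domain is the coordinate measure.) -/
def volumeMeasure (Y : Set X) (om : X → Cn n [⋀^Fin 2]→L[ℝ] ℝ) : Measure X :=
  ⨆ x₀ : X, Measure.map (chartAt (Cn n) x₀).symm
    ((volume.restrict {z ∈ (chartAt (Cn n) x₀).target | (chartAt (Cn n) x₀).symm z ∈ Y}).withDensity
      fun z => ENNReal.ofReal (volDensity om (chartAt (Cn n) x₀).symm (realBasis n) z))

/-- A smooth real chart `e = (t, s₁, …, s_{2n-1})` of `X` whose first coordinate is `Φ`. -/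
structure IsAdaptedChart (Φ : X → ℝ)
    (e : OpenPartialHomeomorph X (ℝ × (Fin (2 * n - 1) → ℝ))) : Prop where
  smooth : ContMDiffOn 𝓘(ℝ, Cn n) 𝓘(ℝ, ℝ × (Fin (2 * n - 1) → ℝ)) ∞ e e.source
  smooth_symm : ContMDiffOn 𝓘(ℝ, ℝ × (Fin (2 * n - 1) → ℝ)) 𝓘(ℝ, Cn n) ∞ e.symm e.target
  fst_eq : ∀ x ∈ e.source, (e x).1 = Φ x

/-- The standard basis `∂/∂t, ∂/∂s₁, …, ∂/∂s_m` of `ℝ × ℝᵐ`. -/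
def prodBasis (m : ℕ) : Option (Fin m) → ℝ × (Fin m → ℝ)
  | none => (1, 0)
  | some j => (0, Pi.single j 1)

/-- The measure `dS = *dΦ / |dΦ|²` on the regular part of the level set `{Φ = d}` in `Y`,
determined by `dV = dΦ ∧ dS`: if `(t, s)` is a chart with `t = Φ` and `dV = ρ dt ds`, then
`dS = ρ(d, s) ds` in this chart; `dS` is the least measure which dominates all of these. -/
def levelMeasure (Y : Set X) (om : X → Cn n [⋀^Fin 2]→L[ℝ] ℝ) (Φ : X → ℝ) (d : ℝ) : Measure X :=
  ⨆ (e : OpenPartialHomeomorph X (ℝ × (Fin (2 * n - 1) → ℝ))) (_ : IsAdaptedChart Φ e),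
    Measure.map (fun s => e.symm (d, s))
      ((volume.restrict {s | (d, s) ∈ e.target ∧ e.symm (d, s) ∈ Y}).withDensity
        fun s => ENNReal.ofReal (volDensity om e.symm (prodBasis (2 * n - 1)) (d, s)))

end Manifold

/-! ### Forms with values in a holomorphic line bundle -/

section LineBundle

variable {n k : ℕ} {X : Type*} [TopologicalSpace X] [ChartedSpace (Cn n) X]
  {F : X → Type*} [∀ x, AddCommGroup (F x)] [∀ x, Module ℂ (F x)] [∀ x, TopologicalSpace (F x)]
  [TopologicalSpace (TotalSpace ℂ F)] [FiberBundle ℂ F] [VectorBundle ℂ ℂ F]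

/-- `h` is a smooth hermitian metric on the line bundle `F` over `Y`. -/
structure IsHermitianMetric (Y : Set X) (h : ∀ x, F x →ₗ[ℂ] F x →ₗ⋆[ℂ] ℂ) : Prop where
  symm : ∀ x ∈ Y, ∀ ξ η : F x, h x η ξ = conj (h x ξ η)
  pos : ∀ x ∈ Y, ∀ ξ : F x, ξ ≠ 0 → 0 < (h x ξ ξ).re
  smooth : ∀ x₀ : X, ContMDiffOn 𝓘(ℝ, Cn n) 𝓘(ℝ, ℂ) ∞
    (fun y => h y ((trivializationAt ℂ F x₀).symmL ℂ y 1) ((trivializationAt ℂ F x₀).symmL ℂ y 1))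
    (Y ∩ (trivializationAt ℂ F x₀).baseSet)

/-- The fibre coordinate over `y` in the trivialization of `F` around `x₀`. -/
def fiberCoord (x₀ y : X) : F y →L[ℝ] ℂ :=
  ((trivializationAt ℂ F x₀).continuousLinearMapAt ℂ y).restrictScalars ℝ

/-- The inverse of the fibre coordinate over `x` in the trivialization of `F` around `x`. -/
def fiberCoordSymm (x : X) : ℂ →L[ℝ] F x :=
  ((trivializationAt ℂ F x).symmL ℂ x).restrictScalars ℝ

/-- The complex valued form on `ℂⁿ` which represents an `F`-valued form in the chart and the
trivialization around `x₀`. -/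
def localRep (x₀ : X) (u : ∀ x : X, Cn n [⋀^Fin k]→L[ℝ] F x) (z : Cn n) :
    Cn n [⋀^Fin k]→L[ℝ] ℂ :=
  let y := (chartAt (Cn n) x₀).symm z
  ((fiberCoord x₀ y).compContinuousAlternatingMap (u y)).compContinuousLinearMap
    (chartSymmDeriv x₀ z)

/-- `u` is a smooth `F`-valued `(p, q)`-form on the open set `Y` (values outside `Y` are
ignored). -/
structure IsSmoothForm (Y : Set X) (p q : ℕ) (u : ∀ x : X, Cn n [⋀^Fin k]→L[ℝ] F x) : Prop where
  isOfType : ∀ x ∈ Y, IsOfType p q (u x)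
  smooth : ∀ x₀ : X, ContDiffOn ℝ ∞ (localRep x₀ u)
    {z ∈ (chartAt (Cn n) x₀).target |
      (chartAt (Cn n) x₀).symm z ∈ Y ∩ (trivializationAt ℂ F x₀).baseSet}

/-- The operator `∂̄` on `F`-valued forms. In a holomorphic chart and trivialization,
`∂̄ φ = ∑ⱼ dz̄ⱼ ∧ ∂φ/∂z̄ⱼ`, the alternatization of the antilinear part of the derivative. -/
def dbar (u : ∀ x : X, Cn n [⋀^Fin k]→L[ℝ] F x) (x : X) : Cn n [⋀^Fin (k + 1)]→L[ℝ] F x :=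
  (fiberCoordSymm x).compContinuousAlternatingMap
    (ContinuousAlternatingMap.alternatizeUncurryFin
      (antilinearPart (fderiv ℝ (localRep x u) (chartAt (Cn n) x x))))

/-- The value at `x` of `∂̄Φ` for a real function `Φ`. -/
def dbarFun (Φ : X → ℝ) (x : X) : Cn n →L[ℝ] ℂ :=
  let D : Cn n →L[ℝ] ℝ := mfderiv 𝓘(ℝ, Cn n) 𝓘(ℝ, ℝ) Φ x
  antilinearPart (Complex.ofRealCLM.comp D)

/-- `(∂̄Φ)^* v`, where `(∂̄Φ)^*` is the adjoint of `∂̄Φ ∧ ·` for the pointwise inner products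
defined by `om`. -/
def dbarFunAdj (om : X → Cn n [⋀^Fin 2]→L[ℝ] ℝ) (Φ : X → ℝ)
    (v : ∀ x : X, Cn n [⋀^Fin (k + 1)]→L[ℝ] F x) (x : X) : Cn n [⋀^Fin k]→L[ℝ] F x :=
  (fiberCoordSymm x).compContinuousAlternatingMap
    (wedgeAdj (metricOf om x) (dbarFun Φ x) ((fiberCoord x x).compContinuousAlternatingMap (v x)))

/-- The pointwise inner product `⟨u, v⟩_{h, om}` of `F`-valued forms. -/
def pointInner (om : X → Cn n [⋀^Fin 2]→L[ℝ] ℝ) (h : ∀ x, F x →ₗ[ℂ] F x →ₗ⋆[ℂ] ℂ)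
    (u v : ∀ x : X, Cn n [⋀^Fin k]→L[ℝ] F x) (x : X) : ℂ :=
  formInner (metricOf om x) (h x) (u x) (v x)

variable [MeasurableSpace X]

/-- The `L²`-norm `‖u‖_{h, om}` over `Y` is finite. -/
def FiniteL2Norm (Y : Set X) (om : X → Cn n [⋀^Fin 2]→L[ℝ] ℝ)
    (h : ∀ x, F x →ₗ[ℂ] F x →ₗ⋆[ℂ] ℂ) (u : ∀ x : X, Cn n [⋀^Fin k]→L[ℝ] F x) : Prop :=
  ∫⁻ x in Y, ENNReal.ofReal (pointInner om h u u x).re ∂(volumeMeasure Y om) < ⊤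

/-- `w = ∂̄^*_{h, om} v` on `Y`, where `∂̄^*` is the formal adjoint of `∂̄`: for a `(p, q+1)`-form
`v`, `w` is the smooth `(p, q)`-form on `Y` with `⟪∂̄φ, v⟫ = ⟪φ, w⟫` for all smooth
`(p, q)`-forms `φ` with compact support in `Y`. -/
structure IsDbarAdjoint (Y : Set X) (om : X → Cn n [⋀^Fin 2]→L[ℝ] ℝ)
    (h : ∀ x, F x →ₗ[ℂ] F x →ₗ⋆[ℂ] ℂ) (p q : ℕ)
    (v : ∀ x : X, Cn n [⋀^Fin (p + q + 1)]→L[ℝ] F x)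
    (w : ∀ x : X, Cn n [⋀^Fin (p + q)]→L[ℝ] F x) : Prop where
  isSmoothForm : IsSmoothForm Y p q w
  adjoint : ∀ φ : ∀ x : X, Cn n [⋀^Fin (p + q)]→L[ℝ] F x, IsSmoothForm Y p q φ →
    (∃ K ⊆ Y, IsCompact K ∧ ∀ x ∉ K, ∀ m, φ x m = 0) →
    ∫ x in Y, pointInner om h (dbar φ) v x ∂(volumeMeasure Y om) =
      ∫ x in Y, pointInner om h φ w x ∂(volumeMeasure Y om)

end LineBundle

end DbarBoundary

end

open DbarBoundary

/-!
The formula is proved by testing against functions of `Φ`, so that Stokes' theorem is not needed: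
the boundary term comes out of the coarea formula.

*The adjoint relation.* Let `λ = l ∘ Φ`, where `l` is smooth and bounded and `ψ = l'` vanishes
outside `(c - a, c + a)`. If `λ u` had compact support in `Y`, the definition of
the formal adjoint and the Leibniz rule `∂̄(λ u) = λ ∂̄u + ∂̄λ ∧ u` would give

  `∫ l(Φ) (⟨∂̄u, v⟩ - ⟨u, ∂̄^* v⟩) dV + ∫ ψ(Φ) ⟨u, (∂̄Φ)^* v⟩ dV = 0`.

In general this is applied to `χ λ` with a smooth compactly supported `χ` that is close to `1` on a
large compact set and whose gradient is small (`exists_cutoff`); as `u`, `v`, `∂̄u` and `∂̄^* v` are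
square integrable, dominated convergence gives the relation for `λ`
(`integral_adjoint_of_bounded_gradient`). Dominating the boundary term uses that `|dΦ|` is bounded
for the metric of `om`: it is bounded for `om₀` on the compact set `{c - a ≤ Φ ≤ c + a}`, and a
larger metric has smaller covectors.

*Cut-off functions.* Their existence is where completeness enters. Closed geodesic balls of a
complete length metric are compact (`isCompact_geodesicBall`, Hopf–Rinow), so that a truncation of a
small multiple of the geodesic distance is a compactly supported Lipschitz function; it is made
smooth by local mollification in charts, with a partition of unity whose gradients are compensated
by the precision of the mollification.

*Passage to the level sets.* Without critical points in `{c - a ≤ Φ ≤ c + a}`, charts with first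
coordinate `Φ` exist there, and Fubini in these charts gives the coarea formula
`∫ g dV = ∫ (∫_{Φ = t} g dS) dt` (`coareaOn_of_isCompact`). Fubini for `l(s) = -∫_{t > s} ψ(t) dt`
turns the first integral into `-∫ ψ(t) A(t) dt`, where `A(t)` is the integral of
`⟨∂̄u, v⟩ - ⟨u, ∂̄^* v⟩` over `{Φ < t}`. Hence `∫ ψ (G - A) = 0` for all test functions `ψ`, where
`G(t)` is the boundary integral over `{Φ = t}`, and `A = G` almost everywhere
(`ae_integral_sublevel_eq`).

*The number `a`.* The critical values of `Φ` on the compact closure of `{Φ < c'}` form a compact set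
which does not contain `c` (`exists_regular_interval`).
-/

set_option linter.unusedSectionVars false

open Set Filter Topology MeasureTheory Bundle
open scoped Manifold ContDiff ENNReal ComplexConjugate

open DbarBoundary

noncomputable section

namespace DbarBoundary


/-! ### Hermitian linear algebra of forms at a point -/

section LinearAlgebra

variable {n k : ℕ}

/-- Real and imaginary parts identify `ℂⁿ` with `ℝ²ⁿ`. -/
def realEquiv (n : ℕ) : Cn n ≃ₗ[ℝ] (Fin n ⊕ Fin n → ℝ) where
  toFun z := Sum.elim (fun j => (z j).re) (fun j => (z j).im)
  map_add' z w := by ext (j | j) <;> simp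
  map_smul' r z := by ext (j | j) <;> simp
  invFun f j := f (.inl j) + f (.inr j) * Complex.I
  left_inv z := by ext j; simp
  right_inv f := by ext (j | j) <;> simp

/-- `realBasis n` as a basis of the real vector space `ℂⁿ`. -/
def realBas (n : ℕ) : Module.Basis (Fin n ⊕ Fin n) ℝ (Cn n) := .ofEquivFun (realEquiv n)

@[simp] theorem coe_realBas (n : ℕ) : ⇑(realBas n) = realBasis n := by
  ext i j
  rcases i with i | i <;>
  · simp only [realBas, Module.Basis.coe_ofEquivFun, realEquiv, realBasis]
    by_cases h : j = i <;> simp [h]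

/-- `g` is a real scalar product on `ℂⁿ` for which multiplication by `i` is an isometry. -/
structure IsHermScalar (g : Cn n → Cn n → ℝ) : Prop where
  add_left : ∀ a b c, g (a + b) c = g a c + g b c
  smul_left : ∀ (r : ℝ) a b, g (r • a) b = r * g a b
  symm : ∀ a b, g a b = g b a
  pos : ∀ a, a ≠ 0 → 0 < g a a
  isometry : ∀ a b, g (Complex.I • a) (Complex.I • b) = g a b

namespace IsHermScalar

variable {g : Cn n → Cn n → ℝ}

theorem add_right (hg : IsHermScalar g) (a b c : Cn n) : g a (b + c) = g a b + g a c := by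
  rw [hg.symm, hg.add_left, hg.symm b, hg.symm c]

theorem smul_right (hg : IsHermScalar g) (r : ℝ) (a b : Cn n) : g a (r • b) = r * g a b := by
  rw [hg.symm, hg.smul_left, hg.symm b]

/-- A scalar product as a bilinear map. -/
def toLin (hg : IsHermScalar g) : Cn n →ₗ[ℝ] Cn n →ₗ[ℝ] ℝ :=
  LinearMap.mk₂ ℝ g hg.add_left hg.smul_left hg.add_right hg.smul_right

@[simp] theorem toLin_apply (hg : IsHermScalar g) (a b : Cn n) : hg.toLin a b = g a b := rfl

/-- Pullback of a scalar product by a complex linear isomorphism. -/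
theorem comp (hg : IsHermScalar g) (A : Cn n →L[ℝ] Cn n) (hA : Function.Injective A)
    (hI : ∀ v, A (Complex.I • v) = Complex.I • A v) :
    IsHermScalar fun a b => g (A a) (A b) where
  add_left a b c := by simp [hg.add_left]
  smul_left r a b := by simp [hg.smul_left]
  symm a b := hg.symm _ _
  pos a ha := hg.pos _ fun h => ha (hA (by simpa using h))
  isometry a b := by simp [hI, hg.isometry]

end IsHermScalar

/-- An orthonormal frame of `ℂⁿ`, as a real Euclidean space with the scalar product `g`. -/
def IsFrame (g : Cn n → Cn n → ℝ) (f : Fin n ⊕ Fin n → Cn n) : Prop :=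
  ∀ l m, g (f l) (f m) = if l = m then 1 else 0

theorem gram_frame {g : Cn n → Cn n → ℝ} (hg : IsHermScalar g)
    (B : Fin n ⊕ Fin n → Fin n ⊕ Fin n → ℝ) (l m : Fin n ⊕ Fin n) :
    g (∑ j, B l j • realBasis n j) (∑ j, B m j • realBasis n j) =
      (Matrix.of B * gram g * (Matrix.of B).transpose) l m := by
  rw [← hg.toLin_apply, map_sum hg.toLin, LinearMap.sum_apply, Matrix.mul_assoc,
    Matrix.mul_apply]
  refine Finset.sum_congr rfl fun i _ => ?_
  rw [map_sum, Matrix.mul_apply, Finset.mul_sum]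
  refine Finset.sum_congr rfl fun j _ => ?_
  simp only [map_smul, LinearMap.smul_apply, smul_eq_mul, hg.toLin_apply, gram, Matrix.of_apply,
    Matrix.transpose_apply]
  ring

theorem exists_frame {g : Cn n → Cn n → ℝ} (hg : IsHermScalar g) : ∃ f, IsFrame g f := by
  obtain ⟨v, hv⟩ := LinearMap.BilinForm.exists_orthogonal_basis (K := ℝ) (V := Cn n) (B := hg.toLin)
    ⟨fun a b => by simpa using hg.symm a b⟩
  have hcard : Fintype.card (Fin n ⊕ Fin n) = Fintype.card (Fin (Module.finrank ℝ (Cn n))) := by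
    rw [Fintype.card_fin, Module.finrank_eq_card_basis (realBas n)]
  set w := v.reindex (Fintype.equivOfCardEq hcard).symm with hw
  have hpos : ∀ l, 0 < g (w l) (w l) := fun l => hg.pos _ (w.ne_zero l)
  refine ⟨fun l => (√(g (w l) (w l)))⁻¹ • w l, fun l m => ?_⟩
  rw [hg.smul_left, hg.smul_right]
  split_ifs with h
  · subst h
    have := Real.mul_self_sqrt (hpos l).le
    have h0 : √(g (w l) (w l)) ≠ 0 := (Real.sqrt_pos.2 (hpos l)).ne'
    field_simp
    rw [sq, this]
  · have : g (w l) (w m) = 0 := by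
      rw [hw, Module.Basis.reindex_apply, Module.Basis.reindex_apply]
      exact hv fun h' => h ((Equiv.symm _).symm.injective h')
    rw [this]; simp

/-- In an orthonormal frame the inner product of forms is a multiple of the sum of the products of
the coefficients. -/
theorem formInner_frame {V : Type*} [AddCommGroup V] [Module ℂ V] [TopologicalSpace V]
    {g : Cn n → Cn n → ℝ} (hg : IsHermScalar g) {f : Fin n ⊕ Fin n → Cn n} (hf : IsFrame g f)
    (h : V →ₗ[ℂ] V →ₗ⋆[ℂ] ℂ) (α β : Cn n [⋀^Fin k]→L[ℝ] V) :
    formInner g h α β = ((((2 : ℝ) ^ k * (k.factorial : ℝ))⁻¹ : ℝ) : ℂ) *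
      ∑ l : Fin k → Fin n ⊕ Fin n, h (α (f ∘ l)) (β (f ∘ l)) := by
  set B : Fin n ⊕ Fin n → Fin n ⊕ Fin n → ℝ := fun l j => (realBas n).repr (f l) j
  have hfB : ∀ l, f l = ∑ j, B l j • realBasis n j := fun l => by
    have := (realBas n).sum_repr (f l)
    simp only [coe_realBas] at this
    exact this.symm
  have h1 : Matrix.of B * gram g * (Matrix.of B).transpose = 1 := by
    ext l m
    rw [← gram_frame hg, Matrix.one_apply, ← hf l m, hfB l, hfB m]
  have h2 : (gram g)⁻¹ = (Matrix.of B).transpose * Matrix.of B := by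
    apply Matrix.inv_eq_right_inv
    rw [← Matrix.mul_assoc]
    rw [Matrix.mul_assoc] at h1
    exact mul_eq_one_comm.1 h1
  have hexp : ∀ (γ : Cn n [⋀^Fin k]→L[ℝ] V) (l : Fin k → Fin n ⊕ Fin n), γ (f ∘ l) =
      ∑ s : Fin k → Fin n ⊕ Fin n, (∏ a, B (l a) (s a)) • γ fun a => realBasis n (s a) := by
    intro γ l
    have : f ∘ l = fun a => ∑ j, B (l a) j • realBasis n j := by
      ext1 a; exact hfB (l a)
    rw [this]
    have h3 := γ.toMultilinearMap.map_sum (fun a j => B (l a) j • realBasis n j)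
    refine h3.trans (Finset.sum_congr rfl fun s _ => ?_)
    exact γ.toMultilinearMap.map_smul_univ (fun a => B (l a) (s a)) _
  have hre : ∀ (r r' : ℝ) (a b : V), h (r • a) (r' • b) = ((r * r' : ℝ) : ℂ) * h a b := by
    have e : ∀ (r : ℝ) (a : V), r • a = (r : ℂ) • a := fun r a => (Complex.coe_smul r a).symm
    intro r r' a b
    rw [e r a, e r' b, (h _).map_smulₛₗ, map_smul, LinearMap.smul_apply]
    simp only [Complex.conj_ofReal, smul_eq_mul, Complex.ofReal_mul]
    ring
  have h3 : ∀ i j, (gram g)⁻¹ i j = ∑ l, B l i * B l j := fun i j => by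
    rw [h2]; rfl
  have h4 : ∀ s t : Fin k → Fin n ⊕ Fin n, ∏ a, (gram g)⁻¹ (s a) (t a) =
      ∑ l : Fin k → Fin n ⊕ Fin n, (∏ a, B (l a) (s a)) * ∏ a, B (l a) (t a) := fun s t => by
    simp_rw [h3, Finset.prod_univ_sum, Fintype.piFinset_univ, ← Finset.prod_mul_distrib]
  have h6 : ((((2 : ℝ) ^ k * (k.factorial : ℝ))⁻¹ : ℝ) : ℂ) =
      ((2 : ℂ) ^ k * (k.factorial : ℂ))⁻¹ := by push_cast; rfl
  rw [formInner, h6]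
  congr 1
  have h5 : ∀ l : Fin k → Fin n ⊕ Fin n, h (α (f ∘ l)) (β (f ∘ l)) =
      ∑ s : Fin k → Fin n ⊕ Fin n, ∑ t : Fin k → Fin n ⊕ Fin n,
        (((∏ a, B (l a) (s a)) * ∏ a, B (l a) (t a) : ℝ) : ℂ) *
          h (α fun a => realBasis n (s a)) (β fun a => realBasis n (t a)) := fun l => by
    rw [hexp α, hexp β, map_sum h, LinearMap.sum_apply]
    refine Finset.sum_congr rfl fun s _ => ?_
    rw [map_sum]
    exact Finset.sum_congr rfl fun t _ => hre _ _ _ _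
  rw [Finset.sum_congr rfl fun l _ => h5 l]
  conv_rhs => rw [Finset.sum_comm]
  refine Finset.sum_congr rfl fun s _ => ?_
  conv_rhs => rw [Finset.sum_comm]
  refine Finset.sum_congr rfl fun t _ => ?_
  rw [h4, Complex.ofReal_sum, Finset.sum_mul]

theorem det_gram_ne_zero {g : Cn n → Cn n → ℝ} (hg : IsHermScalar g) : (gram g).det ≠ 0 := by
  obtain ⟨f, hf⟩ := exists_frame hg
  set B : Fin n ⊕ Fin n → Fin n ⊕ Fin n → ℝ := fun l j => (realBas n).repr (f l) j
  have hfB : ∀ l, f l = ∑ j, B l j • realBasis n j := fun l => by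
    have := (realBas n).sum_repr (f l)
    simp only [coe_realBas] at this
    exact this.symm
  have h1 : Matrix.of B * gram g * (Matrix.of B).transpose = 1 := by
    ext l m
    rw [← gram_frame hg, Matrix.one_apply, ← hf l m, hfB l, hfB m]
  intro h0
  have := congrArg Matrix.det h1
  simp [h0] at this

theorem formInner_congr {V W : Type*} [AddCommGroup V] [Module ℂ V] [TopologicalSpace V]
    [AddCommGroup W] [Module ℂ W] [TopologicalSpace W]
    (g : Cn n → Cn n → ℝ) {h : V →ₗ[ℂ] V →ₗ⋆[ℂ] ℂ} {h' : W →ₗ[ℂ] W →ₗ⋆[ℂ] ℂ}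
    {α β : Cn n [⋀^Fin k]→L[ℝ] V} {α' β' : Cn n [⋀^Fin k]→L[ℝ] W}
    (H : ∀ m m', h (α m) (β m') = h' (α' m) (β' m')) :
    formInner g h α β = formInner g h' α' β' := by
  simp only [formInner, H]

/-- The inner product of forms is invariant under complex linear isomorphisms of `ℂⁿ`. -/
theorem formInner_comp {V : Type*} [AddCommGroup V] [Module ℂ V] [TopologicalSpace V]
    {g : Cn n → Cn n → ℝ} (hg : IsHermScalar g) (A : Cn n →L[ℝ] Cn n)
    (hA : Function.Injective A) (hI : ∀ v, A (Complex.I • v) = Complex.I • A v)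
    (h : V →ₗ[ℂ] V →ₗ⋆[ℂ] ℂ) (α β : Cn n [⋀^Fin k]→L[ℝ] V) :
    formInner (fun a b => g (A a) (A b)) h (α.compContinuousLinearMap A)
      (β.compContinuousLinearMap A) = formInner g h α β := by
  obtain ⟨f, hf⟩ := exists_frame (hg.comp A hA hI)
  rw [formInner_frame (hg.comp A hA hI) hf, formInner_frame hg (f := A ∘ f) hf]
  rfl

/-- The multiple `α' = c α` is described by its values, because the target `V` (a fibre of the bundle)
need not be a topological module. -/
theorem formInner_smul_left {V : Type*} [AddCommGroup V] [Module ℂ V] [TopologicalSpace V]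
    (g : Cn n → Cn n → ℝ) (h : V →ₗ[ℂ] V →ₗ⋆[ℂ] ℂ) {α α' : Cn n [⋀^Fin k]→L[ℝ] V} (c : ℂ)
    (H : ∀ m, α' m = c • α m) (β : Cn n [⋀^Fin k]→L[ℝ] V) :
    formInner g h α' β = c * formInner g h α β := by
  simp only [formInner, H, map_smul, LinearMap.smul_apply, smul_eq_mul, Finset.mul_sum]
  refine Finset.sum_congr rfl fun s _ => Finset.sum_congr rfl fun t _ => ?_
  ring

theorem formInner_add_left {V : Type*} [AddCommGroup V] [Module ℂ V] [TopologicalSpace V]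
    (g : Cn n → Cn n → ℝ) (h : V →ₗ[ℂ] V →ₗ⋆[ℂ] ℂ) {α α₁ α₂ : Cn n [⋀^Fin k]→L[ℝ] V}
    (H : ∀ m, α m = α₁ m + α₂ m) (β : Cn n [⋀^Fin k]→L[ℝ] V) :
    formInner g h α β = formInner g h α₁ β + formInner g h α₂ β := by
  simp only [formInner, H, map_add, LinearMap.add_apply, ← mul_add, ← Finset.sum_add_distrib]

/-- `h` is a positive semidefinite hermitian form. -/
structure IsPosSemi {V : Type*} [AddCommGroup V] [Module ℂ V] (h : V →ₗ[ℂ] V →ₗ⋆[ℂ] ℂ) :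
    Prop where
  symm : ∀ ξ η, h η ξ = conj (h ξ η)
  nonneg : ∀ ξ, 0 ≤ (h ξ ξ).re

section Bounds

variable {V : Type*} [AddCommGroup V] [Module ℂ V] {h : V →ₗ[ℂ] V →ₗ⋆[ℂ] ℂ}

/-- The Cauchy–Schwarz inequality, combined with the inequality of means. -/
theorem IsPosSemi.norm_le (hh : IsPosSemi h) (ξ η : V) :
    ‖h ξ η‖ ≤ ((h ξ ξ).re + (h η η).re) / 2 := by
  by_cases hc : h ξ η = 0
  · rw [hc, norm_zero]
    have := hh.nonneg ξ
    have := hh.nonneg η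
    positivity
  -- rotate `η` by the phase of `h ξ η`
  set ζ : ℂ := h ξ η / ‖h ξ η‖ with hζ
  have hn : (‖h ξ η‖ : ℂ) ≠ 0 := by simpa using hc
  have h1 : conj ζ * h ξ η = ‖h ξ η‖ := by
    rw [hζ, map_div₀, Complex.conj_ofReal, div_mul_eq_mul_div, Complex.conj_mul', sq,
      mul_div_assoc, div_self hn, mul_one]
  have h2 : ζ * conj ζ = 1 := by
    rw [Complex.mul_conj', hζ, norm_div]
    simp [hc]
  have h3 : h (ξ - ζ • η) (ξ - ζ • η) =
      h ξ ξ - conj ζ * h ξ η - conj (conj ζ * h ξ η) + h η η := by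
    have e : h η ξ = conj (h ξ η) := hh.symm ξ η
    simp only [map_sub, LinearMap.sub_apply, map_smul, LinearMap.smul_apply,
      (h _).map_smulₛₗ, smul_eq_mul, map_mul, Complex.conj_conj, ← e]
    linear_combination (h η η) * h2
  have h4 := hh.nonneg (ξ - ζ • η)
  rw [h3, h1] at h4
  simp at h4
  linarith

variable [TopologicalSpace V] {g : Cn n → Cn n → ℝ}

theorem formInner_self_frame (hg : IsHermScalar g) {f : Fin n ⊕ Fin n → Cn n}
    (hf : IsFrame g f) (α : Cn n [⋀^Fin k]→L[ℝ] V) :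
    (formInner g h α α).re = ((2 : ℝ) ^ k * (k.factorial : ℝ))⁻¹ *
      ∑ l : Fin k → Fin n ⊕ Fin n, (h (α (f ∘ l)) (α (f ∘ l))).re := by
  rw [formInner_frame hg hf, Complex.re_ofReal_mul, Complex.re_sum]

theorem formInner_self_nonneg (hg : IsHermScalar g) (hh : IsPosSemi h)
    (α : Cn n [⋀^Fin k]→L[ℝ] V) : 0 ≤ (formInner g h α α).re := by
  obtain ⟨f, hf⟩ := exists_frame hg
  rw [formInner_self_frame hg hf]
  exact mul_nonneg (by positivity) (Finset.sum_nonneg fun l _ => hh.nonneg _)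

theorem norm_formInner_le (hg : IsHermScalar g) (hh : IsPosSemi h)
    (α β : Cn n [⋀^Fin k]→L[ℝ] V) :
    ‖formInner g h α β‖ ≤ ((formInner g h α α).re + (formInner g h β β).re) / 2 := by
  obtain ⟨f, hf⟩ := exists_frame hg
  rw [formInner_self_frame hg hf, formInner_self_frame hg hf, formInner_frame hg hf, norm_mul,
    Complex.norm_real, Real.norm_of_nonneg (by positivity), ← mul_add, mul_div_assoc,
    ← Finset.sum_add_distrib, Finset.sum_div]
  gcongr
  exact norm_sum_le_of_le _ fun l _ => hh.norm_le _ _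

end Bounds

/-- The pointwise estimate `|⟨θ ∧ α, β⟩| ≤ C |θ| (|α|² + |β|²)`, with a constant which depends only
on the dimension and the degree. -/
theorem norm_formInner_wedge_le {h : ℂ →ₗ[ℂ] ℂ →ₗ⋆[ℂ] ℂ} {g : Cn n → Cn n → ℝ}
    (hg : IsHermScalar g) (hh : IsPosSemi h) {θ : Cn n →L[ℝ] ℂ} {ε : ℝ} (hε : 0 ≤ ε)
    (hθ : ∀ v, ‖θ v‖ ≤ ε * √(g v v))
    (α : Cn n [⋀^Fin k]→L[ℝ] ℂ) (β : Cn n [⋀^Fin (k + 1)]→L[ℝ] ℂ) :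
    ‖formInner g h (wedge θ α) β‖ ≤
      ε * (n + k + 1) * ((formInner g h α α).re + (formInner g h β β).re) := by
  obtain ⟨f, hf⟩ := exists_frame hg
  have hθf : ∀ l, ‖θ (f l)‖ ≤ ε := fun l => by simpa [hf l l] using hθ (f l)
  have hα0 := formInner_self_nonneg hg hh α
  have hβ0 := formInner_self_nonneg hg hh β
  set P : (Fin k → Fin n ⊕ Fin n) → ℝ := fun s => (h (α (f ∘ s)) (α (f ∘ s))).re with hP
  set Q : (Fin (k + 1) → Fin n ⊕ Fin n) → ℝ := fun s => (h (β (f ∘ s)) (β (f ∘ s))).re with hQ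
  have hP0 : 0 ≤ ∑ s, P s := Finset.sum_nonneg fun l _ => hh.nonneg _
  have hQ0 : 0 ≤ ∑ s, Q s := Finset.sum_nonneg fun l _ => hh.nonneg _
  have hterm : ∀ s : Fin (k + 1) → Fin n ⊕ Fin n, ‖h (wedge θ α (f ∘ s)) (β (f ∘ s))‖ ≤
      ∑ r : Fin (k + 1), ε * ((P (r.removeNth s) + Q s) / 2) := by
    intro s
    rw [wedge, ContinuousAlternatingMap.alternatizeUncurryFin_apply, map_sum, LinearMap.sum_apply]
    refine norm_sum_le_of_le _ fun r _ => ?_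
    have e1 : ((-1 : ℤ) ^ (r : ℕ)) • (θ.smulRight α) ((f ∘ s) r) (r.removeNth (f ∘ s)) =
        ((-1 : ℂ) ^ (r : ℕ) * θ (f (s r))) • (α (f ∘ r.removeNth s)) := by
      have e0 : r.removeNth (f ∘ s) = f ∘ r.removeNth s := rfl
      simp [mul_assoc, e0]
    rw [e1, map_smul, LinearMap.smul_apply, smul_eq_mul, norm_mul, norm_mul, norm_pow, norm_neg,
      norm_one, one_pow, one_mul]
    gcongr
    · exact hθf _
    · exact hh.norm_le _ _
  have hsum : ∀ r : Fin (k + 1), ∑ s : Fin (k + 1) → Fin n ⊕ Fin n, P (r.removeNth s) =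
      (2 * n) * ∑ s, P s := by
    intro r
    rw [← (Fin.insertNthEquiv (fun _ => Fin n ⊕ Fin n) r).sum_comp, Fintype.sum_prod_type]
    simp only [Fin.insertNthEquiv, Equiv.coe_fn_mk, Fin.removeNth_insertNth, Finset.sum_const,
      Finset.card_univ, Fintype.card_sum, Fintype.card_fin, nsmul_eq_mul]
    push_cast
    ring
  rw [formInner_self_frame hg hf, formInner_self_frame hg hf, formInner_frame hg hf, norm_mul,
    Complex.norm_real, Real.norm_of_nonneg (by positivity)]
  have h1 : ‖∑ s : Fin (k + 1) → Fin n ⊕ Fin n, h (wedge θ α (f ∘ s)) (β (f ∘ s))‖ ≤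
      ε * (k + 1) * (n * ∑ s, P s + (∑ s, Q s) / 2) := by
    refine (norm_sum_le_of_le _ fun s _ => hterm s).trans (le_of_eq ?_)
    rw [Finset.sum_comm]
    simp only [← Finset.mul_sum, ← Finset.sum_div, Finset.sum_add_distrib, hsum]
    simp
    ring
  have h2 : ((2 : ℝ) ^ (k + 1) * ((k + 1).factorial : ℝ))⁻¹ * (k + 1) =
      ((2 : ℝ) ^ k * (k.factorial : ℝ))⁻¹ / 2 := by
    rw [Nat.factorial_succ]
    have hk' : ((k : ℝ) + 1) ≠ 0 := by positivity
    push_cast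
    field_simp
    ring
  have c0 : 0 ≤ ((2 : ℝ) ^ k * (k.factorial : ℝ))⁻¹ := by positivity
  have c1 : 0 ≤ ((2 : ℝ) ^ (k + 1) * ((k + 1).factorial : ℝ))⁻¹ := by positivity
  set C := ((2 : ℝ) ^ k * (k.factorial : ℝ))⁻¹
  set C' := ((2 : ℝ) ^ (k + 1) * ((k + 1).factorial : ℝ))⁻¹
  calc _ ≤ C' * (ε * (k + 1) * (n * ∑ s, P s + (∑ s, Q s) / 2)) := by gcongr
    _ = ε * ((C' * (k + 1)) * n * (∑ s, P s) + (k + 1) * (C' * ∑ s, Q s) / 2) := by ring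
    _ = ε * (n * (C * ∑ s, P s) / 2 + (k + 1) * (C' * ∑ s, Q s) / 2) := by rw [h2]; ring
    _ ≤ ε * ((n + k + 1) * (C * ∑ s, P s) + (n + k + 1) * (C' * ∑ s, Q s)) := by
      have a1 : 0 ≤ C * ∑ s, P s := mul_nonneg c0 hP0
      have a2 : 0 ≤ C' * ∑ s, Q s := mul_nonneg c1 hQ0
      gcongr ε * (?_ + ?_)
      · nlinarith [mul_nonneg (Nat.cast_nonneg (α := ℝ) n) a1,
          mul_nonneg (Nat.cast_nonneg (α := ℝ) k) a1]
      · nlinarith [mul_nonneg (Nat.cast_nonneg (α := ℝ) n) a2,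
          mul_nonneg (Nat.cast_nonneg (α := ℝ) k) a2]
    _ = _ := by ring

/-- `|∂̄f|` is bounded by `|df|`, since multiplication by `i` is an isometry. -/
theorem norm_antilinearPart_le {g : Cn n → Cn n → ℝ} (hg : IsHermScalar g) {D : Cn n →L[ℝ] ℝ}
    {ε : ℝ} (hD : ∀ v, |D v| ≤ ε * √(g v v)) (v : Cn n) :
    ‖antilinearPart (Complex.ofRealCLM.comp D) v‖ ≤ ε * √(g v v) := by
  have h1 := hD v
  have h2 := hD (Complex.I • v)
  rw [hg.isometry] at h2
  have : antilinearPart (Complex.ofRealCLM.comp D) v =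
      2⁻¹ * ((D v : ℂ) + Complex.I * (D (Complex.I • v) : ℂ)) := by
    simp [antilinearPart, mul_add]
  rw [this, norm_mul]
  calc ‖(2⁻¹ : ℂ)‖ * ‖(D v : ℂ) + Complex.I * (D (Complex.I • v) : ℂ)‖
      ≤ 2⁻¹ * (|D v| + |D (Complex.I • v)|) := by
        gcongr
        · simp
        · refine (norm_add_le _ _).trans (le_of_eq ?_)
          simp
    _ ≤ _ := by linarith

theorem continuousOn_formInner {T : Type*} [TopologicalSpace T] {S : Set T}
    {g : T → Cn n → Cn n → ℝ} {h : T → ℂ →ₗ[ℂ] ℂ →ₗ⋆[ℂ] ℂ}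
    {α β : T → Cn n [⋀^Fin k]→L[ℝ] ℂ} (hg : ∀ a b, ContinuousOn (fun z => g z a b) S)
    (hdet : ∀ z ∈ S, (gram (g z)).det ≠ 0) (hh : ContinuousOn (fun z => h z 1 1) S)
    (hα : ContinuousOn α S) (hβ : ContinuousOn β S) :
    ContinuousOn (fun z => formInner (g z) (h z) (α z) (β z)) S := by
  have hG : ContinuousOn (fun z => gram (g z)) S :=
    continuousOn_pi.2 fun i => continuousOn_pi.2 fun j => hg _ _
  have hinv : ContinuousOn (fun z => (gram (g z))⁻¹) S := by
    simp only [Matrix.inv_def, Ring.inverse_eq_inv']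
    have hadj : Continuous fun M : Matrix (Fin n ⊕ Fin n) (Fin n ⊕ Fin n) ℝ => M.adjugate :=
      continuous_id.matrix_adjugate
    have hd : Continuous fun M : Matrix (Fin n ⊕ Fin n) (Fin n ⊕ Fin n) ℝ => M.det :=
      continuous_id.matrix_det
    have hdc : ContinuousOn (fun z => ((gram (g z)).det)⁻¹) S :=
      (hd.comp_continuousOn hG).inv₀ hdet
    exact hdc.smul (hadj.comp_continuousOn hG)
  have hval : ∀ z ξ η, h z ξ η = ξ * conj η * h z 1 1 := fun z ξ η => by
    have e1 : h z ξ η = h z (ξ • 1) (η • 1) := by simp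
    rw [e1, (h z _).map_smulₛₗ, map_smul, LinearMap.smul_apply]
    simp only [smul_eq_mul]
    ring
  have e2 : (fun z => formInner (g z) (h z) (α z) (β z)) = fun z =>
      ((2 : ℂ) ^ k * (k.factorial : ℂ))⁻¹ *
        ∑ s : Fin k → Fin n ⊕ Fin n, ∑ t : Fin k → Fin n ⊕ Fin n,
          ((∏ a, (gram (g z))⁻¹ (s a) (t a) : ℝ) : ℂ) *
            ((α z fun a => realBasis n (s a)) * conj (β z fun a => realBasis n (t a)) *
              h z 1 1) := by
    ext z
    rw [formInner]
    congr 1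
    exact Finset.sum_congr rfl fun s _ => Finset.sum_congr rfl fun t _ => by rw [hval z]
  rw [e2]
  refine continuousOn_const.mul (continuousOn_finsetSum _ fun s _ =>
    continuousOn_finsetSum _ fun t _ => ?_)
  refine ContinuousOn.mul ?_ ((ContinuousOn.mul ?_ ?_).mul hh)
  · refine Complex.continuous_ofReal.comp_continuousOn (continuousOn_finsetProd _ fun a _ => ?_)
    exact continuousOn_pi.1 (continuousOn_pi.1 hinv _) _
  · exact (ContinuousAlternatingMap.apply ℝ (Cn n) ℂ _).continuous.comp_continuousOn hα
  · exact Complex.continuous_conj.comp_continuousOn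
      ((ContinuousAlternatingMap.apply ℝ (Cn n) ℂ _).continuous.comp_continuousOn hβ)

end LinearAlgebra

/-! ### The operator `∂̄` on forms on `ℂⁿ` -/

section DbarOp

variable {n k : ℕ}

theorem antilinearPart_apply {V : Type*} [NormedAddCommGroup V] [NormedSpace ℂ V]
    (A : Cn n →L[ℝ] V) (v : Cn n) :
    antilinearPart A v = (2⁻¹ : ℂ) • (A v + Complex.I • A (Complex.I • v)) := by
  simp [antilinearPart]

/-- The operator `∂̄` on complex valued forms on `ℂⁿ`. -/
def dbarOp (β : Cn n → Cn n [⋀^Fin k]→L[ℝ] ℂ) (z : Cn n) : Cn n [⋀^Fin (k + 1)]→L[ℝ] ℂ :=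
  ContinuousAlternatingMap.alternatizeUncurryFin (antilinearPart (fderiv ℝ β z))

theorem dbarOp_congr {β β' : Cn n → Cn n [⋀^Fin k]→L[ℝ] ℂ} {z : Cn n} (h : β =ᶠ[𝓝 z] β') :
    dbarOp β z = dbarOp β' z := by
  rw [dbarOp, dbarOp, h.fderiv_eq]

theorem antilinearPart_add {V : Type*} [NormedAddCommGroup V] [NormedSpace ℂ V]
    (A B : Cn n →L[ℝ] V) : antilinearPart (A + B) = antilinearPart A + antilinearPart B := by
  ext v
  simp only [antilinearPart_apply, add_apply]
  module

theorem antilinearPart_smul {V : Type*} [NormedAddCommGroup V] [NormedSpace ℂ V]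
    (c : ℂ) (A : Cn n →L[ℝ] V) : antilinearPart (c • A) = c • antilinearPart A := by
  ext v
  simp only [antilinearPart_apply, smul_apply]
  module

theorem antilinearPart_eq_zero {V : Type*} [NormedAddCommGroup V] [NormedSpace ℂ V]
    {A : Cn n →L[ℝ] V} (hA : ∀ v, A (Complex.I • v) = Complex.I • A v) :
    antilinearPart A = 0 := by
  ext v
  simp [antilinearPart_apply, hA, smul_smul]

theorem antilinearPart_smulRight {V : Type*} [NormedAddCommGroup V] [NormedSpace ℂ V]
    (A : Cn n →L[ℝ] ℂ) (w : V) :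
    antilinearPart (A.smulRight w) = (antilinearPart A).smulRight w := by
  ext v
  simp only [antilinearPart_apply, ContinuousLinearMap.smulRight_apply, smul_eq_mul]
  module

theorem wedge_zero_left (α : Cn n [⋀^Fin k]→L[ℝ] ℂ) : wedge 0 α = 0 := by
  ext m
  simp [wedge, ContinuousAlternatingMap.alternatizeUncurryFin_apply]

/-- The Leibniz rule for `∂̄`. -/
theorem dbarOp_smul {ξ : Cn n → ℂ} {β : Cn n → Cn n [⋀^Fin k]→L[ℝ] ℂ} {z : Cn n}
    (hξ : DifferentiableAt ℝ ξ z) (hβ : DifferentiableAt ℝ β z) :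
    dbarOp (fun w => ξ w • β w) z =
      ξ z • dbarOp β z + wedge (antilinearPart (fderiv ℝ ξ z)) (β z) := by
  rw [dbarOp, fderiv_fun_smul hξ hβ, antilinearPart_add, antilinearPart_smul,
    antilinearPart_smulRight, ContinuousAlternatingMap.alternatizeUncurryFin_add,
    ContinuousAlternatingMap.alternatizeUncurryFin_smul]
  rfl

/-- `∂̄` commutes with the pullback by a holomorphic map. The second derivatives of the map do not
contribute because they are symmetric. -/
theorem dbarOp_pullback {τ : Cn n → Cn n} {α : Cn n → Cn n [⋀^Fin k]→L[ℝ] ℂ} {z : Cn n}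
    (hα : DifferentiableAt ℝ α (τ z)) (hτ : ContDiffAt ℝ 2 τ z)
    (hI : ∀ᶠ w in 𝓝 z, ∀ v, fderiv ℝ τ w (Complex.I • v) = Complex.I • fderiv ℝ τ w v) :
    dbarOp (fun w => (α (τ w)).compContinuousLinearMap (fderiv ℝ τ w)) z =
      (dbarOp α (τ z)).compContinuousLinearMap (fderiv ℝ τ z) := by
  have hdτ : DifferentiableAt ℝ τ z := hτ.differentiableAt two_ne_zero
  have hd2 : DifferentiableAt ℝ (fderiv ℝ τ) z :=
    (hτ.fderiv_right (m := 1) (by norm_num)).differentiableAt one_ne_zero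
  have hsymm : ∀ v w, fderiv ℝ (fderiv ℝ τ) z v w = fderiv ℝ (fderiv ℝ τ) z w v :=
    fun v w => hτ.isSymmSndFDerivAt (by simp) v w
  have hI' : ∀ v w, fderiv ℝ (fderiv ℝ τ) z (Complex.I • v) w =
      Complex.I • fderiv ℝ (fderiv ℝ τ) z v w := by
    intro v w
    rw [hsymm, hsymm v w]
    have h1 : (fun y => fderiv ℝ τ y (Complex.I • v)) =ᶠ[𝓝 z]
        fun y => Complex.I • fderiv ℝ τ y v := by
      filter_upwards [hI] with y hy using hy v
    have h2 := h1.fderiv_eq (𝕜 := ℝ)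
    rw [fderiv_clm_apply hd2 (differentiableAt_const _),
      fderiv_fun_const_smul (hd2.clm_apply (differentiableAt_const v)),
      fderiv_clm_apply hd2 (differentiableAt_const _)] at h2
    simpa using congrArg (fun L => L w) h2
  set H := fderiv ℝ (fderiv ℝ τ) z with hH
  set T := fderiv ℝ τ z with hT
  set IH : Cn n →L[ℝ] Cn n →L[ℝ] Cn n := Complex.I • H with hIH
  have hz := hI.self_of_nhds
  rw [dbarOp, fderiv_continuousAlternatingMapCompContinuousLinearMap
    (by exact hα.comp z hdτ) hd2, antilinearPart_add,
    ContinuousAlternatingMap.alternatizeUncurryFin_add]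
  have e1 : antilinearPart (((α (τ z)).fderivCompContinuousLinearMap T) ∘L H) =
      (2⁻¹ : ℂ) • (((α (τ z)).fderivCompContinuousLinearMap T) ∘L H +
        Complex.I • (((α (τ z)).fderivCompContinuousLinearMap T) ∘L IH)) := by
    ext1 v
    rw [antilinearPart_apply]
    have : H (Complex.I • v) = IH v := by
      ext1 w
      exact hI' v w
    simp [this]
  -- the terms with second derivatives of `τ` are symmetric, hence vanish after alternatization
  have e2 : ContinuousAlternatingMap.alternatizeUncurryFin
      (antilinearPart (((α (τ z)).fderivCompContinuousLinearMap T) ∘L H)) = 0 := by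
    rw [e1, ContinuousAlternatingMap.alternatizeUncurryFin_smul,
      ContinuousAlternatingMap.alternatizeUncurryFin_add,
      ContinuousAlternatingMap.alternatizeUncurryFin_smul,
      ContinuousAlternatingMap.alternatizeUncurryFin_fderivCompContinuousLinearMap_eq_zero _ _ hsymm,
      ContinuousAlternatingMap.alternatizeUncurryFin_fderivCompContinuousLinearMap_eq_zero]
    · simp
    · intro v w
      change Complex.I • H v w = Complex.I • H w v
      rw [hsymm]
  rw [e2, add_zero, fderiv_fun_comp _ hα hdτ]
  ext m
  rw [ContinuousAlternatingMap.compContinuousLinearMap_apply, dbarOp,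
    ContinuousAlternatingMap.alternatizeUncurryFin_apply,
    ContinuousAlternatingMap.alternatizeUncurryFin_apply]
  refine Finset.sum_congr rfl fun i _ => ?_
  rw [antilinearPart_apply, antilinearPart_apply]
  have e0 : i.removeNth (T ∘ m) = T ∘ i.removeNth m := rfl
  rw [← hT] at hz
  simp [hz, ← hT, e0]

end DbarOp

/-! ### Charts of a complex manifold -/

section Charts

variable {n : ℕ} {X : Type*} [TopologicalSpace X] [ChartedSpace (Cn n) X]

/-- The transition map between the preferred charts at `x₀` and `x₁`. -/
def trans (x₀ x₁ : X) (z : Cn n) : Cn n := chartAt (Cn n) x₁ ((chartAt (Cn n) x₀).symm z)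

/-- The domain of the transition map `trans x₀ x₁`. -/
def transDom (x₀ x₁ : X) : Set (Cn n) :=
  {z ∈ (chartAt (Cn n) x₀).target | (chartAt (Cn n) x₀).symm z ∈ (chartAt (Cn n) x₁).source}

theorem isOpen_chart_preimage (x₀ : X) {U : Set X} (hU : IsOpen U) :
    IsOpen {z ∈ (chartAt (Cn n) x₀).target | (chartAt (Cn n) x₀).symm z ∈ U} :=
  (chartAt (Cn n) x₀).symm.isOpen_inter_preimage hU

theorem isOpen_transDom (x₀ x₁ : X) : IsOpen (transDom (n := n) x₀ x₁) :=
  isOpen_chart_preimage x₀ (chartAt (Cn n) x₁).open_source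

theorem mfderiv_eq_fderiv_chart {W : Type*} [NormedAddCommGroup W] [NormedSpace ℝ W] {f : W → X}
    {w : W} (hf : MDifferentiableAt 𝓘(ℝ, W) 𝓘(ℝ, Cn n) f w) :
    mfderiv 𝓘(ℝ, W) 𝓘(ℝ, Cn n) f w = fderiv ℝ (fun w' => chartAt (Cn n) (f w) (f w')) w := by
  rw [hf.mfderiv]
  simp [writtenInExtChartAt, Function.comp_def, chartAt_self_eq]
  rfl

theorem mfderiv_eq_fderiv_chart_symm {W : Type*} [NormedAddCommGroup W] [NormedSpace ℝ W]
    {f : X → W} {x : X} (hf : MDifferentiableAt 𝓘(ℝ, Cn n) 𝓘(ℝ, W) f x) :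
    mfderiv 𝓘(ℝ, Cn n) 𝓘(ℝ, W) f x =
      fderiv ℝ (fun z => f ((chartAt (Cn n) x).symm z)) (chartAt (Cn n) x x) := by
  rw [hf.mfderiv]
  simp [writtenInExtChartAt, Function.comp_def, chartAt_self_eq]
  rfl

theorem update_pair_zero (a b c : Cn n) :
    Function.update ![a, b] 0 c = ![c, b] := by
  ext i; fin_cases i <;> simp

theorem IsPositiveForm.isHermScalar {Y : Set X} {om : X → Cn n [⋀^Fin 2]→L[ℝ] ℝ}
    (hom : IsPositiveForm Y om) {x : X} (hx : x ∈ Y) : IsHermScalar (metricOf om x) where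
  add_left a b c := by
    have h := (om x).toMultilinearMap.map_update_add ![a, Complex.I • c] 0 a b
    rwa [update_pair_zero, update_pair_zero, update_pair_zero] at h
  smul_left r a b := by
    have h := (om x).toMultilinearMap.map_update_smul ![a, Complex.I • b] 0 r a
    rwa [update_pair_zero, update_pair_zero] at h
  symm a b := by
    have h1 := hom.type_one_one x hx (Complex.I • a) b
    have h2 : om x ![Complex.I • a, b] = - om x ![b, Complex.I • a] := by
      have := (om x).toAlternatingMap.map_swap ![b, Complex.I • a] (i := 0) (j := 1) (by simp)
      rw [← ContinuousAlternatingMap.coe_toAlternatingMap, ← this]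
      congr 1
      ext i; fin_cases i <;> simp
    have h3 : om x ![-a, Complex.I • b] = - om x ![a, Complex.I • b] := by
      have h := (om x).toMultilinearMap.map_update_smul ![a, Complex.I • b] 0 (-1) a
      rw [update_pair_zero, update_pair_zero, neg_one_smul, neg_one_smul] at h
      exact h
    rw [smul_smul, Complex.I_mul_I, neg_one_smul, h3, h2] at h1
    simpa [metricOf] using h1
  pos a ha := hom.pos x hx a ha
  isometry a b := hom.type_one_one x hx a _

/-- The differential of a real function, as a linear form on the model space. -/
def dReal (f : X → ℝ) (x : X) : Cn n →L[ℝ] ℝ := mfderiv 𝓘(ℝ, Cn n) 𝓘(ℝ, ℝ) f x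

theorem dbarFun_eq (f : X → ℝ) (x : X) :
    dbarFun (n := n) f x = antilinearPart (Complex.ofRealCLM.comp (dReal f x)) := rfl

variable [IsManifold 𝓘(ℂ, Cn n) ω X]

theorem contDiffOn_trans_complex (x₀ x₁ : X) :
    ContDiffOn ℂ ω (trans (n := n) x₀ x₁) (transDom x₀ x₁) := by
  have h := contDiffOn_ext_coord_change (𝕜 := ℂ) (I := 𝓘(ℂ, Cn n)) (n := ω) x₁ x₀
  refine h.congr_mono (fun z hz => ?_) fun z hz => ?_
  · simp [trans]
  · simpa [transDom] using hz

/-- The real manifold underlying a complex manifold. -/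
instance realManifold : IsManifold 𝓘(ℝ, Cn n) ∞ X := by
  refine isManifold_of_contDiffOn _ _ _ fun e e' he he' => ?_
  have h := (contDiffGroupoid ω 𝓘(ℂ, Cn n)).compatible he he'
  rw [contDiffGroupoid, mem_groupoid_of_pregroupoid] at h
  have h1 : ContDiffOn ℂ ω (e.symm ≫ₕ e') (e.symm ≫ₕ e').source := by
    simpa [contDiffPregroupoid] using h.1
  simpa using (h1.restrict_scalars ℝ).of_le le_top

theorem contDiffOn_trans (x₀ x₁ : X) :
    ContDiffOn ℝ ∞ (trans (n := n) x₀ x₁) (transDom x₀ x₁) :=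
  ((contDiffOn_trans_complex x₀ x₁).restrict_scalars ℝ).of_le le_top

/-- Transition maps are holomorphic. -/
theorem fderiv_trans_I_smul {x₀ x₁ : X} {z : Cn n} (hz : z ∈ transDom x₀ x₁) (v : Cn n) :
    fderiv ℝ (trans x₀ x₁) z (Complex.I • v) = Complex.I • fderiv ℝ (trans x₀ x₁) z v := by
  have h : DifferentiableAt ℂ (trans x₀ x₁) z :=
    ((contDiffOn_trans_complex x₀ x₁).contDiffAt
      ((isOpen_transDom x₀ x₁).mem_nhds hz)).differentiableAt (by simp)
  rw [h.fderiv_restrictScalars ℝ]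
  simp

theorem mdifferentiableAt_chart_symm {x₀ : X} {z : Cn n} (hz : z ∈ (chartAt (Cn n) x₀).target) :
    MDifferentiableAt 𝓘(ℝ, Cn n) 𝓘(ℝ, Cn n) (chartAt (Cn n) x₀).symm z :=
  ((contMDiffOn_chart_symm (I := 𝓘(ℝ, Cn n)) (n := ∞)).contMDiffAt
    ((chartAt (Cn n) x₀).open_target.mem_nhds hz)).mdifferentiableAt (by simp)

theorem mdifferentiableAt_chart {x₀ x : X} (hx : x ∈ (chartAt (Cn n) x₀).source) :
    MDifferentiableAt 𝓘(ℝ, Cn n) 𝓘(ℝ, Cn n) (chartAt (Cn n) x₀) x :=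
  ((contMDiffOn_chart (I := 𝓘(ℝ, Cn n)) (n := ∞)).contMDiffAt
    ((chartAt (Cn n) x₀).open_source.mem_nhds hx)).mdifferentiableAt (by simp)

theorem chartSymmDeriv_eq {x₀ : X} {z : Cn n} (hz : z ∈ (chartAt (Cn n) x₀).target) :
    chartSymmDeriv x₀ z = fderiv ℝ (trans x₀ ((chartAt (Cn n) x₀).symm z)) z :=
  mfderiv_eq_fderiv_chart (mdifferentiableAt_chart_symm hz)

theorem chartSymmDeriv_I_smul {x₀ : X} {z : Cn n} (hz : z ∈ (chartAt (Cn n) x₀).target)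
    (v : Cn n) : chartSymmDeriv x₀ z (Complex.I • v) = Complex.I • chartSymmDeriv x₀ z v := by
  rw [chartSymmDeriv_eq hz]
  exact fderiv_trans_I_smul ⟨hz, mem_chart_source _ _⟩ v

theorem chartSymmDeriv_self (x : X) :
    chartSymmDeriv x (chartAt (Cn n) x x) = ContinuousLinearMap.id ℝ (Cn n) := by
  have hz := mem_chart_target (Cn n) x
  rw [chartSymmDeriv_eq hz, (chartAt (Cn n) x).left_inv (mem_chart_source _ x)]
  have : trans x x =ᶠ[𝓝 (chartAt (Cn n) x x)] id := by
    filter_upwards [(chartAt (Cn n) x).open_target.mem_nhds hz] with w hw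
    exact (chartAt (Cn n) x).right_inv hw
  rw [this.fderiv_eq, fderiv_id]

theorem chartSymmDeriv_trans {x₀ x₁ : X} {z : Cn n} (hz : z ∈ transDom x₀ x₁) :
    chartSymmDeriv x₀ z = (chartSymmDeriv x₁ (trans x₀ x₁ z)).comp (fderiv ℝ (trans x₀ x₁) z) := by
  have h1 : (chartAt (Cn n) x₀).symm =ᶠ[𝓝 z] (chartAt (Cn n) x₁).symm ∘ trans x₀ x₁ := by
    filter_upwards [(isOpen_transDom x₀ x₁).mem_nhds hz] with w hw
    exact ((chartAt (Cn n) x₁).left_inv hw.2).symm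
  have h2 : trans x₀ x₁ z ∈ (chartAt (Cn n) x₁).target := (chartAt (Cn n) x₁).map_source hz.2
  have h3 : DifferentiableAt ℝ (trans x₀ x₁) z :=
    ((contDiffOn_trans x₀ x₁).contDiffAt ((isOpen_transDom x₀ x₁).mem_nhds hz)).differentiableAt
      (by simp)
  rw [chartSymmDeriv, h1.mfderiv_eq, mfderiv_comp z (mdifferentiableAt_chart_symm h2)
    h3.mdifferentiableAt, mfderiv_eq_fderiv]
  rfl

theorem mfderiv_chart_comp_chartSymmDeriv {x₀ : X} {z : Cn n}
    (hz : z ∈ (chartAt (Cn n) x₀).target) (v : Cn n) :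
    (mfderiv 𝓘(ℝ, Cn n) 𝓘(ℝ, Cn n) (chartAt (Cn n) x₀) ((chartAt (Cn n) x₀).symm z) :
      Cn n →L[ℝ] Cn n) (chartSymmDeriv x₀ z v) = v := by
  have h1 : chartAt (Cn n) x₀ ∘ (chartAt (Cn n) x₀).symm =ᶠ[𝓝 z] id := by
    filter_upwards [(chartAt (Cn n) x₀).open_target.mem_nhds hz] with w hw
    exact (chartAt (Cn n) x₀).right_inv hw
  have h2 := mfderiv_comp z (mdifferentiableAt_chart ((chartAt (Cn n) x₀).map_target hz))
    (mdifferentiableAt_chart_symm hz)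
  rw [h1.mfderiv_eq, mfderiv_id] at h2
  exact (congrArg (fun L : Cn n →L[ℝ] Cn n => L v) h2).symm

theorem chartSymmDeriv_injective {x₀ : X} {z : Cn n} (hz : z ∈ (chartAt (Cn n) x₀).target) :
    Function.Injective (chartSymmDeriv x₀ z) :=
  Function.LeftInverse.injective (mfderiv_chart_comp_chartSymmDeriv hz)

theorem chartSymmDeriv_surjective {x₀ : X} {z : Cn n} (hz : z ∈ (chartAt (Cn n) x₀).target) :
    Function.Surjective (chartSymmDeriv x₀ z) :=
  LinearMap.injective_iff_surjective.1
    (show Function.Injective (chartSymmDeriv x₀ z : Cn n →ₗ[ℝ] Cn n) from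
      chartSymmDeriv_injective hz)

/-- The derivative of a function in a chart. -/
theorem fderiv_comp_chart_symm {W : Type*} [NormedAddCommGroup W] [NormedSpace ℝ W] {f : X → W}
    {x₀ : X} {z : Cn n} (hz : z ∈ (chartAt (Cn n) x₀).target)
    (hf : MDifferentiableAt 𝓘(ℝ, Cn n) 𝓘(ℝ, W) f ((chartAt (Cn n) x₀).symm z)) (v : Cn n) :
    fderiv ℝ (fun w => f ((chartAt (Cn n) x₀).symm w)) z v =
      (mfderiv 𝓘(ℝ, Cn n) 𝓘(ℝ, W) f ((chartAt (Cn n) x₀).symm z) : Cn n →L[ℝ] W)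
        (chartSymmDeriv x₀ z v) := by
  rw [← mfderiv_eq_fderiv]
  have := mfderiv_comp z hf (mdifferentiableAt_chart_symm hz)
  exact congrArg (fun L : Cn n →L[ℝ] W => L v) this

end Charts

/-! ### Forms with values in a line bundle in charts and trivializations -/

section BundleForms

variable {n k : ℕ} {X : Type*} [TopologicalSpace X] [ChartedSpace (Cn n) X]
  {F : X → Type*} [∀ x, AddCommGroup (F x)] [∀ x, Module ℂ (F x)] [∀ x, TopologicalSpace (F x)]
  [TopologicalSpace (TotalSpace ℂ F)] [FiberBundle ℂ F] [VectorBundle ℂ ℂ F]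

theorem fiberCoordSymm_fiberCoord (x : X) (w : F x) : fiberCoordSymm x (fiberCoord x x w) = w :=
  (trivializationAt ℂ F x).symmL_continuousLinearMapAt (mem_baseSet_trivializationAt ℂ F x) w

theorem fiberCoord_fiberCoordSymm (x : X) (w : ℂ) : fiberCoord (F := F) x x (fiberCoordSymm x w) = w :=
  (trivializationAt ℂ F x).continuousLinearMapAt_symmL (mem_baseSet_trivializationAt ℂ F x) w

theorem fiberCoord_smul (x₀ y : X) (c : ℂ) (w : F y) :
    fiberCoord x₀ y (c • w) = c * fiberCoord x₀ y w :=
  ((trivializationAt ℂ F x₀).continuousLinearMapAt ℂ y).map_smul c w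

theorem fiberCoordSymm_smul (x : X) (c w : ℂ) :
    fiberCoordSymm (F := F) x (c * w) = c • fiberCoordSymm x w :=
  ((trivializationAt ℂ F x).symmL ℂ x).map_smul c w

/-- The domain, in the chart at `x₀`, of the local representation of a form on `Y`. -/
def repDom (F : X → Type*) [∀ x, TopologicalSpace (F x)] [TopologicalSpace (TotalSpace ℂ F)]
    [FiberBundle ℂ F] (Y : Set X) (x₀ : X) : Set (Cn n) :=
  {z ∈ (chartAt (Cn n) x₀).target |
    (chartAt (Cn n) x₀).symm z ∈ Y ∩ (trivializationAt ℂ F x₀).baseSet}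

theorem isOpen_repDom {Y : Set X} (hY : IsOpen Y) (x₀ : X) : IsOpen (repDom (n := n) F Y x₀) :=
  isOpen_chart_preimage x₀ (hY.inter (trivializationAt ℂ F x₀).open_baseSet)

/-- The transition function of the line bundle between the preferred trivializations at `x₀`
and `x₁`. -/
def bundleTrans (F : X → Type*) [∀ x, AddCommGroup (F x)] [∀ x, Module ℂ (F x)]
    [∀ x, TopologicalSpace (F x)] [TopologicalSpace (TotalSpace ℂ F)] [FiberBundle ℂ F]
    [VectorBundle ℂ ℂ F] (x₀ x₁ : X) (y : X) : ℂ :=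
  ((trivializationAt ℂ F x₀).coordChangeL ℂ (trivializationAt ℂ F x₁) y : ℂ →L[ℂ] ℂ) 1

theorem fiberCoord_eq_bundleTrans {x₀ x₁ y : X} (h₀ : y ∈ (trivializationAt ℂ F x₀).baseSet)
    (h₁ : y ∈ (trivializationAt ℂ F x₁).baseSet) (w : F y) :
    fiberCoord x₁ y w = bundleTrans F x₀ x₁ y * fiberCoord x₀ y w := by
  set L : ℂ ≃L[ℂ] ℂ := (trivializationAt ℂ F x₀).coordChangeL ℂ (trivializationAt ℂ F x₁) y
  have h1 : L (fiberCoord x₀ y w) = fiberCoord x₁ y w := by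
    have e := (trivializationAt ℂ F x₀).coordChangeL_apply (R := ℂ) (trivializationAt ℂ F x₁)
      ⟨h₀, h₁⟩ (fiberCoord x₀ y w)
    refine e.trans ?_
    have e2 : (trivializationAt ℂ F x₀).symm y (fiberCoord x₀ y w) = w := by
      rw [← (trivializationAt ℂ F x₀).symmL_apply (R := ℂ) h₀]
      exact (trivializationAt ℂ F x₀).symmL_continuousLinearMapAt h₀ w
    rw [e2]
    have e3 := (trivializationAt ℂ F x₁).coe_linearMapAt_of_mem (R := ℂ) h₁
    exact (congrFun e3 w).symm
  rw [← h1, bundleTrans]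
  have : L (fiberCoord x₀ y w • (1 : ℂ)) = fiberCoord x₀ y w • L 1 := L.map_smul _ _
  rw [smul_eq_mul, mul_one] at this
  rw [this, smul_eq_mul, mul_comm]
  rfl

theorem bundleTrans_contMDiffOn [ContMDiffVectorBundle ω ℂ F 𝓘(ℂ, Cn n)] (x₀ x₁ : X) :
    ContMDiffOn 𝓘(ℂ, Cn n) 𝓘(ℂ, ℂ) ω (bundleTrans F x₀ x₁)
      ((trivializationAt ℂ F x₀).baseSet ∩ (trivializationAt ℂ F x₁).baseSet) := by
  have h := contMDiffOn_coordChangeL (n := ω) (IB := 𝓘(ℂ, Cn n)) (trivializationAt ℂ F x₀)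
    (trivializationAt ℂ F x₁)
  exact h.clm_apply contMDiffOn_const

theorem localRep_apply (x₀ : X) (u : ∀ x : X, Cn n [⋀^Fin k]→L[ℝ] F x) (z : Cn n)
    (m : Fin k → Cn n) :
    localRep x₀ u z m = fiberCoord x₀ ((chartAt (Cn n) x₀).symm z)
      (u ((chartAt (Cn n) x₀).symm z) fun i => chartSymmDeriv x₀ z (m i)) := rfl

theorem dbar_eq (u : ∀ x : X, Cn n [⋀^Fin k]→L[ℝ] F x) (x : X) :
    dbar u x = (fiberCoordSymm x).compContinuousAlternatingMap
      (dbarOp (localRep x u) (chartAt (Cn n) x x)) := rfl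

/-- The hermitian metric at `y`, written in the fibre coordinate of the trivialization around `x₀`. -/
def localMetric (x₀ : X) (h : ∀ x, F x →ₗ[ℂ] F x →ₗ⋆[ℂ] ℂ) (y : X) : ℂ →ₗ[ℂ] ℂ →ₗ⋆[ℂ] ℂ :=
  LinearMap.mk₂'ₛₗ (RingHom.id ℂ) (starRingEnd ℂ)
    (fun ξ η => h y ((trivializationAt ℂ F x₀).symmL ℂ y ξ)
      ((trivializationAt ℂ F x₀).symmL ℂ y η))
    (by simp) (by intros; rw [map_smul, map_smul, LinearMap.smul_apply]; rfl) (by simp)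
    (by intros; rw [map_smul, (h y _).map_smulₛₗ])

theorem localMetric_apply (x₀ : X) (h : ∀ x, F x →ₗ[ℂ] F x →ₗ⋆[ℂ] ℂ) (y : X) (ξ η : ℂ) :
    localMetric x₀ h y ξ η = h y ((trivializationAt ℂ F x₀).symmL ℂ y ξ)
      ((trivializationAt ℂ F x₀).symmL ℂ y η) := rfl

theorem IsHermitianMetric.isPosSemi {Y : Set X} {h : ∀ x, F x →ₗ[ℂ] F x →ₗ⋆[ℂ] ℂ}
    (hh : IsHermitianMetric (n := n) Y h) {x : X} (hx : x ∈ Y) : IsPosSemi (h x) where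
  symm := hh.symm x hx
  nonneg ξ := by
    by_cases hξ : ξ = 0
    · simp [hξ]
    · exact (hh.pos x hx ξ hξ).le

theorem localMetric_isPosSemi {Y : Set X} {h : ∀ x, F x →ₗ[ℂ] F x →ₗ⋆[ℂ] ℂ}
    (hh : IsHermitianMetric (n := n) Y h) {x : X} (hx : x ∈ Y) (x₀ : X) :
    IsPosSemi (localMetric x₀ h x) where
  symm _ _ := hh.symm x hx _ _
  nonneg _ := (hh.isPosSemi hx).nonneg _

/-- The form `f u`, for a real function `f`. It is defined through the fibre coordinate, because the
fibres are not assumed to be topological modules. -/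
def smulForm (f : X → ℝ) (u : ∀ x : X, Cn n [⋀^Fin k]→L[ℝ] F x) (x : X) :
    Cn n [⋀^Fin k]→L[ℝ] F x :=
  (fiberCoordSymm x).compContinuousAlternatingMap
    ((f x : ℂ) • (fiberCoord x x).compContinuousAlternatingMap (u x))

/-- The form at `x` in the fibre coordinate at `x`. -/
def coordForm (u : ∀ x : X, Cn n [⋀^Fin k]→L[ℝ] F x) (x : X) : Cn n [⋀^Fin k]→L[ℝ] ℂ :=
  (fiberCoord x x).compContinuousAlternatingMap (u x)

theorem smulForm_apply (f : X → ℝ) (u : ∀ x : X, Cn n [⋀^Fin k]→L[ℝ] F x) (x : X)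
    (m : Fin k → Cn n) : smulForm f u x m = (f x : ℂ) • u x m := by
  change fiberCoordSymm x ((f x : ℂ) * fiberCoord x x (u x m)) = _
  rw [fiberCoordSymm_smul, fiberCoordSymm_fiberCoord]

theorem localRep_smulForm (f : X → ℝ) (u : ∀ x : X, Cn n [⋀^Fin k]→L[ℝ] F x) (x₀ : X)
    (z : Cn n) : localRep x₀ (smulForm f u) z =
      (f ((chartAt (Cn n) x₀).symm z) : ℂ) • localRep x₀ u z := by
  ext m
  rw [localRep_apply, smulForm_apply, fiberCoord_smul]
  rfl

theorem pointInner_self (om : X → Cn n [⋀^Fin 2]→L[ℝ] ℝ) (h : ∀ x, F x →ₗ[ℂ] F x →ₗ⋆[ℂ] ℂ)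
    (u v : ∀ x : X, Cn n [⋀^Fin k]→L[ℝ] F x) (x : X) :
    pointInner om h u v x =
      formInner (metricOf om x) (localMetric x h x) (coordForm u x) (coordForm v x) := by
  refine formInner_congr _ fun m m' => ?_
  rw [localMetric_apply]
  exact congrArg₂ (fun a b => h x a b) (fiberCoordSymm_fiberCoord x _).symm
    (fiberCoordSymm_fiberCoord x _).symm

theorem pointInner_dbarFunAdj (om : X → Cn n [⋀^Fin 2]→L[ℝ] ℝ)
    (h : ∀ x, F x →ₗ[ℂ] F x →ₗ⋆[ℂ] ℂ) (f : X → ℝ) (u : ∀ x : X, Cn n [⋀^Fin k]→L[ℝ] F x)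
    (v : ∀ x : X, Cn n [⋀^Fin (k + 1)]→L[ℝ] F x) (x : X) :
    pointInner om h u (dbarFunAdj om f v) x = formInner (metricOf om x) (localMetric x h x)
      (wedge (dbarFun f x) (coordForm u x)) (coordForm v x) := by
  rw [pointInner_self, formInner_wedge]
  congr 1
  ext m
  exact fiberCoord_fiberCoordSymm x _

/-- The pairing `⟨u, (∂̄f)^* v⟩` depends linearly on the differential of `f`. -/
theorem pointInner_dbarFunAdj_linear (om : X → Cn n [⋀^Fin 2]→L[ℝ] ℝ)
    (h : ∀ x, F x →ₗ[ℂ] F x →ₗ⋆[ℂ] ℂ) {f f₁ f₂ : X → ℝ} {a b : ℝ}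
    (u : ∀ x : X, Cn n [⋀^Fin k]→L[ℝ] F x) (v : ∀ x : X, Cn n [⋀^Fin (k + 1)]→L[ℝ] F x) {x : X}
    (H : ∀ w : Cn n, dReal f x w =
      a * dReal f₁ x w +
      b * dReal f₂ x w) :
    pointInner om h u (dbarFunAdj om f v) x = a * pointInner om h u (dbarFunAdj om f₁ v) x +
      b * pointInner om h u (dbarFunAdj om f₂ v) x := by
  have h1 : ∀ w : Cn n, dbarFun f x w = a * dbarFun f₁ x w + b * dbarFun f₂ x w := fun w => by
    simp only [dbarFun_eq, antilinearPart_apply, ContinuousLinearMap.comp_apply,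
      Complex.ofRealCLM_apply, H, smul_eq_mul]
    push_cast
    ring
  simp only [pointInner_dbarFunAdj]
  rw [← formInner_smul_left (metricOf om x) (localMetric x h x) (a : ℂ)
      (α' := (a : ℂ) • wedge (dbarFun f₁ x) (coordForm u x)) fun m => rfl,
    ← formInner_smul_left (metricOf om x) (localMetric x h x) (b : ℂ)
      (α' := (b : ℂ) • wedge (dbarFun f₂ x) (coordForm u x)) fun m => rfl]
  refine formInner_add_left _ _ (fun m => ?_) _
  simp only [wedge, ContinuousAlternatingMap.smul_apply,
    ContinuousAlternatingMap.alternatizeUncurryFin_apply, ContinuousLinearMap.smulRight_apply, h1,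
    Finset.smul_sum, ← Finset.sum_add_distrib]
  refine Finset.sum_congr rfl fun i _ => ?_
  simp only [zsmul_eq_mul, smul_eq_mul]
  ring

/-- A bound for the differential of `f` in the metric of `om` bounds the boundary integrand. -/
theorem norm_pointInner_dbarFunAdj_le {Y : Set X} {om : X → Cn n [⋀^Fin 2]→L[ℝ] ℝ}
    (hom : IsPositiveForm Y om) {h : ∀ x, F x →ₗ[ℂ] F x →ₗ⋆[ℂ] ℂ}
    (hh : IsHermitianMetric (n := n) Y h) {f : X → ℝ} {ε : ℝ} (hε : 0 ≤ ε)
    (u : ∀ x : X, Cn n [⋀^Fin k]→L[ℝ] F x) (v : ∀ x : X, Cn n [⋀^Fin (k + 1)]→L[ℝ] F x) {x : X}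
    (hx : x ∈ Y) (H : ∀ w : Cn n, |dReal f x w| ≤
      ε * √(metricOf om x w w)) :
    ‖pointInner om h u (dbarFunAdj om f v) x‖ ≤ ε * (n + k + 1) *
      ((pointInner om h u u x).re + (pointInner om h v v x).re) := by
  rw [pointInner_dbarFunAdj, pointInner_self, pointInner_self om h v]
  exact norm_formInner_wedge_le (hom.isHermScalar hx) (localMetric_isPosSemi hh hx x) hε
    (norm_antilinearPart_le (hom.isHermScalar hx) H) _ _

theorem coordForm_dbar (u : ∀ x : X, Cn n [⋀^Fin k]→L[ℝ] F x) (x : X) :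
    coordForm (dbar u) x = dbarOp (localRep x u) (chartAt (Cn n) x x) := by
  ext m
  exact fiberCoord_fiberCoordSymm x _

variable [IsManifold 𝓘(ℂ, Cn n) ω X]

/-- The local representations of a form in two charts. -/
theorem localRep_trans {x₀ x₁ : X} {z : Cn n} (hz : z ∈ transDom x₀ x₁)
    (h₀ : (chartAt (Cn n) x₀).symm z ∈ (trivializationAt ℂ F x₀).baseSet)
    (h₁ : (chartAt (Cn n) x₀).symm z ∈ (trivializationAt ℂ F x₁).baseSet)
    (u : ∀ x : X, Cn n [⋀^Fin k]→L[ℝ] F x) :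
    localRep x₀ u z = bundleTrans F x₁ x₀ ((chartAt (Cn n) x₀).symm z) •
      (localRep x₁ u (trans x₀ x₁ z)).compContinuousLinearMap (fderiv ℝ (trans x₀ x₁) z) := by
  ext m
  have hy : (chartAt (Cn n) x₁).symm (trans x₀ x₁ z) = (chartAt (Cn n) x₀).symm z :=
    (chartAt (Cn n) x₁).left_inv hz.2
  rw [ContinuousAlternatingMap.smul_apply, ContinuousAlternatingMap.compContinuousLinearMap_apply,
    localRep_apply, localRep_apply, hy, smul_eq_mul, ← fiberCoord_eq_bundleTrans h₁ h₀,
    chartSymmDeriv_trans hz]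
  rfl

theorem localRep_self (x : X) (u : ∀ x : X, Cn n [⋀^Fin k]→L[ℝ] F x) :
    localRep x u (chartAt (Cn n) x x) = (fiberCoord x x).compContinuousAlternatingMap (u x) := by
  ext m
  rw [localRep_apply, chartSymmDeriv_self, (chartAt (Cn n) x).left_inv (mem_chart_source _ x)]
  rfl

/-- The operator `∂̄` may be computed in any holomorphic chart and trivialization. -/
theorem localRep_dbar [ContMDiffVectorBundle ω ℂ F 𝓘(ℂ, Cn n)] {Y : Set X} (hY : IsOpen Y)
    {u : ∀ x : X, Cn n [⋀^Fin k]→L[ℝ] F x}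
    (hu : ∀ x₀ : X, ContDiffOn ℝ ∞ (localRep x₀ u) (repDom F Y x₀)) {x₀ : X} {z : Cn n}
    (hz : z ∈ repDom F Y x₀) : localRep x₀ (dbar u) z = dbarOp (localRep x₀ u) z := by
  obtain ⟨hzt, hzY, hzb⟩ := hz
  set y := (chartAt (Cn n) x₀).symm z with hy
  have hzy : z ∈ transDom x₀ y := ⟨hzt, mem_chart_source _ y⟩
  have hτz : trans x₀ y z = chartAt (Cn n) y y := rfl
  have hyb : y ∈ (trivializationAt ℂ F y).baseSet := mem_baseSet_trivializationAt ℂ F y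
  set ξ : Cn n → ℂ := fun w => bundleTrans F y x₀ ((chartAt (Cn n) x₀).symm w) with hξ
  have hO : IsOpen {w ∈ (chartAt (Cn n) x₀).target | (chartAt (Cn n) x₀).symm w ∈
      (trivializationAt ℂ F y).baseSet ∩ (trivializationAt ℂ F x₀).baseSet} :=
    isOpen_chart_preimage x₀ ((trivializationAt ℂ F y).open_baseSet.inter
      (trivializationAt ℂ F x₀).open_baseSet)
  have hξd : DifferentiableAt ℂ ξ z := by
    have h1 : ContMDiffOn 𝓘(ℂ, Cn n) 𝓘(ℂ, ℂ) ω ξ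
        {w ∈ (chartAt (Cn n) x₀).target | (chartAt (Cn n) x₀).symm w ∈
          (trivializationAt ℂ F y).baseSet ∩ (trivializationAt ℂ F x₀).baseSet} :=
      (bundleTrans_contMDiffOn y x₀).comp
        ((contMDiffOn_chart_symm (I := 𝓘(ℂ, Cn n)) (n := ω)).mono fun w hw => hw.1)
        fun w hw => hw.2
    exact (h1.contDiffOn.contDiffAt (hO.mem_nhds ⟨hzt, hyb, hzb⟩)).differentiableAt (by simp)
  -- the transition function of the bundle is holomorphic, so that it commutes with `∂̄`
  have hξI : antilinearPart (fderiv ℝ ξ z) = 0 := by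
    apply antilinearPart_eq_zero
    intro v
    rw [hξd.fderiv_restrictScalars ℝ]
    simp
  have hα : DifferentiableAt ℝ (localRep y u) (trans x₀ y z) := by
    rw [hτz]
    refine ((hu y).contDiffAt ((isOpen_repDom hY y).mem_nhds ?_)).differentiableAt (by simp)
    refine ⟨mem_chart_target _ y, ?_⟩
    rw [(chartAt (Cn n) y).left_inv (mem_chart_source _ y)]
    exact ⟨hzY, hyb⟩
  have hτ : ContDiffAt ℝ ∞ (trans x₀ y) z :=
    (contDiffOn_trans x₀ y).contDiffAt ((isOpen_transDom x₀ y).mem_nhds hzy)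
  have hloc : localRep x₀ u =ᶠ[𝓝 z] fun w => ξ w •
      (localRep y u (trans x₀ y w)).compContinuousLinearMap (fderiv ℝ (trans x₀ y) w) := by
    filter_upwards [(isOpen_transDom x₀ y).mem_nhds hzy, hO.mem_nhds ⟨hzt, hyb, hzb⟩]
      with w hw hw'
    exact localRep_trans hw hw'.2.2 hw'.2.1 u
  have hd2 : DifferentiableAt ℝ (fderiv ℝ (trans x₀ y)) z :=
    (hτ.fderiv_right (m := 1) (by norm_cast)).differentiableAt one_ne_zero
  rw [dbarOp_congr hloc, dbarOp_smul (hξd.restrictScalars ℝ)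
    (DifferentiableAt.continuousAlternatingMapCompContinuousLinearMap
      (by exact hα.comp z (hτ.differentiableAt (by simp))) hd2), hξI,
    dbarOp_pullback hα (hτ.of_le (by norm_cast)) (by
      filter_upwards [(isOpen_transDom x₀ y).mem_nhds hzy] with w hw
      exact fderiv_trans_I_smul hw)]
  ext m
  rw [localRep_apply, dbar_eq, chartSymmDeriv_eq hzt, ← hy, ← hτz]
  rw [ContinuousLinearMap.compContinuousAlternatingMap_coe, Function.comp_apply,
    fiberCoord_eq_bundleTrans hyb hzb, fiberCoord_fiberCoordSymm]
  rw [wedge_zero_left, add_zero]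
  rfl

theorem chart_mem_repDom {Y : Set X} {x : X} (hx : x ∈ Y) :
    chartAt (Cn n) x x ∈ repDom F Y x := by
  refine ⟨mem_chart_target _ x, ?_⟩
  rw [(chartAt (Cn n) x).left_inv (mem_chart_source _ x)]
  exact ⟨hx, mem_baseSet_trivializationAt ℂ F x⟩

/-- The Leibniz rule for `∂̄` on a manifold, paired with a form. -/
theorem pointInner_dbar_smulForm {Y : Set X} (hY : IsOpen Y) (om : X → Cn n [⋀^Fin 2]→L[ℝ] ℝ)
    (h : ∀ x, F x →ₗ[ℂ] F x →ₗ⋆[ℂ] ℂ) {f : X → ℝ} (hf : ContMDiff 𝓘(ℝ, Cn n) 𝓘(ℝ, ℝ) ∞ f)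
    {u : ∀ x : X, Cn n [⋀^Fin k]→L[ℝ] F x}
    (hu : ∀ x₀ : X, ContDiffOn ℝ ∞ (localRep x₀ u) (repDom F Y x₀))
    (v : ∀ x : X, Cn n [⋀^Fin (k + 1)]→L[ℝ] F x) {x : X} (hx : x ∈ Y) :
    pointInner om h (dbar (smulForm f u)) v x =
      f x * pointInner om h (dbar u) v x + pointInner om h u (dbarFunAdj om f v) x := by
  set z := chartAt (Cn n) x x with hz
  have hzx : (chartAt (Cn n) x).symm z = x := (chartAt (Cn n) x).left_inv (mem_chart_source _ x)
  have hzt := mem_chart_target (Cn n) x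
  have hfd : MDifferentiableAt 𝓘(ℝ, Cn n) 𝓘(ℝ, ℝ) f ((chartAt (Cn n) x).symm z) :=
    hf.mdifferentiableAt (by simp)
  have hgd : DifferentiableAt ℝ (fun w => f ((chartAt (Cn n) x).symm w)) z :=
    (hfd.comp z (mdifferentiableAt_chart_symm hzt)).differentiableAt
  have hξ : DifferentiableAt ℝ (fun w => (f ((chartAt (Cn n) x).symm w) : ℂ)) z :=
    Complex.ofRealCLM.differentiableAt.comp z hgd
  have hβ : DifferentiableAt ℝ (localRep x u) z :=
    ((hu x).contDiffAt ((isOpen_repDom hY x).mem_nhds (chart_mem_repDom hx))).differentiableAt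
      (by simp)
  have e1 : fderiv ℝ (fun w => (f ((chartAt (Cn n) x).symm w) : ℂ)) z =
      Complex.ofRealCLM.comp (fderiv ℝ (fun w => f ((chartAt (Cn n) x).symm w)) z) :=
    (Complex.ofRealCLM.hasFDerivAt.comp z hgd.hasFDerivAt).fderiv
  have e2 : fderiv ℝ (fun w => f ((chartAt (Cn n) x).symm w)) z =
      dReal f x := by
    rw [hzx] at hfd
    exact (mfderiv_eq_fderiv_chart_symm hfd).symm
  have e3 : localRep x (smulForm f u) = fun w =>
      (f ((chartAt (Cn n) x).symm w) : ℂ) • localRep x u w :=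
    funext fun w => localRep_smulForm f u x w
  have e4 : localRep x u z = coordForm u x := localRep_self x u
  rw [pointInner_self, coordForm_dbar, e3, dbarOp_smul hξ hβ, e1, e2, hzx, e4,
    pointInner_dbarFunAdj, pointInner_self om h (dbar u), coordForm_dbar]
  rw [← formInner_smul_left (metricOf om x) (localMetric x h x) (f x : ℂ)
      (α' := (f x : ℂ) • dbarOp (localRep x u) z) fun m => rfl]
  exact formInner_add_left _ _ (fun m => rfl) _

theorem isSmoothForm_smulForm {Y : Set X} {p q : ℕ} {f : X → ℝ}
    (hf : ContMDiff 𝓘(ℝ, Cn n) 𝓘(ℝ, ℝ) ∞ f)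
    {u : ∀ x : X, Cn n [⋀^Fin k]→L[ℝ] F x} (hu : IsSmoothForm Y p q u) :
    IsSmoothForm Y p q (smulForm f u) where
  isOfType x hx ζ m := by
    rw [smulForm_apply, smulForm_apply, hu.isOfType x hx ζ m, smul_comm]
  smooth x₀ := by
    have e3 : localRep x₀ (smulForm f u) = fun w =>
        (f ((chartAt (Cn n) x₀).symm w) : ℂ) • localRep x₀ u w :=
      funext fun w => localRep_smulForm f u x₀ w
    rw [e3]
    have h1 : ContMDiffOn 𝓘(ℝ, Cn n) 𝓘(ℝ, ℝ) ∞ (fun w => f ((chartAt (Cn n) x₀).symm w))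
        (chartAt (Cn n) x₀).target := hf.comp_contMDiffOn contMDiffOn_chart_symm
    have h2 : ContDiffOn ℝ ∞ (fun w => (f ((chartAt (Cn n) x₀).symm w) : ℂ))
        (chartAt (Cn n) x₀).target := Complex.ofRealCLM.contDiff.comp_contDiffOn h1.contDiffOn
    exact (h2.mono fun w hw => hw.1).smul (hu.smooth x₀)

/-- The pointwise inner product of forms in a chart and a trivialization. -/
theorem pointInner_chart {Y : Set X} {om : X → Cn n [⋀^Fin 2]→L[ℝ] ℝ}
    (hom : IsPositiveForm Y om) (h : ∀ x, F x →ₗ[ℂ] F x →ₗ⋆[ℂ] ℂ) {x₀ : X} {z : Cn n}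
    (hz : z ∈ repDom F Y x₀) (u v : ∀ x : X, Cn n [⋀^Fin k]→L[ℝ] F x) :
    pointInner om h u v ((chartAt (Cn n) x₀).symm z) =
      formInner (fun a b => metricOf om ((chartAt (Cn n) x₀).symm z) (chartSymmDeriv x₀ z a)
        (chartSymmDeriv x₀ z b)) (localMetric x₀ h ((chartAt (Cn n) x₀).symm z))
        (localRep x₀ u z) (localRep x₀ v z) := by
  set y := (chartAt (Cn n) x₀).symm z
  have h1 := formInner_comp (hom.isHermScalar hz.2.1) (chartSymmDeriv x₀ z)
    (chartSymmDeriv_injective hz.1) (chartSymmDeriv_I_smul hz.1) (localMetric x₀ h y)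
    ((fiberCoord x₀ y).compContinuousAlternatingMap (u y))
    ((fiberCoord x₀ y).compContinuousAlternatingMap (v y))
  refine Eq.trans ?_ h1.symm
  refine formInner_congr _ fun m m' => ?_
  rw [localMetric_apply]
  exact congrArg₂ (fun a b => h y a b)
    ((trivializationAt ℂ F x₀).symmL_continuousLinearMapAt hz.2.2 _).symm
    ((trivializationAt ℂ F x₀).symmL_continuousLinearMapAt hz.2.2 _).symm

/-- The coefficients of the metric in a chart are smooth. -/
theorem contDiffOn_metric {Y : Set X} {om : X → Cn n [⋀^Fin 2]→L[ℝ] ℝ}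
    (hom : IsPositiveForm Y om) (x₀ : X) (a b : Cn n) :
    ContDiffOn ℝ ∞ (fun z => metricOf om ((chartAt (Cn n) x₀).symm z) (chartSymmDeriv x₀ z a)
        (chartSymmDeriv x₀ z b))
      {z ∈ (chartAt (Cn n) x₀).target | (chartAt (Cn n) x₀).symm z ∈ Y} := by
  have h1 := (ContinuousAlternatingMap.apply ℝ (Cn n) ℝ ![a, Complex.I • b]).contDiff
    (n := ∞) |>.comp_contDiffOn (hom.smooth x₀)
  refine h1.congr fun z hz => ?_
  rw [metricOf, ← chartSymmDeriv_I_smul hz.1]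
  change _ = om _ (chartSymmDeriv x₀ z ∘ ![a, Complex.I • b])
  congr 1
  ext1 i; fin_cases i <;> simp

/-- The local representations of the form `u` on `Y` are continuous. -/
def IsContForm (Y : Set X) (u : ∀ x : X, Cn n [⋀^Fin k]→L[ℝ] F x) : Prop :=
  ∀ x₀ : X, ContinuousOn (localRep x₀ u) (repDom F Y x₀)

theorem continuousOn_pointInner {Y : Set X} (hY : IsOpen Y) {om : X → Cn n [⋀^Fin 2]→L[ℝ] ℝ}
    (hom : IsPositiveForm Y om) {h : ∀ x, F x →ₗ[ℂ] F x →ₗ⋆[ℂ] ℂ}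
    (hh : IsHermitianMetric (n := n) Y h) {u v : ∀ x : X, Cn n [⋀^Fin k]→L[ℝ] F x}
    (hu : IsContForm Y u) (hv : IsContForm Y v) : ContinuousOn (pointInner om h u v) Y := by
  intro x hx
  have hd := isOpen_repDom (n := n) (F := F) hY x
  have hsymm : ContinuousOn (chartAt (Cn n) x).symm (repDom F Y x) :=
    (chartAt (Cn n) x).continuousOn_symm.mono fun w hw => hw.1
  have h1 : ContinuousOn (fun z => pointInner om h u v ((chartAt (Cn n) x).symm z))
      (repDom F Y x) := by
    refine ContinuousOn.congr (f := fun z => formInner (fun a b =>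
        metricOf om ((chartAt (Cn n) x).symm z) (chartSymmDeriv x z a)
        (chartSymmDeriv x z b)) (localMetric x h ((chartAt (Cn n) x).symm z))
        (localRep x u z) (localRep x v z)) ?_ fun z hz => pointInner_chart hom h hz u v
    refine continuousOn_formInner (fun a b => ?_) (fun z hz => ?_) ?_ (hu x) (hv x)
    · exact (contDiffOn_metric hom x a b).continuousOn.mono fun w hw => ⟨hw.1, hw.2.1⟩
    · exact det_gram_ne_zero ((hom.isHermScalar hz.2.1).comp _ (chartSymmDeriv_injective hz.1)
        (chartSymmDeriv_I_smul hz.1))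
    · exact (hh.smooth x).continuousOn.comp hsymm fun w hw => hw.2
  have h2 : ContinuousAt (fun z => pointInner om h u v ((chartAt (Cn n) x).symm z))
      (chartAt (Cn n) x x) := h1.continuousAt (hd.mem_nhds (chart_mem_repDom hx))
  have h3 : ContinuousAt (fun y => pointInner om h u v
      ((chartAt (Cn n) x).symm (chartAt (Cn n) x y))) x :=
    ContinuousAt.comp (f := chartAt (Cn n) x) h2
      ((chartAt (Cn n) x).continuousAt (mem_chart_source _ x))
  refine (h3.congr ?_).continuousWithinAt
  filter_upwards [(chartAt (Cn n) x).open_source.mem_nhds (mem_chart_source _ x)] with y hy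
  rw [(chartAt (Cn n) x).left_inv hy]

theorem IsSmoothForm.isContForm {Y : Set X} {p q : ℕ} {u : ∀ x : X, Cn n [⋀^Fin k]→L[ℝ] F x}
    (hu : IsSmoothForm Y p q u) : IsContForm Y u := fun x₀ => (hu.smooth x₀).continuousOn

theorem IsSmoothForm.isContForm_dbar [ContMDiffVectorBundle ω ℂ F 𝓘(ℂ, Cn n)] {Y : Set X}
    (hY : IsOpen Y) {p q : ℕ} {u : ∀ x : X, Cn n [⋀^Fin k]→L[ℝ] F x}
    (hu : IsSmoothForm Y p q u) : IsContForm Y (dbar u) := by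
  intro x₀
  refine ContinuousOn.congr (f := dbarOp (localRep x₀ u)) ?_
    fun z hz => localRep_dbar hY hu.smooth hz
  have h1 : ContinuousOn (fderiv ℝ (localRep x₀ u)) (repDom F Y x₀) :=
    (hu.smooth x₀).continuousOn_fderiv_of_isOpen (isOpen_repDom hY x₀) (by simp)
  have h2 : Continuous fun A : Cn n →L[ℝ] Cn n [⋀^Fin k]→L[ℝ] ℂ =>
      ContinuousAlternatingMap.alternatizeUncurryFin (antilinearPart A) := by
    refine (ContinuousAlternatingMap.alternatizeUncurryFinCLM ℝ (Cn n) ℂ).continuous.comp ?_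
    unfold antilinearPart
    fun_prop
  exact h2.comp_continuousOn h1

theorem continuousOn_pointInner_dbarFunAdj [ContMDiffVectorBundle ω ℂ F 𝓘(ℂ, Cn n)] {Y : Set X}
    (hY : IsOpen Y) {om : X → Cn n [⋀^Fin 2]→L[ℝ] ℝ} (hom : IsPositiveForm Y om)
    {h : ∀ x, F x →ₗ[ℂ] F x →ₗ⋆[ℂ] ℂ} (hh : IsHermitianMetric (n := n) Y h) {f : X → ℝ}
    (hf : ContMDiff 𝓘(ℝ, Cn n) 𝓘(ℝ, ℝ) ∞ f) {p q : ℕ}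
    {u : ∀ x : X, Cn n [⋀^Fin k]→L[ℝ] F x} (hu : IsSmoothForm Y p q u)
    {v : ∀ x : X, Cn n [⋀^Fin (k + 1)]→L[ℝ] F x} (hv : IsContForm Y v) :
    ContinuousOn (pointInner om h u (dbarFunAdj om f v)) Y := by
  have h1 := continuousOn_pointInner hY hom hh ((isSmoothForm_smulForm hf hu).isContForm_dbar hY) hv
  have h2 := continuousOn_pointInner hY hom hh (hu.isContForm_dbar hY) hv
  have h3 : ContinuousOn (fun x => (f x : ℂ)) Y :=
    (Complex.continuous_ofReal.comp hf.continuous).continuousOn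
  refine (h1.sub (h3.mul h2)).congr fun x hx => ?_
  rw [Pi.sub_apply, Pi.mul_apply, pointInner_dbar_smulForm hY om h hf hu.smooth v hx]
  ring

end BundleForms

/-! ### Complete length spaces and mollification -/

section HopfRinow

open Metric

/-- The Hopf–Rinow–Cohn-Vossen theorem: closed balls of finite radius of a complete, locally
compact length space are compact. -/
theorem isCompact_closedEBall_of_length {M : Type*} [PseudoEMetricSpace M] [CompleteSpace M]
    (hloc : ∀ x : M, ∃ ε : ℝ, 0 < ε ∧ IsCompact (closedEBall x (ENNReal.ofReal ε)))
    (hlen : ∀ (x y : M) (r s : ℝ), 0 < r → 0 < s → edist x y < ENNReal.ofReal (r + s) →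
      ∃ z, edist x z < ENNReal.ofReal r ∧ edist z y < ENNReal.ofReal s)
    (p : M) (r₀ : ℝ) : IsCompact (closedEBall p (ENNReal.ofReal r₀)) := by
  have hmono : ∀ {r s : ℝ}, r ≤ s → IsCompact (closedEBall p (ENNReal.ofReal s)) →
      IsCompact (closedEBall p (ENNReal.ofReal r)) := fun hrs h =>
    h.of_isClosed_subset isClosed_closedEBall
      (closedEBall_subset_closedEBall (ENNReal.ofReal_le_ofReal hrs))
  set S : Set ℝ := {r | r ≤ r₀ ∧ IsCompact (closedEBall p (ENNReal.ofReal r))} with hS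
  obtain ⟨ε₀, hε₀, hc₀⟩ := hloc p
  by_cases hr₀ : r₀ ≤ ε₀
  · exact hmono hr₀ hc₀
  push Not at hr₀
  have hεS : ε₀ ∈ S := ⟨hr₀.le, hc₀⟩
  have hbdd : BddAbove S := ⟨r₀, fun r hr => hr.1⟩
  set R := sSup S with hR
  have hεR : ε₀ ≤ R := le_csSup hbdd hεS
  have hR0 : 0 < R := hε₀.trans_le hεR
  have hRr : R ≤ r₀ := csSup_le ⟨_, hεS⟩ fun r hr => hr.1
  have hlt : ∀ r < R, IsCompact (closedEBall p (ENNReal.ofReal r)) := by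
    intro r hr
    obtain ⟨s, hs, hrs⟩ := exists_lt_of_lt_csSup ⟨_, hεS⟩ hr
    exact hmono hrs.le hs.2
  -- the ball of the critical radius is totally bounded
  have hcR : IsCompact (closedEBall p (ENNReal.ofReal R)) := by
    rw [isCompact_iff_totallyBounded_isComplete]
    refine ⟨?_, isClosed_closedEBall.isComplete⟩
    rw [EMetric.totallyBounded_iff]
    intro ε hε
    obtain ⟨δ, hδ0, hδε⟩ : ∃ δ : ℝ, 0 < δ ∧ ENNReal.ofReal δ < ε := by
      obtain ⟨q, hq0, hqε⟩ := ENNReal.lt_iff_exists_nnreal_btwn.1 hε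
      exact ⟨q, by simpa using hq0, by simpa using hqε⟩
    set η := min (δ / 4) (R / 2) with hη
    have hη0 : 0 < η := by positivity
    have hηR : η ≤ R / 2 := min_le_right _ _
    have hηδ : η ≤ δ / 4 := min_le_left _ _
    obtain ⟨T, hTf, hT⟩ := EMetric.totallyBounded_iff.1
      (hlt (R - η) (by linarith)).totallyBounded (ENNReal.ofReal (δ / 2)) (by simpa using hδ0)
    refine ⟨T, hTf, fun y hy => ?_⟩
    have hy' : edist p y < ENNReal.ofReal ((R - η) + 2 * η) := by
      rw [edist_comm]
      exact (mem_closedEBall.1 hy).trans_lt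
        ((ENNReal.ofReal_lt_ofReal_iff (by linarith)).2 (by linarith))
    obtain ⟨z, hz1, hz2⟩ := hlen p y (R - η) (2 * η) (by linarith) (by linarith) hy'
    have hz3 := hT (mem_closedEBall'.2 hz1.le)
    simp only [mem_iUnion, exists_prop] at hz3 ⊢
    obtain ⟨t, ht, hzt⟩ := hz3
    refine ⟨t, ht, ?_⟩
    rw [mem_eball] at hzt ⊢
    calc edist y t ≤ edist y z + edist z t := edist_triangle _ _ _
      _ < ENNReal.ofReal (2 * η) + ENNReal.ofReal (δ / 2) := by
        rw [edist_comm y z]; exact ENNReal.add_lt_add hz2 hzt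
      _ = ENNReal.ofReal (2 * η + δ / 2) := (ENNReal.ofReal_add (by linarith) (by linarith)).symm
      _ ≤ ENNReal.ofReal δ := ENNReal.ofReal_le_ofReal (by linarith)
      _ < ε := hδε
  rcases hRr.eq_or_lt with h | hRlt
  · rwa [← h]
  -- a larger ball is compact as well, by local compactness
  exfalso
  choose e he0 hec using hloc
  obtain ⟨t, -, ht⟩ := hcR.elim_nhds_subcover
    (fun x => eball x (ENNReal.ofReal (e x / 2))) fun x _ =>
      eball_mem_nhds x (by simpa using he0 x)
  obtain ⟨δ, hδ0, hδ⟩ : ∃ δ : ℝ, 0 < δ ∧ ∀ x ∈ t, δ ≤ e x / 2 := by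
    rcases t.eq_empty_or_nonempty with rfl | hne
    · exact ⟨1, one_pos, by simp⟩
    · obtain ⟨x, hx, hmin⟩ := t.exists_min_image e hne
      exact ⟨e x / 2, half_pos (he0 x), fun y hy => by linarith [hmin y hy]⟩
  set R' := min r₀ (R + δ / 2) with hR'
  have hRR' : R < R' := lt_min hRlt (by linarith)
  have hsub : closedEBall p (ENNReal.ofReal R') ⊆
      ⋃ x ∈ t, closedEBall x (ENNReal.ofReal (e x)) := by
    intro y hy
    have hy' : edist p y < ENNReal.ofReal (R + δ) := by
      rw [edist_comm]
      refine (mem_closedEBall.1 hy).trans_lt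
        ((ENNReal.ofReal_lt_ofReal_iff (by linarith)).2 ?_)
      exact (min_le_right _ _).trans_lt (by linarith)
    obtain ⟨z, hz1, hz2⟩ := hlen p y R δ hR0 hδ0 hy'
    have hz3 := ht (mem_closedEBall'.2 hz1.le)
    simp only [mem_iUnion, exists_prop] at hz3 ⊢
    obtain ⟨x, hx, hzx⟩ := hz3
    refine ⟨x, hx, ?_⟩
    rw [mem_eball] at hzx
    rw [mem_closedEBall]
    calc edist y x ≤ edist y z + edist z x := edist_triangle _ _ _
      _ ≤ ENNReal.ofReal δ + ENNReal.ofReal (e x / 2) := by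
        rw [edist_comm y z]; exact add_le_add hz2.le hzx.le
      _ = ENNReal.ofReal (δ + e x / 2) :=
        (ENNReal.ofReal_add hδ0.le (by linarith [he0 x])).symm
      _ ≤ ENNReal.ofReal (e x) := ENNReal.ofReal_le_ofReal (by linarith [hδ x hx])
  have hcR' : IsCompact (closedEBall p (ENNReal.ofReal R')) :=
    (t.isCompact_biUnion fun x _ => hec x).of_isClosed_subset isClosed_closedEBall hsub
  exact absurd (le_csSup hbdd (show R' ∈ S from ⟨min_le_left _ _, hcR'⟩)) (not_le.2 hRR')

end HopfRinow

section Mollify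

open Metric ContinuousLinearMap

/-- Mollification of a continuous function on a ball: the smooth approximation satisfies the same
Lipschitz estimates as the function, with respect to every homogeneous gauge `N`. -/
theorem exists_smooth_approx {E : Type*} [NormedAddCommGroup E] [NormedSpace ℝ E]
    [FiniteDimensional ℝ E] {f : E → ℝ} {z₀ : E} {r δ : ℝ} (hr : 0 < r) (hδ : 0 < δ)
    (hf : ContinuousOn f (closedBall z₀ r)) :
    ∃ F : E → ℝ, ContDiff ℝ ∞ F ∧ (∀ z ∈ ball z₀ (r / 2), |F z - f z| ≤ δ) ∧
      ∀ N : E → ℝ, (∀ t : ℝ, 0 ≤ t → ∀ w, N (t • w) = t * N w) →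
        (∀ a ∈ closedBall z₀ r, ∀ b ∈ closedBall z₀ r, |f a - f b| ≤ N (a - b)) →
        ∀ z ∈ ball z₀ (r / 2), ∀ w, |fderiv ℝ F z w| ≤ N w := by
  borelize E
  set μ : Measure E := Measure.addHaar
  obtain ⟨η, hη0, hη⟩ := Metric.uniformContinuousOn_iff.1
    ((isCompact_closedBall z₀ r).uniformContinuousOn_of_continuous hf) δ hδ
  set f' : E → ℝ := (closedBall z₀ r).indicator f with hf'
  have hint : Integrable f' μ :=
    (hf.integrableOn_compact (isCompact_closedBall z₀ r)).integrable_indicator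
      measurableSet_closedBall
  set ρ := min η (r / 2) with hρ
  have hρ0 : 0 < ρ := by positivity
  set φ : ContDiffBump (0 : E) := ⟨ρ / 2, ρ, half_pos hρ0, half_lt_self hρ0⟩
  set F : E → ℝ := convolution (φ.normed μ) f' (lsmul ℝ ℝ) μ with hF
  have hFs : ContDiff ℝ ∞ F :=
    φ.hasCompactSupport_normed.contDiff_convolution_left _ φ.contDiff_normed hint.locallyIntegrable
  have hin : ∀ z ∈ ball z₀ (r / 2), ∀ x, dist x z < ρ → x ∈ closedBall z₀ r := by
    intro z hz x hx
    have h1 : ρ ≤ r / 2 := min_le_right _ _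
    rw [mem_ball] at hz
    rw [mem_closedBall]
    linarith [dist_triangle x z z₀]
  refine ⟨F, hFs, fun z hz => ?_, fun N hN hfN z hz w => ?_⟩
  · have hzr : z ∈ closedBall z₀ r := hin z hz z (by simpa using hρ0)
    have hfz : f' z = f z := indicator_of_mem hzr f
    rw [← hfz, ← Real.dist_eq]
    refine φ.dist_normed_convolution_le hint.aestronglyMeasurable fun x hx => ?_
    have hx' : dist x z < ρ := hx
    have hxr := hin z hz x hx'
    rw [hfz, hf', indicator_of_mem hxr f]
    exact (hη x hxr z hzr (hx'.trans_le (min_le_left _ _))).le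
  · have hconv : ∀ x, Integrable (fun t => φ.normed μ t * f' (x - t)) μ := fun x =>
      (φ.hasCompactSupport_normed.convolutionExists_left (lsmul ℝ ℝ)
        φ.continuous_normed hint.locallyIntegrable x)
    have hFx : ∀ x, F x = ∫ t, φ.normed μ t * f' (x - t) ∂μ := fun x => rfl
    have hdiff : ∀ y ∈ ball z₀ (r / 2), |F y - F z| ≤ N (y - z) := by
      intro y hy
      rw [hFx, hFx, ← integral_sub (hconv y) (hconv z), ← Real.norm_eq_abs]
      have hb : ∀ t, ‖φ.normed μ t * f' (y - t) - φ.normed μ t * f' (z - t)‖ ≤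
          φ.normed μ t * N (y - z) := by
        intro t
        rw [← mul_sub, norm_mul, Real.norm_of_nonneg (φ.nonneg_normed t)]
        by_cases ht : t ∈ ball (0 : E) ρ
        · rw [mem_ball_zero_iff] at ht
          have h1 := hin y hy (y - t) (by simpa [dist_eq_norm] using ht)
          have h2 := hin z hz (z - t) (by simpa [dist_eq_norm] using ht)
          rw [hf', indicator_of_mem h1, indicator_of_mem h2, Real.norm_eq_abs]
          refine mul_le_mul_of_nonneg_left ?_ (φ.nonneg_normed t)
          simpa using hfN _ h1 _ h2
        · have : φ.normed μ t = 0 := by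
            rw [← Function.notMem_support, φ.support_normed_eq]
            exact ht
          simp [this]
      refine (norm_integral_le_of_norm_le (φ.integrable_normed.mul_const _)
        (ae_of_all _ hb)).trans (le_of_eq ?_)
      rw [integral_mul_const, φ.integral_normed, one_mul]
    -- the differential is a limit of difference quotients in the direction `w`
    have hd : HasFDerivAt F (fderiv ℝ F z) z :=
      (hFs.differentiable (by simp) z).hasFDerivAt
    have hlim := hd.hasLineDerivAt w
    have hlim2 := (hlim.tendsto_slope_zero_right).abs
    refine le_of_tendsto hlim2 ?_
    have hcont : Tendsto (fun t : ℝ => z + t • w) (𝓝[>] 0) (𝓝 z) := by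
      have : Continuous fun t : ℝ => z + t • w := by fun_prop
      simpa using (this.tendsto 0).mono_left nhdsWithin_le_nhds
    filter_upwards [hcont (isOpen_ball.mem_nhds hz), self_mem_nhdsWithin] with t ht ht0
    have ht0' : (0 : ℝ) < t := ht0
    have h1 := hdiff _ ht
    rw [add_sub_cancel_left, hN t ht0'.le] at h1
    rw [smul_eq_mul, abs_mul, abs_inv, abs_of_pos ht0', inv_mul_le_iff₀ ht0']
    simpa using h1

end Mollify

/-! ### The geodesic distance of a positive form -/

section Length

variable {n : ℕ} {X : Type*} [TopologicalSpace X] [ChartedSpace (Cn n) X]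

theorem metricOf_smul_self (om : X → Cn n [⋀^Fin 2]→L[ℝ] ℝ) (x : X) (c : ℝ) (v : Cn n) :
    metricOf om x (c • v) (c • v) = c ^ 2 * metricOf om x v v := by
  unfold metricOf
  have h1 : ![c • v, Complex.I • c • v] = fun i => c • (![v, Complex.I • v] i) := by
    ext i j
    fin_cases i <;> simp
    ring
  rw [h1, ContinuousAlternatingMap.map_smul_univ]
  simp

/-- The length element of the metric of a `(1,1)`-form, as an extended norm on tangent spaces. -/
@[reducible] def formENorm (om : X → Cn n [⋀^Fin 2]→L[ℝ] ℝ) (x : X) :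
    ENorm (TangentSpace 𝓘(ℝ, Cn n) x) :=
  ⟨fun v => ENNReal.ofReal √(metricOf om x v v)⟩

theorem formENorm_smulClass (om : X → Cn n [⋀^Fin 2]→L[ℝ] ℝ) (x : X) :
    letI := formENorm om x
    ENormSMulClass ℝ (TangentSpace 𝓘(ℝ, Cn n) x) := by
  let _ := formENorm om x
  refine ⟨fun c (v : Cn n) => ?_⟩
  change ENNReal.ofReal √(metricOf om x (c • v) (c • v)) =
    ‖c‖ₑ * ENNReal.ofReal √(metricOf om x v v)
  rw [metricOf_smul_self, Real.sqrt_mul (sq_nonneg c), Real.sqrt_sq_eq_abs,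
    ENNReal.ofReal_mul (abs_nonneg c), Real.enorm_eq_ofReal_abs]

/-- The length of a curve between two parameter values. -/
def curveLength (om : X → Cn n [⋀^Fin 2]→L[ℝ] ℝ) (γ : ℝ → X) (a b : ℝ) : ℝ≥0∞ :=
  letI := formENorm om
  Manifold.pathELength 𝓘(ℝ, Cn n) γ a b

theorem curveLength_eq (om : X → Cn n [⋀^Fin 2]→L[ℝ] ℝ) (γ : ℝ → X) (a b : ℝ) :
    curveLength om γ a b = ∫⁻ t in Icc a b, ENNReal.ofReal √(metricOf om (γ t)
      (mfderivWithin 𝓘(ℝ, ℝ) 𝓘(ℝ, Cn n) γ (Icc a b) t (1 : ℝ))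
      (mfderivWithin 𝓘(ℝ, ℝ) 𝓘(ℝ, Cn n) γ (Icc a b) t (1 : ℝ))) := by
  let _ := formENorm om
  exact Manifold.pathELength_eq_lintegral_mfderivWithin_Icc

theorem curveLength_eq_mfderiv (om : X → Cn n [⋀^Fin 2]→L[ℝ] ℝ) (γ : ℝ → X) (a b : ℝ) :
    curveLength om γ a b = ∫⁻ t in Icc a b, ENNReal.ofReal √(metricOf om (γ t)
      (mfderiv 𝓘(ℝ, ℝ) 𝓘(ℝ, Cn n) γ t (1 : ℝ)) (mfderiv 𝓘(ℝ, ℝ) 𝓘(ℝ, Cn n) γ t (1 : ℝ))) := by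
  let _ := formENorm om
  exact Manifold.pathELength_eq_lintegral_mfderiv_Icc

theorem curveLength_add (om : X → Cn n [⋀^Fin 2]→L[ℝ] ℝ) (γ : ℝ → X) {a b c : ℝ} (h : a ≤ b)
    (h' : b ≤ c) : curveLength om γ a b + curveLength om γ b c = curveLength om γ a c := by
  let _ := formENorm om
  exact Manifold.pathELength_add h h'

theorem curveLength_self (om : X → Cn n [⋀^Fin 2]→L[ℝ] ℝ) (γ : ℝ → X) (a : ℝ) :
    curveLength om γ a a = 0 := by
  let _ := formENorm om
  exact Manifold.pathELength_self

theorem curveLength_congr_Ioo (om : X → Cn n [⋀^Fin 2]→L[ℝ] ℝ) {γ γ' : ℝ → X} {a b : ℝ}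
    (h : EqOn γ γ' (Ioo a b)) : curveLength om γ a b = curveLength om γ' a b := by
  let _ := formENorm om
  exact Manifold.pathELength_congr_Ioo h

theorem curveLength_comp_of_monotoneOn (om : X → Cn n [⋀^Fin 2]→L[ℝ] ℝ) {γ : ℝ → X} {a b : ℝ}
    {f : ℝ → ℝ} (h : a ≤ b) (hf : MonotoneOn f (Icc a b)) (h'f : DifferentiableOn ℝ f (Icc a b))
    (hγ : MDifferentiableOn 𝓘(ℝ, ℝ) 𝓘(ℝ, Cn n) γ (Icc (f a) (f b))) :
    curveLength om (γ ∘ f) a b = curveLength om γ (f a) (f b) := by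
  let _ := formENorm om
  let _ := formENorm_smulClass om
  exact Manifold.pathELength_comp_of_monotoneOn h hf h'f hγ

theorem curveLength_comp_of_antitoneOn (om : X → Cn n [⋀^Fin 2]→L[ℝ] ℝ) {γ : ℝ → X} {a b : ℝ}
    {f : ℝ → ℝ} (h : a ≤ b) (hf : AntitoneOn f (Icc a b)) (h'f : DifferentiableOn ℝ f (Icc a b))
    (hγ : MDifferentiableOn 𝓘(ℝ, ℝ) 𝓘(ℝ, Cn n) γ (Icc (f b) (f a))) :
    curveLength om (γ ∘ f) a b = curveLength om γ (f b) (f a) := by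
  let _ := formENorm om
  let _ := formENorm_smulClass om
  exact Manifold.pathELength_comp_of_antitoneOn h hf h'f hγ

variable {Y : Set X} {om : X → Cn n [⋀^Fin 2]→L[ℝ] ℝ}

theorem geodesicDist_le_curveLength {γ : ℝ → X} {a b : ℝ} (hab : a ≤ b)
    (hγ : ContMDiffOn 𝓘(ℝ, ℝ) 𝓘(ℝ, Cn n) 1 γ (Icc a b)) (hY : MapsTo γ (Icc a b) Y) :
    geodesicDist Y om (γ a) (γ b) ≤ curveLength om γ a b := by
  let η : ℝ → ℝ := fun t => a + t * (b - a)
  have hη0 : η 0 = a := by simp [η]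
  have hη1 : η 1 = b := by simp [η]
  have hmaps : MapsTo η (Icc 0 1) (Icc a b) := fun t ht => by
    have := mul_nonneg ht.1 (sub_nonneg.2 hab)
    have := mul_le_mul_of_nonneg_right ht.2 (sub_nonneg.2 hab)
    constructor <;> simp only [η] <;> linarith
  have hηs : ContDiff ℝ 1 η := by fun_prop
  have hlen : pathLength om (γ ∘ η) = curveLength om γ a b := by
    have h1 : pathLength om (γ ∘ η) = curveLength om (γ ∘ η) 0 1 := (curveLength_eq _ _ _ _).symm
    rw [h1, curveLength_comp_of_monotoneOn om zero_le_one, hη0, hη1]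
    · intro s _ t _ hst
      have := mul_le_mul_of_nonneg_right hst (sub_nonneg.2 hab)
      simp only [η]; linarith
    · exact (hηs.differentiable one_ne_zero).differentiableOn
    · rw [hη0, hη1]; exact hγ.mdifferentiableOn one_ne_zero
  rw [← hlen]
  refine iInf₂_le_of_le (γ ∘ η) ⟨?_, hY.comp hmaps, by simp [hη0], by simp [hη1]⟩ le_rfl
  exact hγ.comp (contMDiffOn_iff_contDiffOn.2 hηs.contDiffOn) hmaps

theorem exists_curve_of_geodesicDist_lt {x y : X} {r : ℝ≥0∞} (h : geodesicDist Y om x y < r) :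
    ∃ γ : ℝ → X, ContMDiffOn 𝓘(ℝ, ℝ) 𝓘(ℝ, Cn n) 1 γ (Icc 0 1) ∧ MapsTo γ (Icc 0 1) Y ∧
      γ 0 = x ∧ γ 1 = y ∧ curveLength om γ 0 1 < r := by
  simp only [geodesicDist, iInf_lt_iff] at h
  obtain ⟨γ, ⟨h1, h2, h3, h4⟩, h5⟩ := h
  exact ⟨γ, h1, h2, h3, h4, by rwa [curveLength_eq]⟩

/-- Curves can be reparametrized to be constant near their end points, and then be glued. -/
theorem exists_locallyConstant_curve {x y : X} {r : ℝ≥0∞} {a b : ℝ} (hab : a < b)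
    (h : geodesicDist Y om x y < r) :
    ∃ γ : ℝ → X, γ a = x ∧ γ b = y ∧ ContMDiff 𝓘(ℝ, ℝ) 𝓘(ℝ, Cn n) 1 γ ∧ (∀ t, γ t ∈ Y) ∧
      curveLength om γ a b < r ∧ γ =ᶠ[𝓝 a] (fun _ => x) ∧ γ =ᶠ[𝓝 b] (fun _ => y) := by
  obtain ⟨γ, γ_smooth, hγY, hγx, hγy, hγ⟩ := exists_curve_of_geodesicDist_lt h
  rcases exists_between hab with ⟨a', haa', ha'b⟩
  rcases exists_between ha'b with ⟨b', ha'b', hb'b⟩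
  let η (t : ℝ) : ℝ := Real.smoothTransition ((b' - a')⁻¹ * (t - a'))
  have A (t) (ht : t < a') : η t = 0 := by
    simp only [η, Real.smoothTransition.zero_iff_nonpos]
    apply mul_nonpos_of_nonneg_of_nonpos
    · simpa using ha'b'.le
    · linarith
  have A' (t) (ht : t < a') : (γ ∘ η) t = x := by simp [A t ht, hγx]
  have B (t) (ht : b' < t) : η t = 1 := by
    simp only [η, Real.smoothTransition.eq_one_iff_one_le, inv_mul_eq_div]
    rw [one_le_div₀] <;> linarith
  have B' (t) (ht : b' < t) : (γ ∘ η) t = y := by simp [B t ht, hγy]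
  have hη : ∀ t, η t ∈ Icc (0 : ℝ) 1 := fun t =>
    ⟨Real.smoothTransition.nonneg _, Real.smoothTransition.le_one _⟩
  refine ⟨γ ∘ η, A' _ haa', B' _ hb'b, ?_, fun t => hγY (hη t), ?_, ?_, ?_⟩
  · rw [← contMDiffOn_univ]
    apply γ_smooth.comp
    · rw [contMDiffOn_univ, contMDiff_iff_contDiff]
      fun_prop
    · exact fun t _ => hη t
  · convert! hγ using 1
    rw [← A a haa', ← B b hb'b]
    apply curveLength_comp_of_monotoneOn om hab.le
    · apply Monotone.monotoneOn
      apply Real.smoothTransition.monotone.comp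
      intro t u htu
      dsimp only
      gcongr
    · simp only [η]
      apply (ContDiff.contDiffOn _).differentiableOn one_ne_zero
      fun_prop
    · rw [A a haa', B b hb'b]
      apply γ_smooth.mdifferentiableOn one_ne_zero
  · filter_upwards [Iio_mem_nhds haa'] with t ht using A' t ht
  · filter_upwards [Ioi_mem_nhds hb'b] with t ht using B' t ht

theorem geodesicDist_self {x : X} (hx : x ∈ Y) : geodesicDist Y om x x = 0 := by
  have := geodesicDist_le_curveLength (Y := Y) (om := om) (γ := fun _ => x) (le_refl (0 : ℝ))
    contMDiffOn_const (fun _ _ => hx)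
  rwa [curveLength_self, nonpos_iff_eq_zero] at this

theorem geodesicDist_comm (x y : X) : geodesicDist Y om x y = geodesicDist Y om y x := by
  suffices H : ∀ x y, geodesicDist Y om y x ≤ geodesicDist Y om x y from le_antisymm (H y x) (H x y)
  intro x y
  apply le_of_forall_gt (fun r hr => ?_)
  obtain ⟨γ, γ0, γ1, γ_smooth, hγY, hγ, -⟩ := exists_locallyConstant_curve (zero_lt_one' ℝ) hr
  let η : ℝ → ℝ := fun t => -t
  have h_smooth : ContMDiff 𝓘(ℝ, ℝ) 𝓘(ℝ, Cn n) 1 (γ ∘ η) := by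
    apply γ_smooth.comp ?_
    simp only [contMDiff_iff_contDiff]
    fun_prop
  have h1 := geodesicDist_le_curveLength (Y := Y) (om := om) (γ := γ ∘ η) (a := -1) (b := 0)
    (by norm_num) h_smooth.contMDiffOn (fun t _ => hγY _)
  rw [curveLength_comp_of_antitoneOn om (by norm_num)] at h1
  · simp only [η, Function.comp_apply, neg_neg, neg_zero, γ0, γ1] at h1
    exact h1.trans_lt hγ
  · exact monotone_id.neg.antitoneOn _
  · exact differentiableOn_neg _
  · exact γ_smooth.contMDiffOn.mdifferentiableOn one_ne_zero

theorem geodesicDist_triangle (x y z : X) :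
    geodesicDist Y om x z ≤ geodesicDist Y om x y + geodesicDist Y om y z := by
  apply le_of_forall_gt (fun r hr => ?_)
  rcases ENNReal.exists_add_lt_of_add_lt hr with ⟨u, hu, v, hv, huv⟩
  obtain ⟨γ₁, h10, h11, h1s, h1Y, h1, -, h1c⟩ := exists_locallyConstant_curve (zero_lt_one' ℝ) hu
  obtain ⟨γ₂, h20, h21, h2s, h2Y, h2, h2c, -⟩ := exists_locallyConstant_curve (one_lt_two (α := ℝ)) hv
  let γ := piecewise (Iic 1) γ₁ γ₂
  have hγ0 : γ 0 = x := by simp [γ, h10]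
  have hγ2 : γ 2 = z := by simp [γ, h21]
  have h3 := geodesicDist_le_curveLength (Y := Y) (om := om) (γ := γ) zero_le_two
    (ContMDiff.contMDiffOn (ContMDiff.piecewise_Iic h1s h2s (h1c.trans h2c.symm)))
    (fun t _ => by
      by_cases ht : t ∈ Iic (1 : ℝ)
      · simp only [γ, piecewise_eq_of_mem _ _ _ ht]; exact h1Y t
      · simp only [γ, piecewise_eq_of_notMem _ _ _ ht]; exact h2Y t)
  rw [hγ0, hγ2] at h3
  refine h3.trans_lt (lt_trans ?_ huv)
  rw [← curveLength_add om γ zero_le_one one_le_two]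
  refine ENNReal.add_lt_add ?_ ?_
  · convert! h1 using 1
    apply curveLength_congr_Ioo
    intro t ht
    simp [γ, ht.2.le]
  · convert! h2 using 1
    apply curveLength_congr_Ioo
    intro t ht
    simp [γ, ht.1]

/-- The geodesic distance is a length distance: a curve can be cut at a prescribed length. -/
theorem exists_between_of_geodesicDist_lt {x y : X} {r s : ℝ} (hr : 0 < r) (hs : 0 < s)
    (h : geodesicDist Y om x y < ENNReal.ofReal (r + s)) :
    ∃ z ∈ Y, geodesicDist Y om x z < ENNReal.ofReal r ∧
      geodesicDist Y om z y < ENNReal.ofReal s := by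
  obtain ⟨γ, hγ, hγY, rfl, rfl, hlt⟩ := exists_curve_of_geodesicDist_lt h
  have hcut : ∀ t ∈ Icc (0 : ℝ) 1, curveLength om γ 0 t < ENNReal.ofReal r →
      curveLength om γ t 1 < ENNReal.ofReal s → ∃ z ∈ Y,
        geodesicDist Y om (γ 0) z < ENNReal.ofReal r ∧
        geodesicDist Y om z (γ 1) < ENNReal.ofReal s := fun t ht h1 h2 =>
    ⟨γ t, hγY ht, (geodesicDist_le_curveLength ht.1 (hγ.mono (Icc_subset_Icc_right ht.2))
      (hγY.mono_left (Icc_subset_Icc_right ht.2))).trans_lt h1,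
      (geodesicDist_le_curveLength ht.2 (hγ.mono (Icc_subset_Icc_left ht.1))
      (hγY.mono_left (Icc_subset_Icc_left ht.1))).trans_lt h2⟩
  obtain ⟨ε, hε, hεlt⟩ : ∃ ε : ℝ≥0∞, 0 < ε ∧
      curveLength om γ 0 1 + ε < ENNReal.ofReal r + ENNReal.ofReal s := by
    rw [← ENNReal.ofReal_add hr.le hs.le]
    obtain ⟨q, hq1, hq2⟩ := exists_between hlt
    exact ⟨q - curveLength om γ 0 1, tsub_pos_of_lt hq1, by rwa [add_tsub_cancel_of_le hq1.le]⟩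
  -- steps of a fine subdivision are short
  obtain ⟨δ, hδ, hδε⟩ := exists_pos_setLIntegral_lt_of_measure_lt (μ := volume.restrict (Icc 0 1))
    (f := fun t => ENNReal.ofReal √(metricOf om (γ t)
      (mfderiv 𝓘(ℝ, ℝ) 𝓘(ℝ, Cn n) γ t (1 : ℝ)) (mfderiv 𝓘(ℝ, ℝ) 𝓘(ℝ, Cn n) γ t (1 : ℝ))))
    (by rw [← curveLength_eq_mfderiv]; exact hlt.ne_top) hε.ne'
  obtain ⟨N, hN⟩ : ∃ N : ℕ, ENNReal.ofReal (1 / (N + 1 : ℝ)) < δ := by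
    have h1 : Tendsto (fun N : ℕ => ENNReal.ofReal (1 / (N + 1 : ℝ))) atTop (𝓝 0) := by
      simpa using ENNReal.tendsto_ofReal tendsto_one_div_add_atTop_nhds_zero_nat
    exact (h1.eventually (gt_mem_nhds hδ)).exists
  have hN0 : (0 : ℝ) < N + 1 := by positivity
  let t : ℕ → ℝ := fun k => k / (N + 1)
  have ht0 : t 0 = 0 := by simp [t]
  have ht1 : t (N + 1) = 1 := by simp only [t]; push_cast; field_simp
  have htm : Monotone t := fun i j hij => by simp only [t]; gcongr
  have hstep : ∀ k, k < N + 1 → curveLength om γ (t k) (t (k + 1)) < ε := by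
    intro k hk
    have hsub : Icc (t k) (t (k + 1)) ⊆ Icc 0 1 :=
      Icc_subset_Icc (ht0 ▸ htm (Nat.zero_le k)) (ht1 ▸ htm hk)
    have := hδε (Icc (t k) (t (k + 1))) (by
      refine (Measure.restrict_apply_le _ _).trans_lt ?_
      rw [Real.volume_Icc]
      convert hN using 2
      simp only [t]; push_cast; field_simp; ring)
    rwa [Measure.restrict_restrict measurableSet_Icc, inter_eq_self_of_subset_left hsub,
      ← curveLength_eq_mfderiv] at this
  by_cases hall : curveLength om γ 0 1 < ENNReal.ofReal r
  · exact hcut 1 (by simp) hall (by rw [curveLength_self]; simpa using hs)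
  · have hex : ∃ k, ¬ curveLength om γ 0 (t k) < ENNReal.ofReal r := ⟨N + 1, by rwa [ht1]⟩
    classical
    obtain ⟨k, hk1, hk2, hkN⟩ : ∃ k, curveLength om γ 0 (t k) < ENNReal.ofReal r ∧
        ¬ curveLength om γ 0 (t (k + 1)) < ENNReal.ofReal r ∧ k < N + 1 := by
      have h0 : Nat.find hex ≠ 0 := fun h0 => by
        have := Nat.find_spec hex
        rw [h0, ht0, curveLength_self] at this
        exact this (by simpa using hr)
      obtain ⟨k, hk⟩ := Nat.exists_eq_succ_of_ne_zero h0
      refine ⟨k, not_not.1 (Nat.find_min hex (by omega)), ?_, ?_⟩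
      · rw [← Nat.succ_eq_add_one, ← hk]; exact Nat.find_spec hex
      · have : Nat.find hex ≤ N + 1 := Nat.find_min' hex (by rwa [ht1])
        omega
    have hk01 : t k ∈ Icc (0 : ℝ) 1 := ⟨ht0 ▸ htm (Nat.zero_le k), ht1 ▸ htm hkN.le⟩
    have hk01' : t (k + 1) ∈ Icc (0 : ℝ) 1 := ⟨ht0 ▸ htm (Nat.zero_le _), ht1 ▸ htm hkN⟩
    refine hcut (t k) hk01 hk1 ?_
    have e1 := curveLength_add om γ (htm (Nat.le_succ k)) hk01'.2
    have e2 := curveLength_add om γ hk01'.1 hk01'.2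
    rw [← e1]
    have : ENNReal.ofReal r + (curveLength om γ (t k) (t (k + 1)) + curveLength om γ (t (k + 1)) 1)
        < ENNReal.ofReal r + ENNReal.ofReal s := by
      refine lt_of_le_of_lt ?_ hεlt
      rw [← e2]
      calc _ = (ENNReal.ofReal r + curveLength om γ (t (k + 1)) 1) +
            curveLength om γ (t k) (t (k + 1)) := by ring
        _ ≤ _ := add_le_add (add_le_add_left (not_lt.1 hk2) _) (hstep k hkN).le
    exact lt_of_add_lt_add_left this

/-- A function whose differential is bounded by `C` is `C`-Lipschitz for the geodesic distance. -/
theorem edist_le_mul_geodesicDist {f : X → ℝ} {C : ℝ} (hC : 0 ≤ C)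
    (hf : ContMDiff 𝓘(ℝ, Cn n) 𝓘(ℝ, ℝ) ∞ f)
    (hfC : ∀ x ∈ Y, ∀ v, |dReal f x v| ≤ C * √(metricOf om x v v)) (x y : X)
    (hxy : geodesicDist Y om x y ≠ ⊤) :
    edist (f x) (f y) ≤ ENNReal.ofReal C * geodesicDist Y om x y := by
  have key : ∀ r, geodesicDist Y om x y < r → edist (f x) (f y) ≤ ENNReal.ofReal C * r := by
    intro r hr
    obtain ⟨γ, hγ, hγY, rfl, rfl, hlt⟩ := exists_curve_of_geodesicDist_lt hr
    have hfγ : ContDiffOn ℝ 1 (f ∘ γ) (Icc 0 1) := by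
      rw [← contMDiffOn_iff_contDiffOn]
      exact (hf.of_le (by exact_mod_cast le_top)).comp_contMDiffOn hγ
    have h1 := enorm_sub_le_lintegral_derivWithin_Icc_of_contDiffOn_Icc hfγ zero_le_one
    rw [edist_comm, edist_eq_enorm_sub]
    refine h1.trans (le_trans ?_ (mul_le_mul_right hlt.le _))
    rw [curveLength_eq, ← lintegral_const_mul' _ _ ENNReal.ofReal_ne_top]
    refine setLIntegral_mono' measurableSet_Icc fun t ht => ?_
    have hu : UniqueMDiffWithinAt 𝓘(ℝ, ℝ) (Icc (0 : ℝ) 1) t := by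
      rw [uniqueMDiffWithinAt_iff_uniqueDiffWithinAt]
      exact uniqueDiffOn_Icc zero_lt_one t ht
    have h2 : mfderivWithin 𝓘(ℝ, ℝ) 𝓘(ℝ, ℝ) (f ∘ γ) (Icc 0 1) t =
        (mfderiv 𝓘(ℝ, Cn n) 𝓘(ℝ, ℝ) f (γ t)).comp
          (mfderivWithin 𝓘(ℝ, ℝ) 𝓘(ℝ, Cn n) γ (Icc 0 1) t) :=
      mfderiv_comp_mfderivWithin t ((hf.mdifferentiable (by simp)) (γ t))
        (hγ.mdifferentiableOn one_ne_zero t ht) hu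
    have h3 : derivWithin (f ∘ γ) (Icc 0 1) t =
        dReal f (γ t) (mfderivWithin 𝓘(ℝ, ℝ) 𝓘(ℝ, Cn n) γ (Icc 0 1) t (1 : ℝ)) := by
      rw [← fderivWithin_derivWithin, ← mfderivWithin_eq_fderivWithin, h2]
      rfl
    rw [h3, Real.enorm_eq_ofReal_abs, ← ENNReal.ofReal_mul hC]
    exact ENNReal.ofReal_le_ofReal (hfC _ (hγY ht) _)
  refine ENNReal.le_of_forall_pos_le_add fun ε hε _ => ?_
  have hC1 : (0 : ℝ) < C + 1 := by linarith
  have hε' : (0 : ℝ≥0∞) < ENNReal.ofReal (ε / (C + 1)) := by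
    simp only [ENNReal.ofReal_pos]; positivity
  refine (key _ (ENNReal.lt_add_right hxy hε'.ne')).trans ?_
  rw [mul_add]
  gcongr
  rw [← ENNReal.ofReal_mul hC, ← ENNReal.ofReal_coe_nnreal]
  apply ENNReal.ofReal_le_ofReal
  rw [mul_div_assoc', div_le_iff₀ hC1]
  nlinarith [ε.2]

end Length

/-! ### Comparison of the geodesic distance with charts -/

section Gauge

variable {n : ℕ} {X : Type*} [TopologicalSpace X] [ChartedSpace (Cn n) X]
  [IsManifold 𝓘(ℂ, Cn n) ω X] {Y : Set X} {om : X → Cn n [⋀^Fin 2]→L[ℝ] ℝ}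

theorem continuousOn_metric_prod (hom : IsPositiveForm Y om) (x₀ : X) :
    ContinuousOn (fun p : Cn n × Cn n => metricOf om ((chartAt (Cn n) x₀).symm p.1)
        (chartSymmDeriv x₀ p.1 p.2) (chartSymmDeriv x₀ p.1 p.2))
      ({z ∈ (chartAt (Cn n) x₀).target | (chartAt (Cn n) x₀).symm z ∈ Y} ×ˢ univ) := by
  have hexp : ∀ p ∈ {z ∈ (chartAt (Cn n) x₀).target | (chartAt (Cn n) x₀).symm z ∈ Y} ×ˢ
      (univ : Set (Cn n)), metricOf om ((chartAt (Cn n) x₀).symm p.1)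
        (chartSymmDeriv x₀ p.1 p.2) (chartSymmDeriv x₀ p.1 p.2) =
      ∑ i, ∑ j, (realBas n).equivFunL p.2 i * ((realBas n).equivFunL p.2 j *
        metricOf om ((chartAt (Cn n) x₀).symm p.1) (chartSymmDeriv x₀ p.1 (realBas n i))
          (chartSymmDeriv x₀ p.1 (realBas n j))) := by
    rintro ⟨z, w⟩ ⟨hz, -⟩
    have hg := hom.isHermScalar hz.2
    conv_lhs => rw [← (realBas n).sum_equivFun w]
    simp only [map_sum, map_smul]
    rw [← hg.toLin_apply, map_sum hg.toLin, LinearMap.sum_apply]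
    refine Finset.sum_congr rfl fun i _ => ?_
    rw [map_sum]
    refine Finset.sum_congr rfl fun j _ => ?_
    rw [hg.toLin_apply, hg.smul_left, hg.smul_right]
    rfl
  refine ContinuousOn.congr ?_ hexp
  refine continuousOn_finsetSum _ fun i _ => continuousOn_finsetSum _ fun j _ => ?_
  have hc : ∀ i, Continuous fun p : Cn n × Cn n => (realBas n).equivFunL p.2 i := fun i =>
    (continuous_apply i).comp ((realBas n).equivFunL.continuous.comp continuous_snd)
  refine (hc i).continuousOn.mul ((hc j).continuousOn.mul ?_)
  exact (contDiffOn_metric hom x₀ _ _).continuousOn.comp continuousOn_fst fun p hp => hp.1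

/-- Near a point, the metric is comparable in the chart with a fixed gauge. -/
theorem exists_local_gauge (hY : IsOpen Y) (hom : IsPositiveForm Y om) {x₀ : X} (hx₀ : x₀ ∈ Y) :
    ∃ (r m M : ℝ) (N : Cn n → ℝ), 0 < r ∧ 0 < m ∧ 0 < M ∧
      (∀ t : ℝ, 0 ≤ t → ∀ w, N (t • w) = t * N w) ∧ (∀ w, m * ‖w‖ ≤ N w) ∧ (∀ w, N w ≤ M * ‖w‖) ∧
      Metric.closedBall (chartAt (Cn n) x₀ x₀) r ⊆
        {z ∈ (chartAt (Cn n) x₀).target | (chartAt (Cn n) x₀).symm z ∈ Y} ∧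
      ∀ z ∈ Metric.closedBall (chartAt (Cn n) x₀ x₀) r, ∀ w,
        N w ≤ 2 * √(metricOf om ((chartAt (Cn n) x₀).symm z) (chartSymmDeriv x₀ z w)
          (chartSymmDeriv x₀ z w)) ∧
        √(metricOf om ((chartAt (Cn n) x₀).symm z) (chartSymmDeriv x₀ z w)
          (chartSymmDeriv x₀ z w)) ≤ 2 * N w := by
  set dom := {z ∈ (chartAt (Cn n) x₀).target | (chartAt (Cn n) x₀).symm z ∈ Y} with hdom
  set z₀ := chartAt (Cn n) x₀ x₀ with hz₀
  set G : Cn n → Cn n → ℝ := fun z w => metricOf om ((chartAt (Cn n) x₀).symm z)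
    (chartSymmDeriv x₀ z w) (chartSymmDeriv x₀ z w) with hG
  have hdo : IsOpen dom := isOpen_chart_preimage x₀ hY
  have hz₀d : z₀ ∈ dom := ⟨mem_chart_target _ _, by
    rw [(chartAt (Cn n) x₀).left_inv (mem_chart_source _ _)]; exact hx₀⟩
  have hGc : ContinuousOn (fun p : Cn n × Cn n => G p.1 p.2) (dom ×ˢ univ) :=
    continuousOn_metric_prod hom x₀
  have hGpos : ∀ z ∈ dom, ∀ w ≠ 0, 0 < G z w := fun z hz w hw =>
    (hom.isHermScalar hz.2).pos _ fun h0 => hw (chartSymmDeriv_injective hz.1 (by rw [h0, map_zero]))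
  have hGs : ∀ z (t : ℝ) w, G z (t • w) = t ^ 2 * G z w := fun z t w => by
    simp only [hG, map_smul, metricOf_smul_self]
  have hG0 : Continuous (G z₀) := by
    rw [← continuousOn_univ]
    exact hGc.comp (f := fun w => (z₀, w)) (by fun_prop) fun w _ => ⟨hz₀d, mem_univ _⟩
  -- by homogeneity it is enough to compare on the unit sphere
  have hnormal : ∀ w : Cn n, w ≠ 0 → ∃ w' ∈ Metric.sphere (0 : Cn n) 1, w = ‖w‖ • w' :=
    fun w hw => ⟨‖w‖⁻¹ • w, by
      simp [norm_smul, inv_mul_cancel₀ (norm_ne_zero_iff.2 hw)], by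
      rw [smul_smul, mul_inv_cancel₀ (norm_ne_zero_iff.2 hw), one_smul]⟩
  have hcomp : IsCompact (Metric.sphere (0 : Cn n) 1) := isCompact_sphere _ _
  have hne : ∀ w ∈ Metric.sphere (0 : Cn n) 1, w ≠ 0 := fun w hw h0 => by simp [h0] at hw
  obtain ⟨μ, hμ, hμG⟩ : ∃ μ : ℝ, 0 < μ ∧ ∀ w ∈ Metric.sphere (0 : Cn n) 1, μ ≤ G z₀ w := by
    rcases (Metric.sphere (0 : Cn n) 1).eq_empty_or_nonempty with h | h
    · exact ⟨1, one_pos, fun w hw => by simp [h] at hw⟩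
    · obtain ⟨w, hw, hmin⟩ := hcomp.exists_isMinOn h hG0.continuousOn
      exact ⟨G z₀ w, hGpos _ hz₀d _ (hne w hw), fun w' hw' => hmin hw'⟩
  obtain ⟨M, hM⟩ := hcomp.exists_bound_of_continuousOn hG0.continuousOn
  -- by compactness of the sphere, the comparison at `z₀` persists, up to a factor, nearby
  obtain ⟨U, V, hU, -, hzU, hSV, hUV⟩ := generalized_tube_lemma (isCompact_singleton (x := z₀)) hcomp
    (n := {p ∈ dom ×ˢ univ | G z₀ p.2 - 2 * G p.1 p.2 < 0 ∧ G p.1 p.2 - 2 * G z₀ p.2 < 0}) (by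
      have h0 : ContinuousOn (fun p : Cn n × Cn n => G z₀ p.2) (dom ×ˢ univ) :=
        (hG0.comp continuous_snd).continuousOn
      have ho := hdo.prod (isOpen_univ (X := Cn n))
      have h1 := (h0.sub (hGc.const_smul (2 : ℝ))).isOpen_inter_preimage ho (isOpen_Iio (a := 0))
      have h2 := (hGc.sub (h0.const_smul (2 : ℝ))).isOpen_inter_preimage ho (isOpen_Iio (a := 0))
      convert h1.inter h2 using 1
      ext p
      simp only [mem_ofPred_eq, mem_inter_iff, mem_preimage, mem_Iio, smul_eq_mul, Pi.sub_apply,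
        Pi.smul_apply]
      tauto) (by
      rintro ⟨z, w⟩ ⟨hz, hw⟩
      rw [mem_singleton_iff] at hz
      subst hz
      have := hGpos _ hz₀d w (hne w hw)
      exact ⟨⟨hz₀d, mem_univ _⟩, by simp only; linarith, by simp only; linarith⟩)
  obtain ⟨r, hr, hrU⟩ := Metric.nhds_basis_closedBall.mem_iff.1
    (Filter.inter_mem (hU.mem_nhds (hzU rfl)) (hdo.mem_nhds hz₀d))
  have hsqrt : ∀ z w (c : ℝ), 0 ≤ c → √(G z (c • w)) = c * √(G z w) := fun z w c hc => by
    rw [hGs, Real.sqrt_mul (sq_nonneg c), Real.sqrt_sq hc]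
  have h00 : ∀ z, G z 0 = 0 := fun z => by simpa using hGs z 0 0
  refine ⟨r, √μ, √(max M 1), fun w => √(G z₀ w), hr, Real.sqrt_pos.2 hμ, by positivity,
    fun t ht w => hsqrt _ _ _ ht, fun w => ?_, fun w => ?_, fun z hz => (hrU hz).2,
    fun z hz w => ?_⟩
  · rcases eq_or_ne w 0 with rfl | hw
    · simp
    · obtain ⟨w', hw', he⟩ := hnormal w hw
      conv_rhs => rw [he]
      beta_reduce
      rw [hsqrt _ _ _ (norm_nonneg w), mul_comm]
      exact mul_le_mul_of_nonneg_left (Real.sqrt_le_sqrt (hμG w' hw')) (norm_nonneg w)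
  · rcases eq_or_ne w 0 with rfl | hw
    · simp [h00]
    · obtain ⟨w', hw', he⟩ := hnormal w hw
      conv_lhs => rw [he]
      beta_reduce
      rw [hsqrt _ _ _ (norm_nonneg w), mul_comm]
      refine mul_le_mul_of_nonneg_right (Real.sqrt_le_sqrt ?_) (norm_nonneg w)
      exact (le_abs_self _).trans ((hM w' hw').trans (le_max_left _ _))
  · change √(G z₀ w) ≤ 2 * √(G z w) ∧ √(G z w) ≤ 2 * √(G z₀ w)
    rcases eq_or_ne w 0 with rfl | hw
    · simp [h00]
    · obtain ⟨w', hw', he⟩ := hnormal w hw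
      rw [he, hsqrt _ _ _ (norm_nonneg w), hsqrt _ _ _ (norm_nonneg w)]
      obtain ⟨-, h1, h2⟩ := hUV (mk_mem_prod (hrU hz).1 (hSV hw'))
      simp only at h1 h2
      have h3 : ∀ a b : ℝ, 0 < b → a - 2 * b < 0 → √a ≤ 2 * √b := fun a b hb hab => by
        rw [Real.sqrt_le_left (by positivity), mul_pow, Real.sq_sqrt hb.le]
        linarith
      have p1 := hGpos z (hrU hz).2 w' (hne w' hw')
      have p2 := hGpos z₀ hz₀d w' (hne w' hw')
      have := h3 _ _ p1 h1
      have := h3 _ _ p2 h2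
      constructor <;> nlinarith [norm_nonneg w]

/-- Straight segments in a chart bound the geodesic distance by the gauge. -/
theorem geodesicDist_chart_le {x₀ : X} {z₀ : Cn n} {r : ℝ} {N : Cn n → ℝ}
    (hsub : Metric.closedBall z₀ r ⊆
      {z ∈ (chartAt (Cn n) x₀).target | (chartAt (Cn n) x₀).symm z ∈ Y})
    (hN : ∀ z ∈ Metric.closedBall z₀ r, ∀ w,
      √(metricOf om ((chartAt (Cn n) x₀).symm z) (chartSymmDeriv x₀ z w)
          (chartSymmDeriv x₀ z w)) ≤ 2 * N w)
    {z z' : Cn n} (hz : z ∈ Metric.closedBall z₀ r) (hz' : z' ∈ Metric.closedBall z₀ r) :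
    geodesicDist Y om ((chartAt (Cn n) x₀).symm z) ((chartAt (Cn n) x₀).symm z') ≤
      ENNReal.ofReal (2 * N (z' - z)) := by
  set e := (chartAt (Cn n) x₀)
  let σ : ℝ → Cn n := fun t => z + t • (z' - z)
  have hσ : ∀ t ∈ Icc (0 : ℝ) 1, σ t ∈ Metric.closedBall z₀ r := fun t ht => by
    have := (convex_closedBall z₀ r).add_smul_sub_mem hz hz' ht
    exact this
  have hσs : ContDiff ℝ ∞ σ := by fun_prop
  have hγ : ContMDiffOn 𝓘(ℝ, ℝ) 𝓘(ℝ, Cn n) 1 (e.symm ∘ σ) (Icc 0 1) := by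
    refine ((contMDiffOn_chart_symm (I := 𝓘(ℝ, Cn n)) (n := ∞) (x := x₀)).of_le
      (by exact_mod_cast le_top)).comp (t := e.target)
      (contMDiffOn_iff_contDiffOn.2 (hσs.of_le (by exact_mod_cast le_top)).contDiffOn) ?_
    exact fun t ht => (hsub (hσ t ht)).1
  have h1 := geodesicDist_le_curveLength (Y := Y) (om := om) zero_le_one hγ
    (fun t ht => (hsub (hσ t ht)).2)
  have h0' : (e.symm ∘ σ) 0 = e.symm z := by simp [σ]
  have h1' : (e.symm ∘ σ) 1 = e.symm z' := by simp [σ]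
  rw [h0', h1'] at h1
  refine h1.trans ?_
  rw [curveLength_eq_mfderiv]
  refine (setLIntegral_mono' measurableSet_Icc (g := fun _ => ENNReal.ofReal (2 * N (z' - z)))
    fun t ht => ENNReal.ofReal_le_ofReal ?_).trans (by simp)
  have h2 : mfderiv 𝓘(ℝ, ℝ) 𝓘(ℝ, Cn n) (e.symm ∘ σ) t =
      (mfderiv 𝓘(ℝ, Cn n) 𝓘(ℝ, Cn n) e.symm (σ t)).comp (mfderiv 𝓘(ℝ, ℝ) 𝓘(ℝ, Cn n) σ t) :=
    mfderiv_comp t (mdifferentiableAt_chart_symm (hsub (hσ t ht)).1)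
      ((hσs.contMDiff.mdifferentiable (by simp)) t)
  have h3 : (mfderiv 𝓘(ℝ, ℝ) 𝓘(ℝ, Cn n) σ t (1 : ℝ) : Cn n) = z' - z := by
    rw [mfderiv_eq_fderiv]
    have : HasDerivAt σ (z' - z) t := by
      have := ((hasDerivAt_id t).smul_const (z' - z)).const_add z
      rwa [one_smul] at this
    exact this.deriv
  have h4 : (mfderiv 𝓘(ℝ, ℝ) 𝓘(ℝ, Cn n) (e.symm ∘ σ) t (1 : ℝ) : Cn n) =
      chartSymmDeriv x₀ (σ t) (z' - z) := by
    rw [h2, ← h3]; rfl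
  have h5 := hN (σ t) (hσ t ht) (z' - z)
  rw [← h4] at h5
  exact h5

theorem dReal_apply_chart {f : X → ℝ} {x₀ : X} {z : Cn n} (hz : z ∈ (chartAt (Cn n) x₀).target)
    (hf : MDifferentiableAt 𝓘(ℝ, Cn n) 𝓘(ℝ, ℝ) f ((chartAt (Cn n) x₀).symm z)) (v : Cn n) :
    fderiv ℝ (fun w => f ((chartAt (Cn n) x₀).symm w)) z v =
      dReal f ((chartAt (Cn n) x₀).symm z) (chartSymmDeriv x₀ z v) :=
  fderiv_comp_chart_symm hz hf v

/-- The differential of a smooth function is bounded on compact sets. -/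
theorem exists_dReal_le_of_isCompact (hY : IsOpen Y) (hom : IsPositiveForm Y om) {f : X → ℝ}
    (hf : ContMDiff 𝓘(ℝ, Cn n) 𝓘(ℝ, ℝ) ∞ f) {K : Set X} (hK : IsCompact K) (hKY : K ⊆ Y) :
    ∃ C : ℝ, 0 ≤ C ∧ ∀ x ∈ K, ∀ v, |dReal f x v| ≤ C * √(metricOf om x v v) := by
  refine hK.induction_on (p := fun K => ∃ C : ℝ, 0 ≤ C ∧ ∀ x ∈ K, ∀ v,
    |dReal f x v| ≤ C * √(metricOf om x v v)) ⟨0, le_rfl, by simp⟩ ?_ ?_ ?_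
  · rintro s t hst ⟨C, hC, h⟩
    exact ⟨C, hC, fun x hx => h x (hst hx)⟩
  · rintro s t ⟨C, hC, h⟩ ⟨C', hC', h'⟩
    refine ⟨max C C', le_max_of_le_left hC, ?_⟩
    rintro x (hx | hx) v
    · exact (h x hx v).trans (mul_le_mul_of_nonneg_right (le_max_left _ _) (Real.sqrt_nonneg _))
    · exact (h' x hx v).trans (mul_le_mul_of_nonneg_right (le_max_right _ _) (Real.sqrt_nonneg _))
  · intro x₀ hx₀
    obtain ⟨r, m, M, N, hr, hm, hM, -, hmN, hNM, hsub, hN⟩ := exists_local_gauge hY hom (hKY hx₀)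
    set e := chartAt (Cn n) x₀ with he
    have hfe : ContDiffOn ℝ ∞ (fun w => f (e.symm w)) e.target := by
      rw [← contMDiffOn_iff_contDiffOn]
      exact hf.comp_contMDiffOn contMDiffOn_chart_symm
    have hfc : ContinuousOn (fderiv ℝ (fun w => f (e.symm w))) e.target :=
      hfe.continuousOn_fderiv_of_isOpen e.open_target (by simp)
    obtain ⟨C, hC⟩ := (isCompact_closedBall (e x₀) r).exists_bound_of_continuousOn
      (hfc.mono fun z hz => (hsub hz).1)
    have hC0 : 0 ≤ C := (norm_nonneg _).trans (hC (e x₀) (Metric.mem_closedBall_self hr.le))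
    refine ⟨e.source ∩ e ⁻¹' Metric.ball (e x₀) r, mem_nhdsWithin_of_mem_nhds
      ((e.isOpen_inter_preimage Metric.isOpen_ball).mem_nhds ⟨mem_chart_source _ _,
        Metric.mem_ball_self hr⟩), C * (2 / m), by positivity, ?_⟩
    rintro x ⟨hxs, hxb⟩ v
    have hxr := Metric.ball_subset_closedBall hxb
    obtain ⟨w, rfl⟩ := chartSymmDeriv_surjective (hsub hxr).1 v
    have h1 := dReal_apply_chart (hsub hxr).1 ((hf.mdifferentiable (by simp)) _) w
    have h2 := (hN (e x) hxr w).1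
    rw [e.left_inv hxs] at h1 h2
    rw [← h1, ← Real.norm_eq_abs]
    refine (ContinuousLinearMap.le_of_opNorm_le _ (hC _ hxr) w).trans ?_
    rw [mul_assoc]
    refine mul_le_mul_of_nonneg_left ?_ hC0
    rw [div_mul_eq_mul_div, le_div_iff₀ hm, mul_comm]
    exact (hmN w).trans h2

theorem dReal_eq_zero_of_notMem_tsupport {f : X → ℝ} {x : X} (hx : x ∉ tsupport f) :
    dReal (n := n) f x = 0 := by
  have h1 : f =ᶠ[𝓝 x] fun _ => 0 := notMem_tsupport_iff_eventuallyEq.1 hx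
  rw [dReal, h1.mfderiv_eq]
  exact mfderiv_const

theorem exists_dReal_le_of_hasCompactSupport (hY : IsOpen Y) (hom : IsPositiveForm Y om) {f : X → ℝ}
    (hf : ContMDiff 𝓘(ℝ, Cn n) 𝓘(ℝ, ℝ) ∞ f) (hc : HasCompactSupport f) (hfY : tsupport f ⊆ Y) :
    ∃ C : ℝ, 0 ≤ C ∧ ∀ x, ∀ v, |dReal f x v| ≤ C * √(metricOf om x v v) := by
  obtain ⟨C, hC, h⟩ := exists_dReal_le_of_isCompact hY hom hf hc hfY
  refine ⟨C, hC, fun x v => ?_⟩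
  by_cases hx : x ∈ tsupport f
  · exact h x hx v
  · rw [dReal_eq_zero_of_notMem_tsupport hx]
    simp only [zero_apply, abs_zero]
    positivity

end Gauge

/-! ### Cut-off functions on complete manifolds -/

section Geodesic

variable {n : ℕ} {X : Type*} [TopologicalSpace X] [ChartedSpace (Cn n) X]
  [IsManifold 𝓘(ℂ, Cn n) ω X] {Y : Set X} {om : X → Cn n [⋀^Fin 2]→L[ℝ] ℝ}

/-- Small geodesic balls are contained in given neighbourhoods. -/
theorem exists_geodesicDist_lt_imp_mem [T2Space X] (hY : IsOpen Y) (hom : IsPositiveForm Y om)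
    {x₀ : X} (hx₀ : x₀ ∈ Y) {U : Set X} (hU : U ∈ 𝓝 x₀) :
    ∃ ρ : ℝ, 0 < ρ ∧ ∀ y, geodesicDist Y om x₀ y < ENNReal.ofReal ρ → y ∈ U := by
  obtain ⟨f, -, hf⟩ := (SmoothBumpFunction.nhds_basis_tsupport (I := 𝓘(ℝ, Cn n)) x₀).mem_iff.1
    (Filter.inter_mem hU (hY.mem_nhds hx₀))
  obtain ⟨C, hC, h⟩ := exists_dReal_le_of_hasCompactSupport hY hom f.contMDiff f.hasCompactSupport
    (hf.trans inter_subset_right)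
  refine ⟨1 / (C + 1), by positivity, fun y hy => ?_⟩
  have h1 := edist_le_mul_geodesicDist (Y := Y) hC f.contMDiff (fun x _ v => h x v) x₀ y hy.ne_top
  by_contra hyU
  have hfy : f y = 0 := by
    by_contra h0
    exact hyU (hf (subset_tsupport _ h0)).1
  rw [f.eq_one, hfy, edist_dist, Real.dist_eq, sub_zero, abs_one] at h1
  have h2 : ENNReal.ofReal C * geodesicDist Y om x₀ y < ENNReal.ofReal 1 := by
    refine (mul_le_mul_right hy.le _).trans_lt ?_
    rw [← ENNReal.ofReal_mul hC, ENNReal.ofReal_lt_ofReal_iff one_pos, mul_one_div,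
      div_lt_one (by positivity)]
    linarith
  exact absurd h1 (not_le.2 h2)

/-- The geodesic distance is continuous for the topology of the manifold. -/
theorem eventually_geodesicDist_lt (hY : IsOpen Y) (hom : IsPositiveForm Y om)
    {x₀ : X} (hx₀ : x₀ ∈ Y) {ε : ℝ} (hε : 0 < ε) :
    ∀ᶠ y in 𝓝 x₀, geodesicDist Y om x₀ y < ENNReal.ofReal ε := by
  obtain ⟨r, m, M, N, hr, hm, hM, -, hmN, hNM, hsub, hN⟩ := exists_local_gauge hY hom hx₀
  set e := chartAt (Cn n) x₀
  have h1 : ∀ᶠ y in 𝓝 x₀, e y ∈ Metric.ball (e x₀) (min r (ε / (2 * M))) :=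
    (e.continuousAt (mem_chart_source _ _)).eventually_mem
      (Metric.ball_mem_nhds _ (lt_min hr (by positivity)))
  filter_upwards [h1, e.open_source.mem_nhds (mem_chart_source _ _)] with y hy hys
  rw [Metric.mem_ball] at hy
  have h2 := geodesicDist_chart_le hsub (fun z hz w => (hN z hz w).2)
    (Metric.mem_closedBall_self hr.le)
    (show e y ∈ _ from Metric.mem_closedBall.2 (hy.le.trans (min_le_left _ _)))
  rw [e.left_inv hys, e.left_inv (mem_chart_source _ _)] at h2
  refine h2.trans_lt ((ENNReal.ofReal_lt_ofReal_iff hε).2 ?_)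
  have h3 := hNM (e y - e x₀)
  rw [← dist_eq_norm] at h3
  have h4 := (lt_div_iff₀ (by positivity)).1 (hy.trans_le (min_le_right _ _))
  linarith

/-- The set `Y`, endowed with the geodesic distance of a positive form. -/
def GeoSpace (Y : Set X) (_ : X → Cn n [⋀^Fin 2]→L[ℝ] ℝ) : Type _ := Y

instance : PseudoEMetricSpace (GeoSpace Y om) where
  edist x y := geodesicDist Y om x.1 y.1
  edist_self x := geodesicDist_self x.2
  edist_comm x y := geodesicDist_comm x.1 y.1
  edist_triangle x y z := geodesicDist_triangle x.1 y.1 z.1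

/-- The inclusion of `Y`, endowed with the geodesic distance, into `X`. -/
def GeoSpace.val (x : GeoSpace Y om) : X := Subtype.val x

/-- A point of `Y`, as a point of the metric space `GeoSpace Y om`. -/
def GeoSpace.mk (x : X) (hx : x ∈ Y) : GeoSpace Y om := ⟨x, hx⟩

theorem GeoSpace.val_mem (x : GeoSpace Y om) : x.val ∈ Y := Subtype.property x

theorem GeoSpace.continuous_val [T2Space X] (hY : IsOpen Y) (hom : IsPositiveForm Y om) :
    Continuous (GeoSpace.val (Y := Y) (om := om)) := by
  refine continuous_iff_continuousAt.2 fun x U hU => ?_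
  obtain ⟨ρ, hρ, h⟩ := exists_geodesicDist_lt_imp_mem hY hom x.val_mem hU
  refine Filter.mem_map.2 (Filter.mem_of_superset
    (Metric.eball_mem_nhds x (ENNReal.ofReal_pos.2 hρ)) fun y hy => h _ ?_)
  rw [Metric.mem_eball, edist_comm] at hy
  exact hy

/-- Local compactness for the geodesic distance: a small ball is contained in the image of a compact
ball of a chart. -/
theorem GeoSpace.exists_isCompact_closedBall [T2Space X] (hY : IsOpen Y)
    (hom : IsPositiveForm Y om) (x : GeoSpace Y om) :
    ∃ ε : ℝ, 0 < ε ∧ IsCompact (Metric.closedEBall x (ENNReal.ofReal ε)) := by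
  obtain ⟨r, m, M, N, hr, hm, hM, -, hmN, hNM, hsub, hN⟩ := exists_local_gauge hY hom x.val_mem
  set e := chartAt (Cn n) x.val with he
  let φ : Metric.closedBall (e x.val) r → GeoSpace Y om := fun z => .mk (e.symm z.1) (hsub z.2).2
  have hφ : Continuous φ := by
    refine continuous_iff_continuousAt.2 fun z => ?_
    rw [ContinuousAt, tendsto_iff_edist_tendsto_0]
    have h1 : ∀ z', edist (φ z') (φ z) ≤ ENNReal.ofReal (2 * (M * ‖z.1 - z'.1‖)) := fun z' =>
      (geodesicDist_chart_le hsub (fun z hz w => (hN z hz w).2) z'.2 z.2).trans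
        (ENNReal.ofReal_le_ofReal (mul_le_mul_of_nonneg_left (hNM _) zero_le_two))
    refine tendsto_of_tendsto_of_tendsto_of_le_of_le tendsto_const_nhds ?_ (fun _ => zero_le)
      h1
    have h2 : Continuous fun z' : Metric.closedBall (e x.val) r =>
        ENNReal.ofReal (2 * (M * ‖z.1 - z'.1‖)) := by
      refine ENNReal.continuous_ofReal.comp ?_
      fun_prop
    simpa using h2.tendsto z
  have hc : IsCompact (range φ) := by
    have : CompactSpace (Metric.closedBall (e x.val) r) :=
      isCompact_iff_compactSpace.1 (isCompact_closedBall _ _)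
    exact isCompact_range hφ
  obtain ⟨ρ, hρ, h⟩ := exists_geodesicDist_lt_imp_mem hY hom x.val_mem
    (U := e.source ∩ e ⁻¹' Metric.ball (e x.val) r)
    ((e.isOpen_inter_preimage Metric.isOpen_ball).mem_nhds ⟨mem_chart_source _ _,
        Metric.mem_ball_self hr⟩)
  refine ⟨ρ / 2, half_pos hρ, hc.of_isClosed_subset Metric.isClosed_closedEBall fun y hy => ?_⟩
  rw [Metric.mem_closedEBall, edist_comm] at hy
  obtain ⟨h1, h2⟩ := h y.val (lt_of_le_of_lt hy
    ((ENNReal.ofReal_lt_ofReal_iff hρ).2 (half_lt_self hρ)))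
  exact ⟨⟨e y.val, Metric.ball_subset_closedBall h2⟩, Subtype.ext (e.left_inv h1)⟩

theorem GeoSpace.completeSpace (hc : IsCompleteForm Y om) : CompleteSpace (GeoSpace Y om) := by
  refine EMetric.complete_of_cauchySeq_tendsto fun s hs => ?_
  obtain ⟨y, hyY, hy⟩ := hc (fun i => (s i).val) (fun i => (s i).val_mem) fun ε hε => by
    obtain ⟨N, hN⟩ := EMetric.cauchySeq_iff.1 hs ε hε
    exact ⟨N, fun i hi j hj => hN i hi j hj⟩
  exact ⟨.mk y hyY, tendsto_iff_edist_tendsto_0.2 hy⟩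

/-- Geodesic balls of a complete form are relatively compact. -/
theorem isCompact_geodesicBall [T2Space X] (hY : IsOpen Y) (hom : IsPositiveForm Y om)
    (hc : IsCompleteForm Y om) {p : X} (hp : p ∈ Y) (R : ℝ) :
    IsCompact {y ∈ Y | geodesicDist Y om p y ≤ ENNReal.ofReal R} := by
  have := GeoSpace.completeSpace hc
  have h1 := isCompact_closedEBall_of_length (M := GeoSpace Y om)
    (GeoSpace.exists_isCompact_closedBall hY hom)
    (fun x y r s hr hs h => by
      obtain ⟨z, hz, h1, h2⟩ := exists_between_of_geodesicDist_lt hr hs h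
      exact ⟨.mk z hz, h1, h2⟩) (.mk p hp) R
  convert h1.image (GeoSpace.continuous_val hY hom) using 1
  ext y
  constructor
  · rintro ⟨hy, h⟩
    refine ⟨.mk y hy, ?_, rfl⟩
    rw [Metric.mem_closedEBall, edist_comm]
    exact h
  · rintro ⟨y, hy, rfl⟩
    rw [Metric.mem_closedEBall, edist_comm] at hy
    exact ⟨y.val_mem, hy⟩

theorem dReal_add {f g : X → ℝ} (hf : ContMDiff 𝓘(ℝ, Cn n) 𝓘(ℝ, ℝ) ∞ f)
    (hg : ContMDiff 𝓘(ℝ, Cn n) 𝓘(ℝ, ℝ) ∞ g) (x : X) :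
    dReal (n := n) (fun y => f y + g y) x = dReal f x + dReal g x :=
  mfderiv_add (hf.mdifferentiable (by simp) x) (hg.mdifferentiable (by simp) x)

theorem dReal_sum {ι : Type*} (s : Finset ι) {f : ι → X → ℝ}
    (hf : ∀ i, ContMDiff 𝓘(ℝ, Cn n) 𝓘(ℝ, ℝ) ∞ (f i)) (x : X) :
    dReal (n := n) (fun y => ∑ i ∈ s, f i y) x = ∑ i ∈ s, dReal (f i) x := by
  classical
  induction s using Finset.induction_on with
  | empty =>
    simp only [Finset.sum_empty]
    exact mfderiv_const
  | insert i s hi ih =>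
    simp only [Finset.sum_insert hi]
    rw [dReal_add (hf i) (contMDiff_finsetSum fun j _ => hf j), ih]

theorem dReal_mul {f g : X → ℝ} {x : X} (hf : MDifferentiableAt 𝓘(ℝ, Cn n) 𝓘(ℝ, ℝ) f x)
    (hg : MDifferentiableAt 𝓘(ℝ, Cn n) 𝓘(ℝ, ℝ) g x) (v : Cn n) :
    dReal (fun y => f y * g y) x v = f x * dReal g x v + g x * dReal f x v := by
  have h1 := hf.hasMFDerivAt.mul' hg.hasMFDerivAt
  have h2 : mfderiv 𝓘(ℝ, Cn n) 𝓘(ℝ, ℝ) (fun y => f y * g y) x = _ := h1.mfderiv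
  change mfderiv 𝓘(ℝ, Cn n) 𝓘(ℝ, ℝ) (fun y => f y * g y) x v = _
  rw [h2]
  change f x * dReal g x v + dReal f x v * g x = _
  ring

/-- A function which is Lipschitz for the geodesic distance and vanishes outside a compact set can
be approximated by smooth functions, with control of the differential. -/
theorem exists_smooth_approx_of_lipschitz [T2Space X] [SecondCountableTopology X] (hY : IsOpen Y)
    (hom : IsPositiveForm Y om) {S O : Set X} (hS : IsCompact S) (hSY : S ⊆ Y) (hO : IsOpen O)
    (hOS : O ⊆ S) {f : X → ℝ} (hfO : ∀ x ∈ Y, x ∉ O → f x = 0) {L : ℝ} (hL : 0 ≤ L)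
    (hfL : ∀ x ∈ Y, ∀ y ∈ Y, ∀ s : ℝ, 0 ≤ s → geodesicDist Y om x y ≤ ENNReal.ofReal s →
      |f x - f y| ≤ L * s) {δ : ℝ} (hδ : 0 < δ) :
    ∃ χ : X → ℝ, ContMDiff 𝓘(ℝ, Cn n) 𝓘(ℝ, ℝ) ∞ χ ∧
      (∃ K ⊆ Y, IsCompact K ∧ ∀ x ∉ K, χ x = 0) ∧ (∀ x ∈ Y, |χ x - f x| ≤ δ) ∧
      ∀ x ∈ Y, ∀ v, |dReal χ x v| ≤ (4 * L + δ) * √(metricOf om x v v) := by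
  have : LocallyCompactSpace X := ChartedSpace.locallyCompactSpace (Cn n) X
  -- near every point, `f` is Lipschitz for the local gauge, hence can be mollified in the chart
  have hloc : ∀ x₀ ∈ Y, ∃ r : ℝ, 0 < r ∧
      Metric.closedBall (chartAt (Cn n) x₀ x₀) r ⊆
        {z ∈ (chartAt (Cn n) x₀).target | (chartAt (Cn n) x₀).symm z ∈ Y} ∧
      ∀ δ : ℝ, 0 < δ → ∃ F : Cn n → ℝ, ContDiff ℝ ∞ F ∧
        (∀ z ∈ Metric.ball (chartAt (Cn n) x₀ x₀) (r / 2),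
          |F z - f ((chartAt (Cn n) x₀).symm z)| ≤ δ) ∧
        ∀ z ∈ Metric.ball (chartAt (Cn n) x₀ x₀) (r / 2), ∀ w, |fderiv ℝ F z w| ≤ 4 * L *
          √(metricOf om ((chartAt (Cn n) x₀).symm z) (chartSymmDeriv x₀ z w)
            (chartSymmDeriv x₀ z w)) := by
    intro x₀ hx₀
    obtain ⟨r, m, M, N, hr, hm, hM, hNs, hmN, hNM, hsub, hN⟩ := exists_local_gauge hY hom hx₀
    have hN0 : ∀ w, 0 ≤ N w := fun w => (by positivity : 0 ≤ m * ‖w‖).trans (hmN w)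
    refine ⟨r, hr, hsub, fun δ hδ => ?_⟩
    have hlip : ∀ a ∈ Metric.closedBall (chartAt (Cn n) x₀ x₀) r,
        ∀ b ∈ Metric.closedBall (chartAt (Cn n) x₀ x₀) r,
        |f ((chartAt (Cn n) x₀).symm a) - f ((chartAt (Cn n) x₀).symm b)| ≤
          2 * L * N (a - b) := by
      intro a ha b hb
      have h1 := geodesicDist_chart_le hsub (fun z hz w => (hN z hz w).2) hb ha
      have h2 := hfL _ (hsub ha).2 _ (hsub hb).2 (2 * N (a - b)) (by linarith [hN0 (a - b)])
        (by rwa [geodesicDist_comm])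
      linarith
    have hcont : ContinuousOn (fun z => f ((chartAt (Cn n) x₀).symm z))
        (Metric.closedBall (chartAt (Cn n) x₀ x₀) r) := by
      have h1 : LipschitzOnWith (Real.toNNReal (2 * L * M))
          (fun z => f ((chartAt (Cn n) x₀).symm z))
          (Metric.closedBall (chartAt (Cn n) x₀ x₀) r) := by
        refine LipschitzOnWith.of_dist_le_mul fun a ha b hb => ?_
        rw [Real.dist_eq, Real.coe_toNNReal _ (by positivity), dist_eq_norm, mul_assoc]
        exact (hlip a ha b hb).trans (mul_le_mul_of_nonneg_left (hNM _) (by positivity))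
      exact h1.continuousOn
    obtain ⟨F, hF1, hF2, hF3⟩ := exists_smooth_approx hr hδ hcont
    refine ⟨F, hF1, hF2, fun z hz w => ?_⟩
    refine (hF3 (fun w => 2 * L * N w) (fun t ht w => by rw [hNs t ht]; ring) hlip z hz w).trans ?_
    have h1 := (hN z (Metric.ball_subset_closedBall
      (Metric.ball_subset_ball (half_le_self hr.le) hz)) w).1
    nlinarith
  choose! r hr hsub hF using hloc
  let U : X → Set X := fun x => (chartAt (Cn n) x).source ∩
    chartAt (Cn n) x ⁻¹' Metric.ball (chartAt (Cn n) x x) (r x / 2)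
  have hUo : ∀ x, IsOpen (U x) := fun x =>
    (chartAt (Cn n) x).isOpen_inter_preimage Metric.isOpen_ball
  have hUx : ∀ x ∈ Y, x ∈ U x := fun x hx =>
    ⟨mem_chart_source _ _, Metric.mem_ball_self (half_pos (hr x hx))⟩
  obtain ⟨t, htS, ht⟩ := hS.elim_nhds_subcover U fun x hx => (hUo x).mem_nhds (hUx x (hSY hx))
  have htY : ∀ i : t, i.1 ∈ Y := fun i => hSY (htS i.1 i.2)
  obtain ⟨θ, hθ⟩ := SmoothPartitionOfUnity.exists_isSubordinate 𝓘(ℝ, Cn n) hS.isClosed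
    (fun i : t => U i.1) (fun i => hUo i.1) (fun x hx => by
      simpa using ht hx)
  have hball : ∀ i : t, ∀ x ∈ U i.1, chartAt (Cn n) i.1 x ∈
      Metric.closedBall (chartAt (Cn n) i.1 i.1) (r i.1) := fun i x hx =>
    Metric.ball_subset_closedBall
      (Metric.ball_subset_ball (half_le_self (hr _ (htY i)).le) hx.2)
  let Kf : t → Set X := fun i => (chartAt (Cn n) i.1).symm ''
    Metric.closedBall (chartAt (Cn n) i.1 i.1) (r i.1)
  have hKc : ∀ i, IsCompact (Kf i) := fun i => (isCompact_closedBall _ _).image_of_continuousOn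
    ((chartAt (Cn n) i.1).continuousOn_symm.mono fun z hz => (hsub _ (htY i) hz).1)
  have hKY : ∀ i, Kf i ⊆ Y := by
    rintro i _ ⟨z, hz, rfl⟩
    exact (hsub _ (htY i) hz).2
  have hUK : ∀ i : t, U i.1 ⊆ Kf i := fun i x hx =>
    ⟨_, hball i x hx, (chartAt (Cn n) i.1).left_inv hx.1⟩
  have hθC : ∀ i, ∃ C : ℝ, 0 ≤ C ∧ ∀ x, ∀ v, |dReal (θ i) x v| ≤ C * √(metricOf om x v v) :=
    fun i => exists_dReal_le_of_hasCompactSupport hY hom (θ i).contMDiff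
      ((hKc i).of_isClosed_subset (isClosed_tsupport _) ((hθ i).trans (hUK i)))
      ((hθ i).trans ((hUK i).trans (hKY i)))
  choose C hC0 hC using hθC
  -- the precision of the mollification compensates the differentials of the partition of unity
  set δ' := δ / (1 + ∑ i, C i) with hδ'
  have hCsum : 0 ≤ ∑ i, C i := Finset.sum_nonneg fun i _ => hC0 i
  have hδ'0 : 0 < δ' := by positivity
  have hδ'1 : δ' ≤ δ := div_le_self hδ.le (by linarith)
  have hδ'2 : δ' * ∑ i, C i ≤ δ := by
    rw [hδ', div_mul_eq_mul_div, div_le_iff₀ (by positivity)]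
    nlinarith
  choose F hF1 hF2 hF3 using fun i : t => hF i.1 (htY i) δ' hδ'0
  let g : t → X → ℝ := fun i x => F i (chartAt (Cn n) i.1 x)
  have hgs : ∀ i, ∀ x ∈ U i.1, ContMDiffAt 𝓘(ℝ, Cn n) 𝓘(ℝ, ℝ) ∞ (g i) x := fun i x hx =>
    (hF1 i).contMDiff.contMDiffAt.comp x ((contMDiffOn_chart (I := 𝓘(ℝ, Cn n)) (n := ∞)).contMDiffAt
      ((chartAt (Cn n) i.1).open_source.mem_nhds hx.1))
  have hθg : ∀ i, ContMDiff 𝓘(ℝ, Cn n) 𝓘(ℝ, ℝ) ∞ fun x => θ i x * g i x := fun i =>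
    θ.contMDiff_smul fun x hx => hgs i x (hθ i hx)
  have hgf : ∀ i, ∀ x ∈ U i.1, |g i x - f x| ≤ δ' := fun i x hx => by
    have := hF2 i _ hx.2
    rwa [(chartAt (Cn n) i.1).left_inv hx.1] at this
  have hgd : ∀ i, ∀ x ∈ U i.1, ∀ v, |dReal (g i) x v| ≤ 4 * L * √(metricOf om x v v) := by
    intro i x hx v
    have hz := hsub _ (htY i) (hball i x hx)
    obtain ⟨w, rfl⟩ := chartSymmDeriv_surjective hz.1 v
    have h1 := hF3 i _ hx.2 w
    have h2 := dReal_apply_chart (f := g i) hz.1 (by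
      rw [(chartAt (Cn n) i.1).left_inv hx.1]
      exact (hgs i x hx).mdifferentiableAt (by simp)) w
    rw [(chartAt (Cn n) i.1).left_inv hx.1] at h1 h2
    rw [← h2]
    convert h1 using 3
    refine Filter.EventuallyEq.fderiv_eq ?_
    filter_upwards [(chartAt (Cn n) i.1).open_target.mem_nhds hz.1] with z' hz'
    simp only [g, (chartAt (Cn n) i.1).right_inv hz']
  have hθ0 : ∀ i x, x ∉ U i.1 → θ i x = 0 := fun i x hx => by
    by_contra h0
    exact hx (hθ i (subset_tsupport _ h0))
  have hsum1 : ∀ x ∈ S, ∑ i, θ i x = 1 := fun x hx => by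
    rw [← finsum_eq_sum_of_fintype]; exact θ.sum_eq_one hx
  have hsumle : ∀ x, ∑ i, θ i x ≤ 1 := fun x => by
    rw [← finsum_eq_sum_of_fintype]; exact θ.sum_le_one x
  have hfsum : ∀ x ∈ Y, f x = ∑ i, θ i x * f x := fun x hx => by
    rw [← Finset.sum_mul]
    by_cases hxO : x ∈ O
    · rw [hsum1 x (hOS hxO), one_mul]
    · rw [hfO x hx hxO, mul_zero]
  refine ⟨fun x => ∑ i, θ i x * g i x, contMDiff_finsetSum fun i _ => hθg i,
    ⟨⋃ i, Kf i, iUnion_subset hKY, isCompact_iUnion hKc, fun x hx => ?_⟩, fun x hx => ?_,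
    fun x hx v => ?_⟩
  · refine Finset.sum_eq_zero fun i _ => ?_
    rw [hθ0 i x fun h => hx (mem_iUnion.2 ⟨i, hUK i h⟩), zero_mul]
  · calc |∑ i, θ i x * g i x - f x| = |∑ i, θ i x * (g i x - f x)| := by
          conv_lhs => rw [hfsum x hx, ← Finset.sum_sub_distrib]
          simp only [mul_sub]
      _ ≤ ∑ i, |θ i x * (g i x - f x)| := Finset.abs_sum_le_sum_abs _ _
      _ ≤ ∑ i, θ i x * δ := Finset.sum_le_sum fun i _ => by
          rw [abs_mul, abs_of_nonneg (θ.nonneg i x)]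
          by_cases hxU : x ∈ U i.1
          · exact mul_le_mul_of_nonneg_left ((hgf i x hxU).trans hδ'1) (θ.nonneg i x)
          · simp [hθ0 i x hxU]
      _ ≤ δ := by
          rw [← Finset.sum_mul]
          nlinarith [hsumle x]
  · have hd : ∀ i, dReal (fun y => θ i y * g i y) x v =
        θ i x * dReal (g i) x v + g i x * dReal (θ i) x v := by
      intro i
      by_cases hxU : x ∈ tsupport (θ i)
      · exact dReal_mul ((θ i).contMDiff.mdifferentiable (by simp) x)
          ((hgs i x (hθ i hxU)).mdifferentiableAt (by simp)) v
      · have h1 : x ∉ tsupport fun y => θ i y * g i y := fun h =>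
          hxU (closure_mono (fun y hy => Function.mem_support.2 fun h0 =>
            Function.mem_support.1 hy (by rw [h0, zero_mul])) h)
        rw [dReal_eq_zero_of_notMem_tsupport h1, dReal_eq_zero_of_notMem_tsupport hxU,
          image_eq_zero_of_notMem_tsupport hxU]
        simp
    -- the differential of the sum of the partition of unity vanishes where `f` does not
    have hf0 : ∑ i, f x * dReal (θ i) x v = 0 := by
      rw [← Finset.mul_sum]
      by_cases hxO : x ∈ O
      · have h1 : dReal (n := n) (fun y => ∑ i, θ i y) x = 0 := by
          have h2 : (fun y => ∑ i, θ i y) =ᶠ[𝓝 x] fun _ => 1 := by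
            filter_upwards [hO.mem_nhds hxO] with y hy using hsum1 y (hOS hy)
          rw [dReal, h2.mfderiv_eq]
          exact mfderiv_const
        rw [dReal_sum Finset.univ (f := fun i => θ i) (fun i => (θ i).contMDiff)] at h1
        have h2 := congrArg (fun A => A v) h1
        simp only [sum_apply, zero_apply] at h2
        rw [h2, mul_zero]
      · rw [hfO x hx hxO, zero_mul]
    rw [dReal_sum Finset.univ hθg, sum_apply]
    simp only [hd]
    set q := √(metricOf om x v v)
    have hq : 0 ≤ q := Real.sqrt_nonneg _
    calc |∑ i, (θ i x * dReal (g i) x v + g i x * dReal (θ i) x v)|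
        = |∑ i, (θ i x * dReal (g i) x v + (g i x - f x) * dReal (θ i) x v)| := by
          rw [← sub_zero (∑ i, (θ i x * dReal (g i) x v + g i x * dReal (θ i) x v)), ← hf0,
            ← Finset.sum_sub_distrib]
          congr 1
          exact Finset.sum_congr rfl fun i _ => by ring
      _ ≤ ∑ i, |θ i x * dReal (g i) x v + (g i x - f x) * dReal (θ i) x v| :=
          Finset.abs_sum_le_sum_abs _ _
      _ ≤ ∑ i, (θ i x * (4 * L * q) + δ' * (C i * q)) := Finset.sum_le_sum fun i _ => by
          refine (abs_add_le _ _).trans (add_le_add ?_ ?_)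
          · rw [abs_mul, abs_of_nonneg (θ.nonneg i x)]
            by_cases hxU : x ∈ U i.1
            · exact mul_le_mul_of_nonneg_left (hgd i x hxU v) (θ.nonneg i x)
            · simp [hθ0 i x hxU]
          · rw [abs_mul]
            by_cases hxU : x ∈ U i.1
            · exact mul_le_mul (hgf i x hxU) (hC i x v) (abs_nonneg _) hδ'0.le
            · rw [dReal_eq_zero_of_notMem_tsupport fun h => hxU (hθ i h)]
              simp only [zero_apply, abs_zero, mul_zero]
              have := hC0 i
              positivity
      _ = (∑ i, θ i x) * (4 * L * q) + (δ' * ∑ i, C i) * q := by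
          rw [Finset.sum_add_distrib, Finset.sum_mul, Finset.mul_sum, Finset.sum_mul]
          congr 1
          exact Finset.sum_congr rfl fun i _ => by ring
      _ ≤ 1 * (4 * L * q) + δ * q := by
          gcongr
          exact hsumle x
      _ = (4 * L + δ) * q := by ring

/-- On a complete manifold there are cut-off functions with arbitrarily small differential. -/
theorem exists_cutoff [T2Space X] [SecondCountableTopology X] (hY : IsOpen Y)
    (hom : IsPositiveForm Y om) (hc : IsCompleteForm Y om) {K : Set X} (hK : IsCompact K)
    (hKY : K ⊆ Y) {ε : ℝ} (hε : 0 < ε) (hε1 : ε ≤ 1) :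
    ∃ χ : X → ℝ, ContMDiff 𝓘(ℝ, Cn n) 𝓘(ℝ, ℝ) ∞ χ ∧
      (∃ K' ⊆ Y, IsCompact K' ∧ ∀ x ∉ K', χ x = 0) ∧ (∀ x ∈ Y, |χ x| ≤ 2) ∧
      (∀ x ∈ K, |χ x - 1| ≤ ε) ∧
      ∀ x ∈ Y, ∀ v, |dReal χ x v| ≤ ε * √(metricOf om x v v) := by
  obtain ⟨T, hTK, hT⟩ := hK.elim_nhds_subcover
    (fun p => {y | geodesicDist Y om p y < ENNReal.ofReal 1}) fun x hx =>
      eventually_geodesicDist_lt hY hom (hKY hx) one_pos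
  -- the Lipschitz constant `η` gives the bound `4 * η + η ≤ ε` after smoothing, and the cut-off
  -- `min 1 (2 - η * D)` vanishes at distance `R = 2 / η`
  set η := ε / 8 with hη
  have hη0 : 0 < η := by positivity
  set R := 2 / η with hR
  have hR0 : 0 < R := by positivity
  have hηR : η * R = 2 := by rw [hR]; field_simp
  let D : X → ℝ≥0∞ := fun x => ⨅ p ∈ T, geodesicDist Y om p x
  have hD : ∀ x y, D x ≤ D y + geodesicDist Y om x y := fun x y => by
    simp only [D, ENNReal.iInf_add]
    refine le_iInf₂ fun p hp => (iInf₂_le p hp).trans ?_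
    rw [geodesicDist_comm x y]
    exact geodesicDist_triangle _ _ _
  have hDlt : ∀ x (s : ℝ≥0∞), D x < s → ∃ p ∈ T, geodesicDist Y om p x < s := fun x s h => by
    simpa only [D, iInf_lt_iff, exists_prop] using h
  -- truncation makes the distance real valued, also on other components of `Y`
  let D' : X → ℝ := fun x => (min (D x) (ENNReal.ofReal R)).toReal
  have hD'0 : ∀ x, 0 ≤ D' x := fun x => ENNReal.toReal_nonneg
  have hD'R : ∀ x, D' x ≤ R := fun x => by
    refine (ENNReal.toReal_mono ENNReal.ofReal_ne_top (min_le_right _ _)).trans ?_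
    rw [ENNReal.toReal_ofReal hR0.le]
  have hD'e : ∀ x, ENNReal.ofReal (D' x) = min (D x) (ENNReal.ofReal R) := fun x =>
    ENNReal.ofReal_toReal (ne_top_of_le_ne_top ENNReal.ofReal_ne_top (min_le_right _ _))
  have hD'L : ∀ x y (s : ℝ), 0 ≤ s → geodesicDist Y om x y ≤ ENNReal.ofReal s →
      D' x ≤ D' y + s := fun x y s hs h => by
    rw [← ENNReal.ofReal_le_ofReal_iff (add_nonneg (hD'0 y) hs), ENNReal.ofReal_add (hD'0 y) hs,
      hD'e, hD'e]
    rcases le_total (D y) (ENNReal.ofReal R) with h1 | h1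
    · rw [min_eq_left h1]
      exact (min_le_left _ _).trans ((hD x y).trans (add_le_add_right h _))
    · rw [min_eq_right h1]
      exact (min_le_right _ _).trans le_self_add
  -- the cut-off as a function of the distance to the finite set `T`
  let f : X → ℝ := fun x => min 1 (2 - η * D' x)
  have hf01 : ∀ x, 0 ≤ f x ∧ f x ≤ 1 := fun x =>
    ⟨le_min zero_le_one (by nlinarith [hD'R x]), min_le_left _ _⟩
  have hfL : ∀ x ∈ Y, ∀ y ∈ Y, ∀ s : ℝ, 0 ≤ s → geodesicDist Y om x y ≤ ENNReal.ofReal s →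
      |f x - f y| ≤ η * s := by
    intro x _ y _ s hs h
    have h1 := hD'L x y s hs h
    have h2 := hD'L y x s hs (by rwa [geodesicDist_comm])
    have h3 := abs_min_sub_min_le_max 1 (2 - η * D' x) 1 (2 - η * D' y)
    refine h3.trans (max_le (by simp; positivity) ?_)
    rw [abs_le]
    constructor <;> nlinarith
  let S : Set X := ⋃ p ∈ T, {y ∈ Y | geodesicDist Y om p y ≤ ENNReal.ofReal R}
  have hS : IsCompact S := T.isCompact_biUnion fun p hp =>
    isCompact_geodesicBall hY hom hc (hKY (hTK p hp)) R
  have hSY : S ⊆ Y := iUnion₂_subset fun p _ y hy => hy.1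
  let O : Set X := {y ∈ Y | D y < ENNReal.ofReal R}
  have hO : IsOpen O := by
    rw [isOpen_iff_mem_nhds]
    rintro x ⟨hxY, hx⟩
    obtain ⟨q, hq, hxq⟩ : ∃ q : ℝ, 0 < q ∧ D x + ENNReal.ofReal q < ENNReal.ofReal R := by
      obtain ⟨b, hb0, hb⟩ := ENNReal.lt_iff_exists_add_pos_lt.1 hx
      exact ⟨b, by exact_mod_cast hb0, by rwa [ENNReal.ofReal_coe_nnreal]⟩
    filter_upwards [hY.mem_nhds hxY, eventually_geodesicDist_lt hY hom hxY hq] with y hyY hy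
    refine ⟨hyY, lt_of_le_of_lt (hD y x) (lt_of_le_of_lt ?_ hxq)⟩
    rw [geodesicDist_comm]
    exact add_le_add_right hy.le _
  have hOS : O ⊆ S := fun x hx => by
    obtain ⟨p, hp, h⟩ := hDlt x _ hx.2
    exact mem_biUnion hp ⟨hx.1, h.le⟩
  have hfO : ∀ x ∈ Y, x ∉ O → f x = 0 := fun x hx hxO => by
    have h1 : ENNReal.ofReal R ≤ D x := not_lt.1 fun h => hxO ⟨hx, h⟩
    have h2 : D' x = R := by
      simp only [D', min_eq_right h1, ENNReal.toReal_ofReal hR0.le]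
    simp only [f, h2, hηR]
    norm_num
  obtain ⟨χ, h1, h2, h3, h4⟩ := exists_smooth_approx_of_lipschitz hY hom hS hSY hO hOS hfO hη0.le
    hfL hη0
  refine ⟨χ, h1, h2, fun x hx => ?_, fun x hx => ?_, fun x hx v => (h4 x hx v).trans ?_⟩
  · have := abs_le.1 (h3 x hx)
    rw [abs_le]
    constructor <;> linarith [(hf01 x).1, (hf01 x).2]
  · have hfx : f x = 1 := by
      have hx1 : D x ≤ ENNReal.ofReal 1 := by
        have h := hT hx
        simp only [mem_iUnion, exists_prop] at h
        obtain ⟨p, hp, hpx⟩ := h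
        exact (iInf₂_le p hp).trans (le_of_lt hpx)
      have : D' x ≤ 1 := by
        rw [← ENNReal.ofReal_le_ofReal_iff zero_le_one, hD'e]
        exact (min_le_left _ _).trans hx1
      exact min_eq_left (by nlinarith)
    have := h3 x (hKY hx)
    rw [hfx] at this
    linarith
  · exact mul_le_mul_of_nonneg_right (by linarith) (Real.sqrt_nonneg _)

end Geodesic

/-! ### Measures defined by parametrizations -/

section ParamMeasure

/-- A family of measures, concentrated on sets `U i` and compatible on intersections, is glued by
its supremum. -/
theorem iSup_measure_restrict {α ι : Type*} [MeasurableSpace α] {μ : ι → Measure α} {U : ι → Set α}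
    (hU : ∀ i, MeasurableSet (U i)) (h0 : ∀ i, μ i (U i)ᶜ = 0)
    (hμ : ∀ i j, (μ i).restrict (U i ∩ U j) = (μ j).restrict (U i ∩ U j)) (j : ι) :
    (⨆ i, μ i).restrict (U j) = μ j := by
  have hj : (μ j).restrict (U j) = μ j := Measure.restrict_eq_self_of_ae_mem (by
    rw [ae_iff]; exact h0 j)
  refine le_antisymm ?_ ?_
  · have hle : (⨆ i, μ i) ≤ μ j + (⨆ i, μ i).restrict (U j)ᶜ := by
      refine iSup_le fun i => Measure.le_iff.2 fun s hs => ?_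
      rw [Measure.add_apply, Measure.restrict_apply hs, ← measure_inter_add_sdiff s (hU j)]
      refine add_le_add ?_ (le_iSup μ i _)
      have h1 : μ i (s ∩ U j) = μ i (s ∩ (U i ∩ U j)) := by
        refine le_antisymm ?_ (measure_mono fun x hx => ⟨hx.1, hx.2.2⟩)
        refine (measure_mono (t := s ∩ (U i ∩ U j) ∪ (U i)ᶜ) fun x hx => ?_).trans
          ((measure_union_le _ _).trans (by rw [h0 i, add_zero]))
        by_cases hxi : x ∈ U i
        · exact Or.inl ⟨hx.1, hxi, hx.2⟩
        · exact Or.inr hxi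
      rw [h1, ← Measure.restrict_apply hs, hμ i j]
      exact Measure.restrict_apply_le _ _
    refine (Measure.restrict_mono_measure hle _).trans ?_
    rw [Measure.restrict_add, Measure.restrict_restrict (hU j), inter_compl_self,
      Measure.restrict_empty, add_zero, hj]
  · conv_lhs => rw [← hj]
    exact Measure.restrict_mono_measure (le_iSup μ j) _

variable {X W : Type*} [TopologicalSpace X] [MeasurableSpace X] [BorelSpace X]
  [NormedAddCommGroup W] [NormedSpace ℝ W] [FiniteDimensional ℝ W] [MeasureSpace W]
  [BorelSpace W] [Measure.IsAddHaarMeasure (volume : Measure W)]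

/-- The image under `f` of the measure of density `ρ` on `D`. -/
def paramMeasure (f : W → X) (D : Set W) (ρ : W → ℝ) : Measure X :=
  Measure.map f ((volume.restrict D).withDensity fun z => ENNReal.ofReal (ρ z))

variable {f : W → X} {D : Set W} {ρ : W → ℝ}

theorem measurableSet_inter_preimage (hf : ContinuousOn f D) (hD : IsOpen D) {s : Set X}
    (hs : MeasurableSet s) : MeasurableSet (D ∩ f ⁻¹' s) := by
  have h1 : MeasurableSet ((D.domRestrict f) ⁻¹' s) := hf.domRestrict.measurable hs
  have h2 := hD.measurableSet.subtype_image h1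
  convert h2 using 1
  ext z
  constructor
  · rintro ⟨h, h'⟩; exact ⟨⟨z, h⟩, h', rfl⟩
  · rintro ⟨z, h, rfl⟩; exact ⟨z.2, h⟩

theorem aemeasurable_param (hf : ContinuousOn f D) (hD : IsOpen D) (ρ : W → ℝ) :
    AEMeasurable f ((volume.restrict D).withDensity fun z => ENNReal.ofReal (ρ z)) :=
  (hf.aemeasurable hD.measurableSet).mono_ac (withDensity_absolutelyContinuous _ _)

theorem paramMeasure_apply (hf : ContinuousOn f D) (hD : IsOpen D) {s : Set X}
    (hs : MeasurableSet s) :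
    paramMeasure f D ρ s = ∫⁻ z in D ∩ f ⁻¹' s, ENNReal.ofReal (ρ z) := by
  rw [paramMeasure, Measure.map_apply_of_aemeasurable (aemeasurable_param hf hD ρ) hs,
    withDensity_apply', ← Measure.restrict_restrict_of_subset (inter_subset_left (s := D)
      (t := f ⁻¹' s)), Measure.restrict_restrict₀' hD.measurableSet.nullMeasurableSet,
    Measure.restrict_restrict (measurableSet_inter_preimage hf hD hs), inter_comm]
  congr 2
  ext z; simp only [mem_inter_iff, mem_preimage]; tauto

theorem paramMeasure_compl (hf : ContinuousOn f D) (hD : IsOpen D) {U : Set X}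
    (hU : MeasurableSet U) (hfU : MapsTo f D U) : paramMeasure f D ρ Uᶜ = 0 := by
  rw [paramMeasure_apply hf hD hU.compl]
  have : D ∩ f ⁻¹' Uᶜ = ∅ := by
    ext z; simp only [mem_inter_iff, mem_preimage, mem_compl_iff, mem_empty_iff_false, iff_false]
    exact fun h => h.2 (hfU h.1)
  rw [this, Measure.restrict_empty, lintegral_zero_measure]

/-- Change of variables: two parametrizations whose densities are related by the Jacobian
determinant of the transition map define the same measure. -/
theorem paramMeasure_restrict_eq {f₁ f₂ : W → X} {D₁ D₂ : Set W} {ρ₁ ρ₂ : W → ℝ}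
    (hf₁ : ContinuousOn f₁ D₁) (hD₁ : IsOpen D₁) (hf₂ : ContinuousOn f₂ D₂) (hD₂ : IsOpen D₂)
    {U : Set X} (hU : MeasurableSet U) {τ : W → W} {τ' : W → W →L[ℝ] W}
    (hτ : ∀ z ∈ D₁, f₁ z ∈ U → τ z ∈ D₂ ∧ f₂ (τ z) = f₁ z ∧ HasFDerivAt τ (τ' z) z ∧
      ρ₁ z = |(τ' z).det| * ρ₂ (τ z))
    (hinj : InjOn f₁ D₁) (hinj₂ : InjOn f₂ D₂)
    (hsurj : ∀ w ∈ D₂, f₂ w ∈ U → ∃ z ∈ D₁, f₁ z = f₂ w) :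
    (paramMeasure f₁ D₁ ρ₁).restrict U = (paramMeasure f₂ D₂ ρ₂).restrict U := by
  ext s hs
  rw [Measure.restrict_apply hs, Measure.restrict_apply hs, paramMeasure_apply hf₁ hD₁ (hs.inter hU),
    paramMeasure_apply hf₂ hD₂ (hs.inter hU)]
  have himage : D₂ ∩ f₂ ⁻¹' (s ∩ U) = τ '' (D₁ ∩ f₁ ⁻¹' (s ∩ U)) := by
    ext w
    constructor
    · rintro ⟨hw, hws, hwU⟩
      obtain ⟨z, hz, hzw⟩ := hsurj w hw hwU
      obtain ⟨h1, h2, -⟩ := hτ z hz (hzw ▸ hwU)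
      refine ⟨z, ⟨hz, ?_⟩, hinj₂ h1 hw (h2.trans hzw)⟩
      rw [mem_preimage, hzw]
      exact ⟨hws, hwU⟩
    · rintro ⟨z, ⟨hz, hzs, hzU⟩, rfl⟩
      obtain ⟨h1, h2, -⟩ := hτ z hz hzU
      refine ⟨h1, ?_⟩
      rw [mem_preimage, h2]
      exact ⟨hzs, hzU⟩
  have hmeas := measurableSet_inter_preimage hf₁ hD₁ (hs.inter hU)
  rw [himage, lintegral_image_eq_lintegral_abs_det_fderiv_mul volume hmeas (f' := τ')
    (fun z hz => (hτ z hz.1 hz.2.2).2.2.1.hasFDerivWithinAt) ?_]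
  · refine setLIntegral_congr_fun hmeas fun z hz => ?_
    rw [(hτ z hz.1 hz.2.2).2.2.2, ENNReal.ofReal_mul (abs_nonneg _)]
  · intro z hz z' hz' h
    refine hinj hz.1 hz'.1 ?_
    rw [← (hτ z hz.1 hz.2.2).2.1, ← (hτ z' hz'.1 hz'.2.2).2.1, h]

/-- Integration with respect to a measure defined by a parametrization, in the parameters. -/
theorem restrict_paramMeasure_integral {g : X → ℂ} (hf : ContinuousOn f D) (hD : IsOpen D)
    (hρ : ContinuousOn ρ D) (hρ0 : ∀ z ∈ D, 0 ≤ ρ z) {B : Set X} (hB : MeasurableSet B)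
    (hg : AEStronglyMeasurable g ((paramMeasure f D ρ).restrict B)) :
    (IntegrableOn g B (paramMeasure f D ρ) ↔
      IntegrableOn (fun z => ρ z • g (f z)) (D ∩ f ⁻¹' B)) ∧
    ∫ x in B, g x ∂(paramMeasure f D ρ) = ∫ z in D ∩ f ⁻¹' B, ρ z • g (f z) := by
  have hm := measurableSet_inter_preimage hf hD hB
  have hfae := hf.aemeasurable (μ := volume) hD.measurableSet
  have h1 : (paramMeasure f D ρ).restrict B = Measure.map f
      ((volume.restrict (D ∩ f ⁻¹' B)).withDensity fun z => ENNReal.ofReal (ρ z)) := by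
    ext s hs
    rw [Measure.restrict_apply hs, paramMeasure_apply hf hD (hs.inter hB),
      Measure.map_apply_of_aemeasurable _ hs, withDensity_apply', Measure.restrict_restrict₀' hm.nullMeasurableSet]
    · congr 2
      ext z; simp only [mem_inter_iff, mem_preimage]; tauto
    · exact (hfae.mono_measure (Measure.restrict_mono inter_subset_left le_rfl)).mono_ac
        (withDensity_absolutelyContinuous _ _)
  have hae : AEMeasurable f ((volume.restrict (D ∩ f ⁻¹' B)).withDensity
      fun z => ENNReal.ofReal (ρ z)) :=
    (hfae.mono_measure (Measure.restrict_mono inter_subset_left le_rfl)).mono_ac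
        (withDensity_absolutelyContinuous _ _)
  have hρm : AEMeasurable (fun z => ENNReal.ofReal (ρ z)) (volume.restrict (D ∩ f ⁻¹' B)) :=
    ((hρ.aemeasurable hD.measurableSet).mono_measure
      (Measure.restrict_mono inter_subset_left le_rfl)).ennreal_ofReal
  have hcongr : ∀ᵐ z ∂(volume.restrict (D ∩ f ⁻¹' B)),
      (ENNReal.ofReal (ρ z)).toReal • g (f z) = ρ z • g (f z) := by
    filter_upwards [ae_restrict_mem hm] with z hz
    rw [ENNReal.toReal_ofReal (hρ0 z hz.1)]
  rw [IntegrableOn, h1]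
  rw [h1] at hg
  constructor
  · rw [integrable_map_measure hg hae, integrable_withDensity_iff_integrable_smul₀' hρm
      (Filter.Eventually.of_forall fun _ => ENNReal.ofReal_lt_top)]
    exact integrable_congr hcongr
  · rw [integral_map hae hg, integral_withDensity_eq_integral_toReal_smul₀ hρm
      (Filter.Eventually.of_forall fun _ => ENNReal.ofReal_lt_top)]
    exact integral_congr_ae hcongr

end ParamMeasure

section Density

variable {n : ℕ} {X : Type*} [TopologicalSpace X] [ChartedSpace (Cn n) X]
  {Y : Set X} {om : X → Cn n [⋀^Fin 2]→L[ℝ] ℝ}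
  {W ι : Type*} [NormedAddCommGroup W] [NormedSpace ℝ W] [Fintype ι] [DecidableEq ι]

theorem volDensity_nonneg (om : X → Cn n [⋀^Fin 2]→L[ℝ] ℝ) (f : W → X) (c : ι → W) (w : W) :
    0 ≤ volDensity om f c w := Real.sqrt_nonneg _

/-- The volume density of a composition is multiplied by the Jacobian determinant. -/
theorem volDensity_comp (hom : IsPositiveForm Y om) {f : W → X} {τ : W → W} {w : W}
    (c : Module.Basis ι ℝ W) (hY : f (τ w) ∈ Y) {f₁ : W → X} (hf₁ : f₁ =ᶠ[𝓝 w] f ∘ τ)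
    (hf : MDifferentiableAt 𝓘(ℝ, W) 𝓘(ℝ, Cn n) f (τ w)) {τ' : W →L[ℝ] W} (hτ : HasFDerivAt τ τ' w) :
    volDensity om f₁ c w = |τ'.det| * volDensity om f c (τ w) := by
  have hD : mfderiv 𝓘(ℝ, W) 𝓘(ℝ, Cn n) f₁ w =
      (mfderiv 𝓘(ℝ, W) 𝓘(ℝ, Cn n) f (τ w)).comp τ' := by
    rw [hf₁.mfderiv_eq, mfderiv_comp w hf hτ.differentiableAt.mdifferentiableAt, mfderiv_eq_fderiv,
      hτ.fderiv]
    rfl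
  set D : W →L[ℝ] Cn n := mfderiv 𝓘(ℝ, W) 𝓘(ℝ, Cn n) f (τ w) with hDdef
  set A := LinearMap.toMatrix c c (τ' : W →ₗ[ℝ] W) with hA
  have hg := hom.isHermScalar hY
  have hf₁w : f₁ w = f (τ w) := hf₁.self_of_nhds
  have hmat : (Matrix.of fun i j => metricOf om (f₁ w) (D (τ' (c i))) (D (τ' (c j)))) =
      A.transpose * (Matrix.of fun i j => metricOf om (f (τ w)) (D (c i)) (D (c j))) * A := by
    ext i j
    have hexp : ∀ i, D (τ' (c i)) = ∑ l, A l i • D (c l) := fun i => by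
      conv_lhs => rw [← c.sum_repr (τ' (c i))]
      simp only [map_sum, map_smul, hA, LinearMap.toMatrix_apply]
      rfl
    rw [Matrix.of_apply, hf₁w, hexp i, hexp j, ← hg.toLin_apply, map_sum hg.toLin,
      LinearMap.sum_apply, Matrix.mul_assoc, Matrix.mul_apply]
    refine Finset.sum_congr rfl fun k _ => ?_
    rw [map_sum, Matrix.mul_apply, Finset.mul_sum]
    refine Finset.sum_congr rfl fun l _ => ?_
    rw [hg.toLin_apply, hg.smul_left, hg.smul_right, Matrix.transpose_apply, Matrix.of_apply]
    ring
  have hdet : A.det = τ'.det := LinearMap.det_toMatrix c _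
  have h1 : volDensity om f₁ c w =
      √(Matrix.of fun i j => metricOf om (f₁ w) (D (τ' (c i))) (D (τ' (c j)))).det := by
    unfold volDensity
    rw [hD]
    rfl
  rw [h1, hmat, Matrix.det_mul, Matrix.det_mul, Matrix.det_transpose, hdet]
  have h2 : ∀ a b : ℝ, √(a * b * a) = |a| * √b := fun a b => by
    rw [mul_right_comm, Real.sqrt_mul (mul_self_nonneg a), Real.sqrt_mul_self_eq_abs]
  rw [h2]
  rfl

theorem volDensity_reindex {κ : Type*} [Fintype κ] [DecidableEq κ]
    {W' : Type*} [NormedAddCommGroup W'] [NormedSpace ℝ W'] (Λ : W ≃L[ℝ] W')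
    {c : ι → W} {c' : κ → W'} (σ : κ ≃ ι) (hσ : ∀ i, Λ.symm (c' i) = c (σ i)) {f : W → X} {w : W'}
    (hf : MDifferentiableAt 𝓘(ℝ, W) 𝓘(ℝ, Cn n) f (Λ.symm w)) :
    volDensity om (fun w' => f (Λ.symm w')) c' w = volDensity om f c (Λ.symm w) := by
  have hD : mfderiv 𝓘(ℝ, W') 𝓘(ℝ, Cn n) (fun w' => f (Λ.symm w')) w =
      (mfderiv 𝓘(ℝ, W) 𝓘(ℝ, Cn n) f (Λ.symm w)).comp (Λ.symm : W' →L[ℝ] W) := by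
    have h := mfderiv_comp w (g := f) (f := Λ.symm) hf
      Λ.symm.differentiableAt.mdifferentiableAt
    rw [mfderiv_eq_fderiv, Λ.symm.fderiv] at h
    exact h
  unfold volDensity
  rw [hD]
  simp only
  rw [← Matrix.det_submatrix_equiv_self σ (Matrix.of fun i j => metricOf om (f (Λ.symm w)) _ _)]
  congr 2
  ext i j
  simp only [Matrix.submatrix_apply, Matrix.of_apply]
  rw [← hσ, ← hσ]
  rfl

variable [IsManifold 𝓘(ℂ, Cn n) ω X]

theorem continuousOn_volDensity (hY : IsOpen Y) (hom : IsPositiveForm Y om) {f : W → X} {D : Set W}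
    (hD : IsOpen D) (hf : ContMDiffOn 𝓘(ℝ, W) 𝓘(ℝ, Cn n) ∞ f D) (c : ι → W) :
    ContinuousOn (volDensity om f c) {w ∈ D | f w ∈ Y} := by
  have hDY : IsOpen {w ∈ D | f w ∈ Y} := hf.continuousOn.isOpen_inter_preimage hD hY
  -- the quadratic form is continuous, the bilinear form follows by polarization
  have hquad : ∀ v : W, ContinuousOn (fun w => metricOf om (f w)
      (mfderiv 𝓘(ℝ, W) 𝓘(ℝ, Cn n) f w v) (mfderiv 𝓘(ℝ, W) 𝓘(ℝ, Cn n) f w v))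
      {w ∈ D | f w ∈ Y} := by
    intro v w₀ hw₀
    refine ContinuousAt.continuousWithinAt ?_
    set x₀ := f w₀ with hx₀
    set e := chartAt (Cn n) x₀ with he
    set κ : W → Cn n := fun w => e (f w) with hκ
    have hDe : IsOpen {w ∈ D | f w ∈ Y ∩ e.source} :=
      hf.continuousOn.isOpen_inter_preimage hD (hY.inter e.open_source)
    have hw₀e : w₀ ∈ {w ∈ D | f w ∈ Y ∩ e.source} := ⟨hw₀.1, hw₀.2, mem_chart_source _ _⟩
    have hκs : ContDiffOn ℝ ∞ κ {w ∈ D | f w ∈ Y ∩ e.source} := by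
      rw [← contMDiffOn_iff_contDiffOn]
      exact (contMDiffOn_chart (I := 𝓘(ℝ, Cn n)) (n := ∞) (x := x₀)).comp
        (hf.mono fun w hw => hw.1) fun w hw => hw.2.2
    have h1 : ContinuousOn (fun w => (κ w, fderiv ℝ κ w v)) {w ∈ D | f w ∈ Y ∩ e.source} :=
      hκs.continuousOn.prodMk ((hκs.continuousOn_fderiv_of_isOpen hDe (by simp)).clm_apply
        continuousOn_const)
    have h2 := (continuousOn_metric_prod hom x₀).comp h1 fun w hw =>
      ⟨⟨e.map_source hw.2.2, by
        rw [← he]; simp only [hκ, e.left_inv hw.2.2]; exact hw.2.1⟩, mem_univ _⟩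
    have h3 := h2.continuousAt (hDe.mem_nhds hw₀e)
    refine h3.congr ?_
    filter_upwards [hDe.mem_nhds hw₀e] with w hw
    simp only [Function.comp_apply, ← he]
    have hfw : e.symm (κ w) = f w := e.left_inv hw.2.2
    have h4 : mfderiv 𝓘(ℝ, W) 𝓘(ℝ, Cn n) f w =
        (chartSymmDeriv x₀ (κ w)).comp (fderiv ℝ κ w) := by
      have h5 : f =ᶠ[𝓝 w] e.symm ∘ κ := by
        filter_upwards [hDe.mem_nhds hw] with w' hw'
        exact (e.left_inv hw'.2.2).symm
      have h6 := mfderiv_comp w (mdifferentiableAt_chart_symm (x₀ := x₀) (e.map_source hw.2.2))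
        ((hκs.contDiffAt (hDe.mem_nhds hw)).differentiableAt (by simp)).mdifferentiableAt
      rw [h5.mfderiv_eq]
      rw [mfderiv_eq_fderiv] at h6
      exact h6
    rw [hfw, h4]
    rfl
  unfold volDensity
  refine Real.continuous_sqrt.comp_continuousOn ?_
  refine (Continuous.matrix_det continuous_id).comp_continuousOn ?_
  refine continuousOn_pi.2 fun i => continuousOn_pi.2 fun j => ?_
  refine (((hquad (c i + c j)).sub (hquad (c i))).sub (hquad (c j)) |>.div_const 2).congr
    fun w hw => ?_
  have hg := hom.isHermScalar hw.2
  have key : ∀ (A : W →L[ℝ] Cn n) (a b : W), metricOf om (f w) (A a) (A b) =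
      (metricOf om (f w) (A (a + b)) (A (a + b)) - metricOf om (f w) (A a) (A a) -
        metricOf om (f w) (A b) (A b)) / 2 := fun A a b => by
    rw [map_add, hg.add_left, hg.add_right, hg.add_right, hg.symm (A b) (A a)]
    ring
  exact key _ _ _

end Density

/-! ### Volume and level measures in charts -/

section ChartMeasure

theorem paramMeasure_comp_measurePreserving {X W W' : Type*} [TopologicalSpace X]
    [MeasurableSpace X] [BorelSpace X]
    [NormedAddCommGroup W] [NormedSpace ℝ W] [FiniteDimensional ℝ W] [MeasureSpace W]
    [BorelSpace W] [NormedAddCommGroup W'] [NormedSpace ℝ W'] [FiniteDimensional ℝ W']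
    [MeasureSpace W'] [BorelSpace W'] [Measure.IsAddHaarMeasure (volume : Measure W)]
    [Measure.IsAddHaarMeasure (volume : Measure W')]
    (Λ : W ≃L[ℝ] W') (hΛ : MeasurePreserving Λ.symm (volume : Measure W') volume)
    {f : W → X} {D : Set W} {ρ : W → ℝ} (hf : ContinuousOn f D) (hD : IsOpen D) :
    paramMeasure (fun w => f (Λ.symm w)) (Λ.symm ⁻¹' D) (fun w => ρ (Λ.symm w)) =
      paramMeasure f D ρ := by
  ext s hs
  rw [paramMeasure_apply (f := fun w => f (Λ.symm w)) (D := Λ.symm ⁻¹' D) (hf.comp Λ.symm.continuous.continuousOn fun w hw => hw)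
    (hD.preimage Λ.symm.continuous) hs, paramMeasure_apply hf hD hs]
  exact hΛ.setLIntegral_comp_preimage_emb Λ.symm.toHomeomorph.measurableEmbedding
    (fun w => ENNReal.ofReal (ρ w)) (D ∩ f ⁻¹' s)

variable {n : ℕ} {X : Type*} [TopologicalSpace X] [ChartedSpace (Cn n) X]

/-- A smooth real chart of `X`, with values in a real vector space. -/
structure IsSmoothChart {W : Type*} [NormedAddCommGroup W] [NormedSpace ℝ W]
    (e : OpenPartialHomeomorph X W) : Prop where
  smooth : ContMDiffOn 𝓘(ℝ, Cn n) 𝓘(ℝ, W) ∞ e e.source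
  smooth_symm : ContMDiffOn 𝓘(ℝ, W) 𝓘(ℝ, Cn n) ∞ e.symm e.target

variable {Y : Set X} {om : X → Cn n [⋀^Fin 2]→L[ℝ] ℝ}
  {W : Type*} [NormedAddCommGroup W] [NormedSpace ℝ W]

theorem IsSmoothChart.mdifferentiableAt_symm {e : OpenPartialHomeomorph X W}
    (he : IsSmoothChart (n := n) e) {z : W} (hz : z ∈ e.target) :
    MDifferentiableAt 𝓘(ℝ, W) 𝓘(ℝ, Cn n) e.symm z :=
  (he.smooth_symm.contMDiffAt (e.open_target.mem_nhds hz)).mdifferentiableAt (by simp)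

theorem isOpen_chartDomain (hY : IsOpen Y) (e : OpenPartialHomeomorph X W) :
    IsOpen {z ∈ e.target | e.symm z ∈ Y} := e.symm.isOpen_inter_preimage hY

theorem differentiableAt_transition {e₁ e₂ : OpenPartialHomeomorph X W}
    (h₁ : IsSmoothChart (n := n) e₁) (h₂ : IsSmoothChart (n := n) e₂) {z : W} (hz : z ∈ e₁.target)
    (hz₂ : e₁.symm z ∈ e₂.source) : DifferentiableAt ℝ (fun w => e₂ (e₁.symm w)) z := by
  rw [← mdifferentiableAt_iff_differentiableAt]
  exact ((h₂.smooth.contMDiffAt (e₂.open_source.mem_nhds hz₂)).mdifferentiableAt (by simp)).comp z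
    (h₁.mdifferentiableAt_symm hz)

/-- The volume densities in two charts differ by the Jacobian of the transition map. -/
theorem volDensity_transition {ι : Type*} [Fintype ι] [DecidableEq ι] (hom : IsPositiveForm Y om)
    (c : Module.Basis ι ℝ W) {e₁ e₂ : OpenPartialHomeomorph X W}
    (h₁ : IsSmoothChart (n := n) e₁) (h₂ : IsSmoothChart (n := n) e₂) {z : W} (hz : z ∈ e₁.target)
    (hzY : e₁.symm z ∈ Y) (hz₂ : e₁.symm z ∈ e₂.source) :
    volDensity om e₁.symm c z =
      |(fderiv ℝ (fun w => e₂ (e₁.symm w)) z).det| * volDensity om e₂.symm c (e₂ (e₁.symm z)) := by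
  refine volDensity_comp (f := e₂.symm) (τ := fun w => e₂ (e₁.symm w)) hom c
    (by rwa [e₂.left_inv hz₂]) ?_ (h₂.mdifferentiableAt_symm (e₂.map_source hz₂))
    (differentiableAt_transition h₁ h₂ hz hz₂).hasFDerivAt
  have ho : IsOpen (e₁.target ∩ e₁.symm ⁻¹' e₂.source) :=
    e₁.symm.isOpen_inter_preimage e₂.open_source
  filter_upwards [ho.mem_nhds ⟨hz, hz₂⟩] with w hw
  exact (e₂.left_inv hw.2).symm

variable [MeasurableSpace X] [BorelSpace X] [FiniteDimensional ℝ W] [MeasureSpace W]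
  [BorelSpace W] [Measure.IsAddHaarMeasure (volume : Measure W)]

/-- The Riemannian volume in a chart. -/
def chartMeasure {ι : Type*} [Fintype ι] [DecidableEq ι] (Y : Set X)
    (om : X → Cn n [⋀^Fin 2]→L[ℝ] ℝ) (c : ι → W) (e : OpenPartialHomeomorph X W) : Measure X :=
  paramMeasure e.symm {z ∈ e.target | e.symm z ∈ Y} (volDensity om e.symm c)

variable {ι : Type*} [Fintype ι] [DecidableEq ι]

theorem chartMeasure_compl (hY : IsOpen Y) (c : ι → W) (e : OpenPartialHomeomorph X W) :
    chartMeasure Y om c e e.sourceᶜ = 0 :=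
  paramMeasure_compl (e.continuousOn_symm.mono fun _ hz => hz.1) (isOpen_chartDomain hY e)
    e.open_source.measurableSet fun _ hz => e.map_target hz.1

theorem chartMeasure_restrict_eq (hY : IsOpen Y) (hom : IsPositiveForm Y om)
    (c : Module.Basis ι ℝ W) {e₁ e₂ : OpenPartialHomeomorph X W}
    (h₁ : IsSmoothChart (n := n) e₁) (h₂ : IsSmoothChart (n := n) e₂) :
    (chartMeasure Y om c e₁).restrict (e₁.source ∩ e₂.source) =
      (chartMeasure Y om c e₂).restrict (e₁.source ∩ e₂.source) := by
  refine paramMeasure_restrict_eq (e₁.continuousOn_symm.mono fun _ hz => hz.1)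
    (isOpen_chartDomain hY e₁) (e₂.continuousOn_symm.mono fun _ hz => hz.1)
    (isOpen_chartDomain hY e₂) (e₁.open_source.inter e₂.open_source).measurableSet
    (τ := fun w => e₂ (e₁.symm w)) (τ' := fun z => fderiv ℝ (fun w => e₂ (e₁.symm w)) z)
    (fun z hz hzU => ⟨⟨e₂.map_source hzU.2, by rw [e₂.left_inv hzU.2]; exact hz.2⟩,
      e₂.left_inv hzU.2, (differentiableAt_transition h₁ h₂ hz.1 hzU.2).hasFDerivAt,
      volDensity_transition hom c h₁ h₂ hz.1 hz.2 hzU.2⟩)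
    (e₁.symm.injOn.mono fun _ hz => hz.1) (e₂.symm.injOn.mono fun _ hz => hz.1)
    (fun w hw hwU => ⟨e₁ (e₂.symm w), ⟨e₁.map_source hwU.1, by
      rw [e₁.left_inv hwU.1]; exact hw.2⟩, e₁.left_inv hwU.1⟩)

theorem isSmoothChart_chartAt [IsManifold 𝓘(ℂ, Cn n) ω X] (x : X) :
    IsSmoothChart (n := n) (chartAt (Cn n) x) :=
  ⟨contMDiffOn_chart, contMDiffOn_chart_symm⟩

theorem volumeMeasure_restrict_chartAt [IsManifold 𝓘(ℂ, Cn n) ω X] (hY : IsOpen Y)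
    (hom : IsPositiveForm Y om) (x₀ : X) :
    (volumeMeasure Y om).restrict (chartAt (Cn n) x₀).source =
      chartMeasure Y om (realBasis n) (chartAt (Cn n) x₀) :=
  iSup_measure_restrict (μ := fun x₀ : X => chartMeasure Y om (realBasis n) (chartAt (Cn n) x₀))
    (fun x => (chartAt (Cn n) x).open_source.measurableSet)
    (fun _ => chartMeasure_compl hY _ _)
    (fun i j => by
      rw [← coe_realBas]
      exact chartMeasure_restrict_eq hY hom _ (isSmoothChart_chartAt i) (isSmoothChart_chartAt j)) x₀

/-- In every smooth real chart, the volume measure is the Riemannian volume. -/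
theorem volumeMeasure_restrict_source [IsManifold 𝓘(ℂ, Cn n) ω X] [SecondCountableTopology X]
    (hY : IsOpen Y) (hom : IsPositiveForm Y om) {e : OpenPartialHomeomorph X (Cn n)}
    (he : IsSmoothChart (n := n) e) :
    (volumeMeasure Y om).restrict e.source = chartMeasure Y om (realBasis n) e := by
  obtain ⟨S, hS, hSu⟩ := TopologicalSpace.countable_cover_nhds
    (fun x : X => (chartAt (Cn n) x).open_source.mem_nhds (mem_chart_source (Cn n) x))
  refine (Measure.ext_iff_of_biUnion_eq_univ hS hSu).2 fun x _ => ?_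
  set U := (chartAt (Cn n) x).source
  have hU : MeasurableSet U := (chartAt (Cn n) x).open_source.measurableSet
  have he' : MeasurableSet e.source := e.open_source.measurableSet
  have hself : (chartMeasure Y om (realBasis n) e).restrict e.source =
      chartMeasure Y om (realBasis n) e := Measure.restrict_eq_self_of_ae_mem (by
    rw [ae_iff]; exact chartMeasure_compl hY _ _)
  have h1 := chartMeasure_restrict_eq hY hom (realBas n) (isSmoothChart_chartAt x) he
  rw [coe_realBas] at h1
  have hself' : (chartMeasure Y om (realBasis n) (chartAt (Cn n) x)).restrict U =
      chartMeasure Y om (realBasis n) (chartAt (Cn n) x) := Measure.restrict_eq_self_of_ae_mem (by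
    rw [ae_iff]; exact chartMeasure_compl hY _ _)
  rw [Measure.restrict_comm hU, volumeMeasure_restrict_chartAt hY hom, ← hself',
    Measure.restrict_restrict he', inter_comm, h1, ← Measure.restrict_restrict hU, hself]

end ChartMeasure

section Adapted

/-- The basis `prodBasis m` of `ℝ × ℝᵐ`. -/
def prodBas (m : ℕ) : Module.Basis (Option (Fin m)) ℝ (ℝ × (Fin m → ℝ)) :=
  ((Module.Basis.singleton Unit ℝ).prod (Pi.basisFun ℝ (Fin m))).reindex
    ((Equiv.sumComm _ _).trans (Equiv.optionEquivSumPUnit _).symm)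

@[simp] theorem coe_prodBas (m : ℕ) : ⇑(prodBas m) = prodBasis m := by
  ext i j
  · rcases i with _ | i <;> simp [prodBas, prodBasis, Module.Basis.prod_apply]
  · rcases i with _ | i <;> simp [prodBas, prodBasis, Module.Basis.prod_apply]

theorem addHaar_prodBas (m : ℕ) : (prodBas m).addHaar = volume := by
  rw [prodBas, Module.Basis.addHaar_reindex, Module.Basis.prod_addHaar, Measure.volume_eq_prod]
  congr 1
  · rw [Module.Basis.addHaar_eq_iff]
    rw [Module.Basis.coe_parallelepiped, parallelepiped_basis_eq]
    have : {x : ℝ | ∀ i, (Module.Basis.singleton Unit ℝ).repr x i ∈ Icc (0 : ℝ) 1} =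
        Icc 0 1 := by
      ext x; simp
    rw [this, Real.volume_Icc]
    simp
  · rw [Module.Basis.addHaar_eq_iff]
    rw [Module.Basis.coe_parallelepiped, parallelepiped_basis_eq]
    have : {x : Fin m → ℝ | ∀ i, (Pi.basisFun ℝ (Fin m)).repr x i ∈ Icc (0 : ℝ) 1} =
        Icc 0 1 := by
      ext x; simp [Pi.le_def, forall_and]
    rw [this, Real.volume_Icc_pi]
    simp

theorem addHaar_realBas (n : ℕ) : (realBas n).addHaar = volume := by
  rw [Module.Basis.addHaar_eq_iff, Module.Basis.coe_parallelepiped, parallelepiped_basis_eq]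
  have h1 : {x : Cn n | ∀ i, (realBas n).repr x i ∈ Icc (0 : ℝ) 1} =
      Set.pi univ fun _ => Icc (0 : ℝ) 1 ×ℂ Icc (0 : ℝ) 1 := by
    ext x
    have h2 : ∀ i, (realBas n).repr x i = realEquiv n x i := fun i => rfl
    have h3 : x ∈ (Set.pi univ fun _ => Icc (0 : ℝ) 1 ×ℂ Icc (0 : ℝ) 1) ↔
        ∀ i, (x i).re ∈ Icc (0 : ℝ) 1 ∧ (x i).im ∈ Icc (0 : ℝ) 1 := by
      simp only [Set.mem_pi, mem_univ, forall_const, Complex.mem_reProdIm]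
    rw [h3, forall_and]
    exact Sum.forall
  have h3 : volume (Icc (0 : ℝ) 1 ×ℂ Icc (0 : ℝ) 1) = 1 := by
    have h4 : Icc (0 : ℝ) 1 ×ℂ Icc (0 : ℝ) 1 =
        Complex.measurableEquivRealProd ⁻¹' (Icc (0 : ℝ) 1 ×ˢ Icc (0 : ℝ) 1) := by
      ext z; simp [Complex.mem_reProdIm, -Icc_prod_Icc]
    rw [h4, Complex.volume_preserving_equiv_real_prod.measure_preimage_equiv,
      Measure.volume_eq_prod, Measure.prod_prod]
    simp
  rw [h1, volume_pi_pi, h3]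
  simp

/-- A volume preserving linear isomorphism `ℝ × ℝ²ⁿ⁻¹ ≃ ℂⁿ` which matches the standard bases, up to a
bijection `σ` of the indices. -/
theorem exists_measurePreserving_equiv {n : ℕ} (hn : 0 < n) :
    ∃ (Λ : (ℝ × (Fin (2 * n - 1) → ℝ)) ≃L[ℝ] Cn n) (σ : Fin n ⊕ Fin n ≃ Option (Fin (2 * n - 1))),
      (∀ i, Λ.symm (realBasis n i) = prodBasis (2 * n - 1) (σ i)) ∧
      MeasurePreserving Λ.symm volume volume := by
  have hcard : Fintype.card (Fin n ⊕ Fin n) = Fintype.card (Option (Fin (2 * n - 1))) := by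
    simp; omega
  let σ := Fintype.equivOfCardEq hcard
  let L : (ℝ × (Fin (2 * n - 1) → ℝ)) ≃ₗ[ℝ] Cn n := (prodBas (2 * n - 1)).equiv (realBas n) σ.symm
  have hL : ∀ i, L.symm (realBasis n i) = prodBasis (2 * n - 1) (σ i) := fun i => by
    rw [LinearEquiv.symm_apply_eq, ← coe_realBas, ← coe_prodBas, Module.Basis.equiv_apply,
      Equiv.symm_apply_apply]
  refine ⟨L.toContinuousLinearEquiv, σ, hL, ⟨L.symm.toContinuousLinearEquiv.continuous.measurable, ?_⟩⟩
  have h1 := (realBas n).map_addHaar L.symm.toContinuousLinearEquiv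
  rw [addHaar_realBas] at h1
  refine Eq.trans h1 ?_
  rw [← addHaar_prodBas, ← Module.Basis.addHaar_reindex (prodBas (2 * n - 1)) σ.symm]
  congr 1
  refine Module.Basis.eq_of_apply_eq fun i => ?_
  rw [Module.Basis.map_apply, Module.Basis.reindex_apply, Equiv.symm_symm, coe_prodBas, coe_realBas]
  exact hL i

variable {n : ℕ} {X : Type*} [TopologicalSpace X] [ChartedSpace (Cn n) X]
  {Y : Set X} {om : X → Cn n [⋀^Fin 2]→L[ℝ] ℝ} {Φ : X → ℝ}

theorem IsAdaptedChart.isSmoothChart {e : OpenPartialHomeomorph X (ℝ × (Fin (2 * n - 1) → ℝ))}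
    (he : IsAdaptedChart Φ e) : IsSmoothChart (n := n) e := ⟨he.smooth, he.smooth_symm⟩

instance (m : ℕ) : Measure.IsAddHaarMeasure (volume : Measure (ℝ × (Fin m → ℝ))) := by
  rw [← addHaar_prodBas]; infer_instance

instance (n : ℕ) : Measure.IsAddHaarMeasure (volume : Measure (Cn n)) := by
  rw [← addHaar_realBas]; infer_instance

variable [MeasurableSpace X] [BorelSpace X]

/-- In an adapted chart, the volume measure is given by the volume density. -/
theorem volumeMeasure_restrict_adapted [IsManifold 𝓘(ℂ, Cn n) ω X] [SecondCountableTopology X]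
    (hn : 0 < n) (hY : IsOpen Y) (hom : IsPositiveForm Y om)
    {e : OpenPartialHomeomorph X (ℝ × (Fin (2 * n - 1) → ℝ))} (he : IsAdaptedChart Φ e) :
    (volumeMeasure Y om).restrict e.source = chartMeasure Y om (prodBasis (2 * n - 1)) e := by
  obtain ⟨Λ, σ, hσ, hΛ⟩ := exists_measurePreserving_equiv hn
  let e' : OpenPartialHomeomorph X (Cn n) := e.transHomeomorph Λ.toHomeomorph
  have he' : IsSmoothChart (n := n) e' := by
    refine ⟨Λ.contDiff.contMDiff.comp_contMDiffOn he.smooth, ?_⟩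
    exact he.smooth_symm.comp Λ.symm.contDiff.contMDiff.contMDiffOn fun z hz => hz
  have h1 := volumeMeasure_restrict_source hY hom he'
  have h2 : e'.source = e.source := rfl
  rw [h2] at h1
  rw [h1]
  have h3 := paramMeasure_comp_measurePreserving Λ hΛ (ρ := volDensity om e.symm (prodBasis (2 * n - 1)))
    (e.continuousOn_symm.mono fun z hz => hz.1) (isOpen_chartDomain hY e)
  rw [chartMeasure, chartMeasure, ← h3]
  have hdom : {z ∈ e'.target | e'.symm z ∈ Y} = Λ.symm ⁻¹' {z ∈ e.target | e.symm z ∈ Y} := rfl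
  rw [hdom]
  ext s hs
  have ho : IsOpen (Λ.symm ⁻¹' {z ∈ e.target | e.symm z ∈ Y}) :=
    (isOpen_chartDomain hY e).preimage Λ.symm.continuous
  have hcont : ContinuousOn e'.symm (Λ.symm ⁻¹' {z ∈ e.target | e.symm z ∈ Y}) :=
    e'.continuousOn_symm.mono fun z hz => hz.1
  rw [paramMeasure_apply hcont ho hs, paramMeasure_apply (f := fun w => e.symm (Λ.symm w)) hcont ho hs]
  refine setLIntegral_congr_fun (measurableSet_inter_preimage hcont ho hs) fun z hz => ?_
  have := volDensity_reindex (om := om) Λ σ hσ (f := e.symm) (w := z)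
    (he.isSmoothChart.mdifferentiableAt_symm hz.1.1)
  exact congrArg ENNReal.ofReal this

/-- The determinant of a linear map which preserves the first coordinate. -/
theorem det_of_fst_eq {m : ℕ} (T : (ℝ × (Fin m → ℝ)) →L[ℝ] ℝ × (Fin m → ℝ))
    (hT : ∀ p, (T p).1 = p.1) :
    T.det = ((ContinuousLinearMap.snd ℝ ℝ (Fin m → ℝ)).comp
      (T.comp (ContinuousLinearMap.inr ℝ ℝ (Fin m → ℝ)))).det := by
  set A := (ContinuousLinearMap.snd ℝ ℝ (Fin m → ℝ)).comp
      (T.comp (ContinuousLinearMap.inr ℝ ℝ (Fin m → ℝ))) with hA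
  let b := (Module.Basis.singleton Unit ℝ).prod (Pi.basisFun ℝ (Fin m))
  have h1 : LinearMap.toMatrix b b (T : (ℝ × (Fin m → ℝ)) →ₗ[ℝ] _) = Matrix.fromBlocks 1 0
      (Matrix.of fun i _ => (T (1, 0)).2 i)
      (LinearMap.toMatrix (Pi.basisFun ℝ (Fin m)) (Pi.basisFun ℝ (Fin m))
        (A : (Fin m → ℝ) →ₗ[ℝ] _)) := by
    ext i j
    rcases i with i | i <;> rcases j with j | j <;>
      simp [b, LinearMap.toMatrix_apply, hT, hA]
  have h2 : T.det = LinearMap.det (T : (ℝ × (Fin m → ℝ)) →ₗ[ℝ] _) := rfl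
  have h3 : A.det = LinearMap.det (A : (Fin m → ℝ) →ₗ[ℝ] _) := rfl
  rw [h2, h3, ← LinearMap.det_toMatrix b, h1, Matrix.det_fromBlocks_zero₁₂, Matrix.det_one, one_mul,
    LinearMap.det_toMatrix]

/-- The part of `levelMeasure` which is defined by the chart `e`. -/
def sliceMeasure (Y : Set X) (om : X → Cn n [⋀^Fin 2]→L[ℝ] ℝ) (d : ℝ)
    (e : OpenPartialHomeomorph X (ℝ × (Fin (2 * n - 1) → ℝ))) : Measure X :=
  paramMeasure (fun s => e.symm (d, s)) {s | (d, s) ∈ e.target ∧ e.symm (d, s) ∈ Y}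
    (fun s => volDensity om e.symm (prodBasis (2 * n - 1)) (d, s))

theorem isOpen_slice (hY : IsOpen Y) (d : ℝ)
    (e : OpenPartialHomeomorph X (ℝ × (Fin (2 * n - 1) → ℝ))) :
    IsOpen {s | (d, s) ∈ e.target ∧ e.symm (d, s) ∈ Y} :=
  (isOpen_chartDomain hY e).preimage (by fun_prop : Continuous fun s => (d, s))

theorem continuousOn_slice (d : ℝ) (e : OpenPartialHomeomorph X (ℝ × (Fin (2 * n - 1) → ℝ))) :
    ContinuousOn (fun s => e.symm (d, s)) {s | (d, s) ∈ e.target ∧ e.symm (d, s) ∈ Y} :=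
  e.continuousOn_symm.comp (by fun_prop) fun _ hs => hs.1

/-- The slice measures of two adapted charts agree on the overlap: the transition map preserves the
first coordinate, hence its Jacobian determinant is the one of its restriction to a slice. -/
theorem sliceMeasure_restrict_eq (hY : IsOpen Y) (hom : IsPositiveForm Y om) (d : ℝ)
    {e₁ e₂ : OpenPartialHomeomorph X (ℝ × (Fin (2 * n - 1) → ℝ))} (h₁ : IsAdaptedChart Φ e₁)
    (h₂ : IsAdaptedChart Φ e₂) :
    (sliceMeasure Y om d e₁).restrict (e₁.source ∩ e₂.source) =
      (sliceMeasure Y om d e₂).restrict (e₁.source ∩ e₂.source) := by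
  have hfst : ∀ (e e' : OpenPartialHomeomorph X (ℝ × (Fin (2 * n - 1) → ℝ))), IsAdaptedChart Φ e →
      IsAdaptedChart Φ e' → ∀ z ∈ e.target, e.symm z ∈ e'.source → (e' (e.symm z)).1 = z.1 :=
    fun e e' h h' z hz hz' => by
      rw [h'.fst_eq _ hz', ← h.fst_eq _ (e.map_target hz), e.right_inv hz]
  have hpair : ∀ (e e' : OpenPartialHomeomorph X (ℝ × (Fin (2 * n - 1) → ℝ))), IsAdaptedChart Φ e →
      IsAdaptedChart Φ e' → ∀ s, (d, s) ∈ e.target → e.symm (d, s) ∈ e'.source →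
      (d, (e' (e.symm (d, s))).2) = e' (e.symm (d, s)) := fun e e' h h' s hs hs' =>
    Prod.ext (hfst e e' h h' _ hs hs').symm rfl
  refine paramMeasure_restrict_eq (continuousOn_slice d e₁) (isOpen_slice hY d e₁)
    (continuousOn_slice d e₂) (isOpen_slice hY d e₂)
    (e₁.open_source.inter e₂.open_source).measurableSet
    (τ := fun s => (e₂ (e₁.symm (d, s))).2)
    (τ' := fun s => (ContinuousLinearMap.snd ℝ ℝ _).comp
      ((fderiv ℝ (fun w => e₂ (e₁.symm w)) (d, s)).comp (ContinuousLinearMap.inr ℝ ℝ _)))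
    ?_ ?_ ?_ ?_
  · rintro s ⟨hs, hsY⟩ ⟨-, hsU⟩
    have hp := hpair e₁ e₂ h₁ h₂ s hs hsU
    have hdiff := differentiableAt_transition h₁.isSmoothChart h₂.isSmoothChart hs hsU
    refine ⟨⟨by rw [hp]; exact e₂.map_source hsU, by rw [hp, e₂.left_inv hsU]; exact hsY⟩,
      by rw [hp, e₂.left_inv hsU], ?_, ?_⟩
    · exact hasFDerivAt_snd.comp s (hdiff.hasFDerivAt.comp s (hasFDerivAt_prodMk_right d s))
    · rw [hp, ← det_of_fst_eq]
      · have := volDensity_transition hom (prodBas (2 * n - 1)) h₁.isSmoothChart h₂.isSmoothChart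
          hs hsY hsU
        rwa [coe_prodBas] at this
      · have h3 : (fun w => (e₂ (e₁.symm w)).1) =ᶠ[𝓝 (d, s)] fun w => w.1 := by
          filter_upwards [(e₁.symm.isOpen_inter_preimage e₂.open_source).mem_nhds ⟨hs, hsU⟩] with w hw
          exact hfst e₁ e₂ h₁ h₂ w hw.1 hw.2
        have h4 := (hasFDerivAt_fst.comp (d, s) hdiff.hasFDerivAt).congr_of_eventuallyEq h3.symm
        have h5 := h4.unique hasFDerivAt_fst
        intro p
        exact congrArg (fun A => A p) h5
  · intro s hs s' hs' h
    have := e₁.symm.injOn hs.1 hs'.1 h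
    exact (Prod.ext_iff.1 this).2
  · intro s hs s' hs' h
    have := e₂.symm.injOn hs.1 hs'.1 h
    exact (Prod.ext_iff.1 this).2
  · rintro s ⟨hs, hsY⟩ ⟨hsU, -⟩
    have hp := hpair e₂ e₁ h₂ h₁ s hs hsU
    refine ⟨(e₁ (e₂.symm (d, s))).2, ⟨?_, ?_⟩, ?_⟩
    · rw [hp]; exact e₁.map_source hsU
    · rw [hp, e₁.left_inv hsU]; exact hsY
    · rw [hp, e₁.left_inv hsU]

/-- In an adapted chart, the level measure is given by the volume density on a slice. -/
theorem levelMeasure_restrict (hY : IsOpen Y) (hom : IsPositiveForm Y om) (d : ℝ)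
    {e : OpenPartialHomeomorph X (ℝ × (Fin (2 * n - 1) → ℝ))} (he : IsAdaptedChart Φ e) :
    (levelMeasure Y om Φ d).restrict e.source = sliceMeasure Y om d e := by
  have h1 : levelMeasure Y om Φ d =
      ⨆ e : {e : OpenPartialHomeomorph X (ℝ × (Fin (2 * n - 1) → ℝ)) // IsAdaptedChart Φ e},
        sliceMeasure Y om d e.1 := by
    rw [iSup_subtype]; rfl
  rw [h1]
  exact iSup_measure_restrict
    (μ := fun e : {e : OpenPartialHomeomorph X (ℝ × (Fin (2 * n - 1) → ℝ)) // IsAdaptedChart Φ e} =>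
      sliceMeasure Y om d e.1) (U := fun e => e.1.source)
    (fun e => e.1.open_source.measurableSet)
    (fun e => paramMeasure_compl (continuousOn_slice d e.1) (isOpen_slice hY d e.1)
      e.1.open_source.measurableSet fun s hs => e.1.map_target hs.1)
    (fun i j => sliceMeasure_restrict_eq hY hom d i.2 j.2) ⟨e, he⟩

end Adapted

/-! ### Adapted charts and the coarea formula -/

section ExistsAdapted

variable {n : ℕ} {X : Type*} [TopologicalSpace X] [ChartedSpace (Cn n) X]
  [IsManifold 𝓘(ℂ, Cn n) ω X] {Φ : X → ℝ}

theorem pos_of_dReal_ne_zero {x : X} (h : dReal (n := n) Φ x ≠ 0) : 0 < n := by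
  rcases Nat.eq_zero_or_pos n with rfl | hn
  · exact absurd (Subsingleton.elim _ _) h
  · exact hn

/-- A nonzero linear form is the first component of a linear isomorphism. -/
theorem exists_linearEquiv_of_ne_zero {ℓ : Cn n →L[ℝ] ℝ} (hℓ : ℓ ≠ 0) :
    ∃ (P : Cn n →L[ℝ] (Fin (2 * n - 1) → ℝ)) (A : Cn n ≃L[ℝ] ℝ × (Fin (2 * n - 1) → ℝ)),
      (A : Cn n →L[ℝ] ℝ × (Fin (2 * n - 1) → ℝ)) = ℓ.prod P := by
  have hdim : Module.finrank ℝ (Cn n) = 2 * n := by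
    rw [Module.finrank_eq_card_basis (realBas n)]; simp; omega
  have hn : 0 < n := by
    rcases Nat.eq_zero_or_pos n with rfl | hn
    · exact absurd (Subsingleton.elim _ _) hℓ
    · exact hn
  let ℓ' : Cn n →ₗ[ℝ] ℝ := ℓ
  have hℓ' : ℓ' ≠ 0 := fun h => hℓ (ContinuousLinearMap.coe_injective h)
  have hrange : LinearMap.range ℓ' = ⊤ := LinearMap.range_eq_top.2 (LinearMap.surjective hℓ')
  have hker : Module.finrank ℝ (LinearMap.ker ℓ') = 2 * n - 1 := by
    have := LinearMap.finrank_range_add_finrank_ker ℓ'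
    rw [hrange, finrank_top, Module.finrank_self, hdim] at this
    omega
  obtain ⟨q⟩ : Nonempty (LinearMap.ker ℓ' ≃ₗ[ℝ] (Fin (2 * n - 1) → ℝ)) :=
    FiniteDimensional.nonempty_linearEquiv_of_finrank_eq (by rw [hker]; simp)
  obtain ⟨r, hr⟩ := (LinearMap.ker ℓ').subtype.exists_leftInverse_of_injective
    (Submodule.ker_subtype _)
  let P : Cn n →ₗ[ℝ] (Fin (2 * n - 1) → ℝ) := q.toLinearMap.comp r
  have hinj : Function.Injective (ℓ'.prod P) := by
    rw [← LinearMap.ker_eq_bot, LinearMap.ker_eq_bot']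
    intro z hz
    have h1 : ℓ' z = 0 := congrArg Prod.fst hz
    have h2 : q (r z) = 0 := congrArg Prod.snd hz
    have h3 : r z = 0 := by simpa using h2
    have h4 : r ((LinearMap.ker ℓ').subtype ⟨z, h1⟩) = ⟨z, h1⟩ :=
      congrArg (fun f => f (⟨z, h1⟩ : LinearMap.ker ℓ')) hr
    rw [Submodule.subtype_apply, h3] at h4
    exact (congrArg Subtype.val h4).symm
  have hdim2 : Module.finrank ℝ (Cn n) = Module.finrank ℝ (ℝ × (Fin (2 * n - 1) → ℝ)) := by
    rw [hdim, Module.finrank_prod, Module.finrank_self, Module.finrank_fin_fun]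
    omega
  refine ⟨P.toContinuousLinearMap,
    (LinearMap.linearEquivOfInjective (ℓ'.prod P) hinj hdim2).toContinuousLinearEquiv, ?_⟩
  ext z <;> rfl

/-- Around a regular point of `Φ` there is a chart whose first coordinate is `Φ`. -/
theorem exists_isAdaptedChart (hΦ : ContMDiff 𝓘(ℝ, Cn n) 𝓘(ℝ, ℝ) ∞ Φ) {x₀ : X}
    (hx₀ : dReal (n := n) Φ x₀ ≠ 0) :
    ∃ e : OpenPartialHomeomorph X (ℝ × (Fin (2 * n - 1) → ℝ)), IsAdaptedChart Φ e ∧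
      x₀ ∈ e.source := by
  set e₀ := chartAt (Cn n) x₀ with he₀
  set φ : Cn n → ℝ := fun z => Φ (e₀.symm z) with hφ
  have hφs : ContDiffOn ℝ ∞ φ e₀.target := by
    rw [← contMDiffOn_iff_contDiffOn]
    exact hΦ.comp_contMDiffOn contMDiffOn_chart_symm
  have hz₀ : e₀ x₀ ∈ e₀.target := mem_chart_target _ _
  have hφd : fderiv ℝ φ (e₀ x₀) = dReal Φ x₀ :=
    (mfderiv_eq_fderiv_chart_symm ((hΦ.mdifferentiable (by simp)) x₀)).symm
  obtain ⟨P, A, hA⟩ := exists_linearEquiv_of_ne_zero hx₀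
  set κ : Cn n → ℝ × (Fin (2 * n - 1) → ℝ) := fun z => (φ z, P z) with hκ
  have hκs : ContDiffOn ℝ ∞ κ e₀.target := hφs.prodMk P.contDiff.contDiffOn
  have hκa : ∀ z ∈ e₀.target, ContDiffAt ℝ ∞ κ z := fun z hz =>
    hκs.contDiffAt (e₀.open_target.mem_nhds hz)
  have hκd : HasFDerivAt κ (A : Cn n →L[ℝ] ℝ × (Fin (2 * n - 1) → ℝ)) (e₀ x₀) := by
    rw [hA, ← hφd]
    exact ((hφs.contDiffAt (e₀.open_target.mem_nhds hz₀)).differentiableAt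
      (by simp)).hasFDerivAt.prodMk P.hasFDerivAt
  set k := (hκa _ hz₀).toOpenPartialHomeomorph κ hκd (by simp) with hk
  have hkκ : ⇑k = κ := rfl
  -- the inverse is smooth where the derivative of `κ` is invertible
  set O : Set (Cn n) := e₀.target ∩ fderiv ℝ κ ⁻¹'
    range ((↑) : (Cn n ≃L[ℝ] ℝ × (Fin (2 * n - 1) → ℝ)) → (Cn n →L[ℝ] _)) with hO
  have hOo : IsOpen O := (hκs.continuousOn_fderiv_of_isOpen e₀.open_target
    (by simp)).isOpen_inter_preimage e₀.open_target ContinuousLinearEquiv.isOpen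
  have hz₀O : e₀ x₀ ∈ O := ⟨hz₀, A, by rw [hκd.fderiv]⟩
  have hz₀k : e₀ x₀ ∈ k.source := (hκa _ hz₀).mem_toOpenPartialHomeomorph_source hκd (by simp)
  set e := e₀.trans (k.restrOpen O hOo) with he
  have hsrc : ∀ x ∈ e.source, x ∈ e₀.source ∧ e₀ x ∈ k.source ∧ e₀ x ∈ O := by
    intro x hx
    rw [he, OpenPartialHomeomorph.trans_source, OpenPartialHomeomorph.restrOpen_source] at hx
    exact ⟨hx.1, hx.2.1, hx.2.2⟩
  refine ⟨e, ⟨?_, ?_, ?_⟩, ?_⟩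
  · have h1 : ContMDiffOn 𝓘(ℝ, Cn n) 𝓘(ℝ, ℝ × (Fin (2 * n - 1) → ℝ)) ∞ (κ ∘ e₀) e₀.source :=
      (contMDiffOn_iff_contDiffOn.2 hκs).comp contMDiffOn_chart fun x hx => e₀.map_source hx
    exact h1.mono fun x hx => (hsrc x hx).1
  · intro y hy
    have h1 := hsrc _ (e.map_target hy)
    have hyk : y ∈ k.target := by
      rw [he, OpenPartialHomeomorph.trans_target] at hy
      have := hy.1
      simp only [OpenPartialHomeomorph.restrOpen, mfld_simps] at this
      exact this.1
    have h2 : e.symm y = e₀.symm (k.symm y) := rfl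
    have hmem : k.symm y ∈ e₀.target := by
      rw [he, OpenPartialHomeomorph.trans_target] at hy
      exact hy.2
    have h3 : e₀ (e.symm y) = k.symm y := by rw [h2, e₀.right_inv hmem]
    rw [h3] at h1
    obtain ⟨A', hA'⟩ := h1.2.2.2
    have h4 : ContDiffAt ℝ ∞ k.symm y := by
      refine k.contDiffAt_symm (f₀' := A') hyk ?_ (hκa _ hmem)
      rw [hA']
      exact ((hκa _ hmem).differentiableAt (by simp)).hasFDerivAt
    refine ContMDiffAt.contMDiffWithinAt ?_
    exact ((contMDiffOn_chart_symm (I := 𝓘(ℝ, Cn n)) (n := ∞)).contMDiffAt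
      (e₀.open_target.mem_nhds hmem)).comp y h4.contMDiffAt
  · intro x hx
    change Φ (e₀.symm (e₀ x)) = Φ x
    rw [e₀.left_inv (hsrc x hx).1]
  · rw [he, OpenPartialHomeomorph.trans_source, OpenPartialHomeomorph.restrOpen_source]
    exact ⟨mem_chart_source _ _, hz₀k, hz₀O⟩

end ExistsAdapted

section Coarea

variable {n : ℕ} {X : Type*} [TopologicalSpace X] [ChartedSpace (Cn n) X]
  {Y : Set X} {om : X → Cn n [⋀^Fin 2]→L[ℝ] ℝ} {Φ : X → ℝ} [MeasurableSpace X]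

/-- The coarea formula `∫_C g dV = ∫ (∫_{C ∩ {Φ = t}} g dS) dt` for `g` on the set `C`, together with
the integrability of the inner and the outer integrands on the right hand side. -/
def CoareaOn (Y : Set X) (om : X → Cn n [⋀^Fin 2]→L[ℝ] ℝ) (Φ : X → ℝ) (g : X → ℂ) (C : Set X) :
    Prop :=
  (∀ᵐ t : ℝ, IntegrableOn g C (levelMeasure Y om Φ t)) ∧
  Integrable (fun t : ℝ => ∫ x in C, g x ∂(levelMeasure Y om Φ t)) ∧
  ∫ x in C, g x ∂(volumeMeasure Y om) = ∫ t : ℝ, ∫ x in C, g x ∂(levelMeasure Y om Φ t)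

theorem CoareaOn.empty (g : X → ℂ) : CoareaOn Y om Φ g ∅ := by
  simp [CoareaOn]

theorem CoareaOn.union {g : X → ℂ} {C C' : Set X} (h : CoareaOn Y om Φ g C)
    (h' : CoareaOn Y om Φ g C') (hd : Disjoint C C') (hC' : MeasurableSet C')
    (hg : IntegrableOn g (C ∪ C') (volumeMeasure Y om)) : CoareaOn Y om Φ g (C ∪ C') := by
  have h1 : ∀ᵐ t : ℝ, ∫ x in C ∪ C', g x ∂(levelMeasure Y om Φ t) =
      ∫ x in C, g x ∂(levelMeasure Y om Φ t) + ∫ x in C', g x ∂(levelMeasure Y om Φ t) := by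
    filter_upwards [h.1, h'.1] with t ht ht' using setIntegral_union hd hC' ht ht'
  refine ⟨?_, (integrable_congr h1).2 (h.2.1.add h'.2.1), ?_⟩
  · filter_upwards [h.1, h'.1] with t ht ht' using ht.union ht'
  · rw [integral_congr_ae h1, integral_add h.2.1 h'.2.1, ← h.2.2, ← h'.2.2,
      setIntegral_union hd hC' (hg.mono_set subset_union_left) (hg.mono_set subset_union_right)]

variable [BorelSpace X]

theorem levelMeasure_preimage_compl (hY : IsOpen Y) (hΦ : Continuous Φ) (d : ℝ) :
    levelMeasure Y om Φ d (Φ ⁻¹' {d})ᶜ = 0 := by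
  have hm : MeasurableSet (Φ ⁻¹' {d}) := (isClosed_singleton.preimage hΦ).measurableSet
  have h1 : levelMeasure Y om Φ d ≤ (levelMeasure Y om Φ d).restrict (Φ ⁻¹' {d}) := by
    refine iSup₂_le fun e he => ?_
    have h2 : sliceMeasure Y om d e ≤ levelMeasure Y om Φ d :=
      le_iSup₂ (f := fun e (_ : IsAdaptedChart Φ e) => sliceMeasure Y om d e) e he
    have h3 : sliceMeasure Y om d e (Φ ⁻¹' {d})ᶜ = 0 :=
      paramMeasure_compl (continuousOn_slice d e) (isOpen_slice hY d e) hm fun s hs => by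
        rw [mem_preimage, mem_singleton_iff, ← he.fst_eq _ (e.map_target hs.1), e.right_inv hs.1]
    have h4 : (sliceMeasure Y om d e).restrict (Φ ⁻¹' {d}) = sliceMeasure Y om d e :=
      Measure.restrict_eq_self_of_ae_mem (by rw [ae_iff]; exact h3)
    change sliceMeasure Y om d e ≤ _
    rw [← h4]
    exact Measure.restrict_mono_measure h2 _
  have h2 := h1 (Φ ⁻¹' {d})ᶜ
  rw [Measure.restrict_apply hm.compl, compl_inter_self, measure_empty] at h2
  exact le_antisymm h2 zero_le

/-- On `Y`, the level measure only sees the level set, so the region may be enlarged to `Φ ⁻¹' I`. -/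
theorem levelMeasure_restrict_preimage (hY : IsOpen Y) (hΦ : Continuous Φ) {I : Set ℝ} {d : ℝ}
    (hd : d ∈ I) : (levelMeasure Y om Φ d).restrict (Y ∩ Φ ⁻¹' I) =
      (levelMeasure Y om Φ d).restrict (Φ ⁻¹' {d} ∩ Y) := by
  refine Measure.restrict_congr_set ?_
  have h1 : ∀ᵐ x ∂(levelMeasure Y om Φ d), Φ x = d := by
    rw [ae_iff]; exact levelMeasure_preimage_compl hY hΦ d
  filter_upwards [h1] with x hx
  refine propext ⟨fun h => ⟨hx, h.1⟩, fun h => ⟨h.2, ?_⟩⟩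
  rw [mem_preimage, hx]
  exact hd

variable [IsManifold 𝓘(ℂ, Cn n) ω X] [SecondCountableTopology X]

/-- In an adapted chart, the coarea formula is Fubini's theorem. -/
theorem coareaOn_chart (hn : 0 < n) (hY : IsOpen Y) (hom : IsPositiveForm Y om)
    {e : OpenPartialHomeomorph X (ℝ × (Fin (2 * n - 1) → ℝ))} (he : IsAdaptedChart Φ e) {g : X → ℂ}
    (hg : ContinuousOn g Y) {C : Set X} (hC : MeasurableSet C) (hCY : C ⊆ Y) (hCe : C ⊆ e.source)
    (hgC : IntegrableOn g C (volumeMeasure Y om)) : CoareaOn Y om Φ g C := by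
  have hgm : ∀ μ : Measure X, AEStronglyMeasurable g (μ.restrict C) := fun μ =>
    (hg.mono hCY).aestronglyMeasurable hC
  have hvol : (volumeMeasure Y om).restrict C =
      (chartMeasure Y om (prodBasis (2 * n - 1)) e).restrict C := by
    rw [← volumeMeasure_restrict_adapted hn hY hom he, Measure.restrict_restrict_of_subset hCe]
  have hlev : ∀ t, (levelMeasure Y om Φ t).restrict C = (sliceMeasure Y om t e).restrict C :=
    fun t => by rw [← levelMeasure_restrict hY hom t he, Measure.restrict_restrict_of_subset hCe]
  have hρ := continuousOn_volDensity hY hom e.open_target he.smooth_symm (prodBasis (2 * n - 1))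
  have hcont : ContinuousOn e.symm {z ∈ e.target | e.symm z ∈ Y} :=
    e.continuousOn_symm.mono fun _ hz => hz.1
  set D := {z ∈ e.target | e.symm z ∈ Y} with hD
  have hDo : IsOpen D := isOpen_chartDomain hY e
  set G : ℝ × (Fin (2 * n - 1) → ℝ) → ℂ :=
    (D ∩ e.symm ⁻¹' C).indicator fun z => volDensity om e.symm (prodBasis (2 * n - 1)) z •
      g (e.symm z) with hG
  have hm := measurableSet_inter_preimage hcont hDo hC
  obtain ⟨h1, h2⟩ := restrict_paramMeasure_integral hcont hDo hρ
    (fun _ _ => volDensity_nonneg _ _ _ _) hC (hgm _)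
  have hslice : ∀ t, (IntegrableOn g C (levelMeasure Y om Φ t) ↔ Integrable fun s => G (t, s)) ∧
      ∫ x in C, g x ∂(levelMeasure Y om Φ t) = ∫ s, G (t, s) := by
    intro t
    obtain ⟨h3, h4⟩ := restrict_paramMeasure_integral (continuousOn_slice t e) (isOpen_slice hY t e)
      (ρ := fun s => volDensity om e.symm (prodBasis (2 * n - 1)) (t, s))
      (hρ.comp (by fun_prop) fun s hs => hs)
      (fun _ _ => volDensity_nonneg _ _ _ _) hC (hgm _)
    have hmt := measurableSet_inter_preimage (continuousOn_slice t e) (isOpen_slice hY t e) hC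
    rw [← integrable_indicator_iff hmt] at h3
    rw [← integral_indicator hmt] at h4
    rw [IntegrableOn, hlev t]
    exact ⟨h3, h4⟩
  have hGi : Integrable G := by
    rw [hG, integrable_indicator_iff hm]
    refine h1.1 ?_
    rw [IntegrableOn, hvol] at hgC
    exact hgC
  rw [Measure.volume_eq_prod] at hGi
  refine ⟨?_, ?_, ?_⟩
  · filter_upwards [hGi.prod_right_ae] with t ht using (hslice t).1.2 ht
  · simp_rw [fun t => (hslice t).2]
    exact hGi.integral_prod_left
  · simp_rw [fun t => (hslice t).2]
    rw [← integral_prod _ hGi, hvol]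
    rw [← integral_indicator hm] at h2
    exact h2

theorem coareaOn_of_cover (hn : 0 < n) (hY : IsOpen Y) (hom : IsPositiveForm Y om) {ι : Type*}
    (s : Finset ι) {e : ι → OpenPartialHomeomorph X (ℝ × (Fin (2 * n - 1) → ℝ))}
    (he : ∀ i ∈ s, IsAdaptedChart Φ (e i)) {g : X → ℂ} (hg : ContinuousOn g Y) {C : Set X}
    (hC : MeasurableSet C) (hCY : C ⊆ Y) (hCe : C ⊆ ⋃ i ∈ s, (e i).source)
    (hgC : IntegrableOn g C (volumeMeasure Y om)) : CoareaOn Y om Φ g C := by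
  classical
  induction s using Finset.induction_on generalizing C with
  | empty =>
    have : C = ∅ := by simpa using hCe
    rw [this]
    exact CoareaOn.empty g
  | insert i s hi ih =>
    have hm : MeasurableSet (e i).source := (e i).open_source.measurableSet
    have h1 : CoareaOn Y om Φ g (C ∩ (e i).source) :=
      coareaOn_chart hn hY hom (he i (Finset.mem_insert_self i s)) hg (hC.inter hm)
        (inter_subset_left.trans hCY) inter_subset_right (hgC.mono_set inter_subset_left)
    have h2 : CoareaOn Y om Φ g (C \ (e i).source) := by
      refine ih (fun j hj => he j (Finset.mem_insert_of_mem hj)) (hC.diff hm)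
        (sdiff_subset.trans hCY) ?_ (hgC.mono_set sdiff_subset)
      intro x hx
      have := hCe hx.1
      simp only [Finset.mem_insert, iUnion_iUnion_eq_or_left, mem_union] at this
      exact this.resolve_left hx.2
    have h3 := h1.union h2 (disjoint_sdiff_right.mono_left inter_subset_right) (hC.diff hm)
      (by rwa [inter_union_sdiff])
    rwa [inter_union_sdiff] at h3

/-- The coarea formula for a compact region without critical points. -/
theorem coareaOn_of_isCompact (hY : IsOpen Y) (hom : IsPositiveForm Y om)
    (hΦ : ContMDiff 𝓘(ℝ, Cn n) 𝓘(ℝ, ℝ) ∞ Φ) {L : Set X} (hL : IsCompact L)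
    (hreg : ∀ x ∈ L, dReal (n := n) Φ x ≠ 0) {g : X → ℂ} (hg : ContinuousOn g Y) {C : Set X}
    (hC : MeasurableSet C) (hCY : C ⊆ Y) (hCL : C ⊆ L)
    (hgC : IntegrableOn g C (volumeMeasure Y om)) : CoareaOn Y om Φ g C := by
  rcases L.eq_empty_or_nonempty with rfl | ⟨x₀, hx₀⟩
  · rw [subset_empty_iff.1 hCL]
    exact CoareaOn.empty g
  have hn := pos_of_dReal_ne_zero (hreg x₀ hx₀)
  obtain ⟨e₁, -, -⟩ := exists_isAdaptedChart hΦ (hreg x₀ hx₀)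
  have : Nonempty (OpenPartialHomeomorph X (ℝ × (Fin (2 * n - 1) → ℝ))) := ⟨e₁⟩
  choose! e he hxe using fun x (hx : x ∈ L) => exists_isAdaptedChart hΦ (hreg x hx)
  obtain ⟨t, htL, ht⟩ := hL.elim_nhds_subcover (fun x => (e x).source) fun x hx =>
    (e x).open_source.mem_nhds (hxe x hx)
  exact coareaOn_of_cover hn hY hom t (fun i hi => he i (htL i hi)) hg hC hCY (hCL.trans ht) hgC

end Coarea

/-! ### Regular sublevel sets -/

section Sublevel

variable {n : ℕ} {X : Type*} [TopologicalSpace X] [ChartedSpace (Cn n) X]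

theorem IsZariskiOpen.isOpen {Y : Set X} (hY : IsZariskiOpen (n := n) Y) : IsOpen Y := by
  refine isOpen_iff_mem_nhds.2 fun x hx => ?_
  obtain ⟨U, hU, hxU, r, f, hf, hZ⟩ := hY x
  have h1 : ∃ i, f i x ≠ 0 := by
    by_contra! h
    have : x ∈ Yᶜ ∩ U := by rw [hZ]; exact ⟨hxU, h⟩
    exact this.1 hx
  obtain ⟨i, hi⟩ := h1
  filter_upwards [(hf i).continuousOn.isOpen_inter_preimage hU isOpen_compl_singleton |>.mem_nhds
    ⟨hxU, hi⟩] with y hy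
  by_contra hyY
  have : y ∈ Yᶜ ∩ U := ⟨hyY, hy.1⟩
  rw [hZ] at this
  exact hy.2 (this.2 i)

variable [IsManifold 𝓘(ℂ, Cn n) ω X] {Φ : X → ℝ}

theorem isClosed_critical (hΦ : ContMDiff 𝓘(ℝ, Cn n) 𝓘(ℝ, ℝ) ∞ Φ) :
    IsClosed {x | dReal (n := n) Φ x = 0} := by
  rw [← isOpen_compl_iff, isOpen_iff_mem_nhds]
  intro x₀ hx₀
  set e := chartAt (Cn n) x₀
  have hφs : ContDiffOn ℝ ∞ (fun z => Φ (e.symm z)) e.target := by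
    rw [← contMDiffOn_iff_contDiffOn]
    exact hΦ.comp_contMDiffOn contMDiffOn_chart_symm
  have hφd : fderiv ℝ (fun z => Φ (e.symm z)) (e x₀) = dReal Φ x₀ :=
    (mfderiv_eq_fderiv_chart_symm ((hΦ.mdifferentiable (by simp)) x₀)).symm
  have hcont : ContinuousAt (fun x => fderiv ℝ (fun z => Φ (e.symm z)) (e x)) x₀ :=
    ContinuousAt.comp (f := e) ((hφs.continuousOn_fderiv_of_isOpen e.open_target
      (by simp)).continuousAt (e.open_target.mem_nhds (mem_chart_target _ _)))
      (e.continuousAt (mem_chart_source _ _))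
  have hne : fderiv ℝ (fun z => Φ (e.symm z)) (e x₀) ≠ 0 := by rw [hφd]; exact hx₀
  filter_upwards [hcont.eventually_ne hne, e.open_source.mem_nhds (mem_chart_source _ _)]
    with x hx hxs h0
  refine hx (ContinuousLinearMap.ext fun v => ?_)
  rw [dReal_apply_chart (e.map_source hxs) ((hΦ.mdifferentiable (by simp)) _)]
  have h1 : e.symm (e x) = x := e.left_inv hxs
  rw [h1]
  exact congrArg (fun A => A (chartSymmDeriv x₀ (e x) v)) h0

/-- Near a regular value, there are no critical points on a compact sublevel set. -/
theorem exists_regular_interval (hΦ : ContMDiff 𝓘(ℝ, Cn n) 𝓘(ℝ, ℝ) ∞ Φ) {c c' : ℝ} (hc : c < c')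
    (hcompact : IsCompact (closure {x | Φ x < c'}))
    (hreg : ∀ x, Φ x = c → dReal (n := n) Φ x ≠ 0) :
    ∃ a > 0, IsCompact (Φ ⁻¹' Icc (c - a) (c + a)) ∧
      ∀ x ∈ Φ ⁻¹' Icc (c - a) (c + a), dReal (n := n) Φ x ≠ 0 := by
  set K := closure {x | Φ x < c'} ∩ {x | dReal (n := n) Φ x = 0} with hK
  have hKc : IsCompact (Φ '' K) := (hcompact.inter_right (isClosed_critical hΦ)).image hΦ.continuous
  have hcK : c ∉ Φ '' K := by
    rintro ⟨x, hx, hxc⟩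
    exact hreg x hxc hx.2
  obtain ⟨ε, hε, hεK⟩ := Metric.nhds_basis_closedBall.mem_iff.1 (hKc.isClosed.isOpen_compl.mem_nhds hcK)
  have hlt : ∀ x, Φ x ≤ c + min ε ((c' - c) / 2) → Φ x < c' := fun x hx => by
    have := min_le_right ε ((c' - c) / 2)
    linarith
  refine ⟨min ε ((c' - c) / 2), lt_min hε (by linarith), ?_, fun x hx h0 => ?_⟩
  · exact hcompact.of_isClosed_subset (isClosed_Icc.preimage hΦ.continuous)
      fun x hx => subset_closure (hlt x hx.2)
  · have h1 : Φ x ∈ Metric.closedBall c ε := by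
      have := min_le_left ε ((c' - c) / 2)
      rw [Metric.mem_closedBall, Real.dist_eq, abs_le]
      constructor <;> linarith [hx.1, hx.2]
    exact hεK h1 ⟨x, ⟨subset_closure (hlt x hx.2), h0⟩, rfl⟩

/-- The boundary of a regular sublevel set is the level set. -/
theorem frontier_sublevel (hΦ : ContMDiff 𝓘(ℝ, Cn n) 𝓘(ℝ, ℝ) ∞ Φ) {d : ℝ}
    (hreg : ∀ x, Φ x = d → dReal (n := n) Φ x ≠ 0) : frontier {x | Φ x < d} = Φ ⁻¹' {d} := by
  refine Subset.antisymm (frontier_lt_subset_eq hΦ.continuous continuous_const) fun x hx => ?_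
  have hopen : IsOpen {x | Φ x < d} := isOpen_lt hΦ.continuous continuous_const
  rw [hopen.frontier_eq]
  refine ⟨?_, fun h => (ne_of_lt h) hx⟩
  -- in an adapted chart at `x`, decrease the first coordinate
  obtain ⟨e, he, hxe⟩ := exists_isAdaptedChart hΦ (hreg x hx)
  have hd : (e x).1 = d := (he.fst_eq x hxe).trans hx
  have h1 : Tendsto (fun t : ℝ => (t, (e x).2)) (𝓝[<] d) (𝓝 (e x)) := by
    have h2 : Continuous fun t : ℝ => (t, (e x).2) := by fun_prop
    have h3 := (h2.tendsto d).mono_left (nhdsWithin_le_nhds (s := Iio d))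
    rwa [← hd, Prod.mk.eta, hd] at h3
  have h2 : Tendsto (fun t : ℝ => e.symm (t, (e x).2)) (𝓝[<] d) (𝓝 x) := by
    have h3 := (e.continuousAt_symm (e.map_source hxe)).tendsto.comp h1
    rwa [e.left_inv hxe] at h3
  refine mem_closure_of_tendsto h2 ?_
  filter_upwards [h1.eventually (e.open_target.mem_nhds (e.map_source hxe)), self_mem_nhdsWithin]
    with t ht htd
  rw [← he.fst_eq _ (e.map_target ht), e.right_inv ht]
  exact htd

variable {Y : Set X} {om : X → Cn n [⋀^Fin 2]→L[ℝ] ℝ} [MeasurableSpace X] [BorelSpace X]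
  [SecondCountableTopology X]

/-- The volume measure is a countable sum of the volumes of disjoint pieces of charts. -/
theorem sFinite_volumeMeasure (hY : IsOpen Y) (hom : IsPositiveForm Y om) :
    SFinite (volumeMeasure Y om) := by
  rcases isEmpty_or_nonempty X with hX | hX
  · rw [Measure.eq_zero_of_isEmpty (volumeMeasure Y om)]
    infer_instance
  obtain ⟨S, hS, hSu⟩ := TopologicalSpace.countable_cover_nhds
    (fun x : X => (chartAt (Cn n) x).open_source.mem_nhds (mem_chart_source (Cn n) x))
  have hSne : S.Nonempty := by
    rw [nonempty_iff_ne_empty]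
    rintro rfl
    obtain ⟨x⟩ := hX
    have := hSu ▸ mem_univ x
    simp at this
  obtain ⟨s, hs⟩ := hS.exists_eq_range hSne
  let U : ℕ → Set X := fun i => (chartAt (Cn n) (s i)).source
  have hU : ⋃ i, U i = univ := by rw [← hSu, hs, biUnion_range]
  have hUm : ∀ i, MeasurableSet (U i) := fun i => (chartAt (Cn n) (s i)).open_source.measurableSet
  have h1 := Measure.restrict_iUnion (μ := volumeMeasure Y om) (disjoint_disjointed U)
    fun i => MeasurableSet.disjointed hUm i
  rw [iUnion_disjointed, hU, Measure.restrict_univ] at h1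
  have h2 : ∀ i, (volumeMeasure Y om).restrict (disjointed U i) =
      (chartMeasure Y om (realBasis n) (chartAt (Cn n) (s i))).restrict (disjointed U i) := fun i => by
    rw [← volumeMeasure_restrict_chartAt hY hom,
      Measure.restrict_restrict_of_subset (disjointed_subset U i)]
  have h3 : ∀ i, SFinite ((volumeMeasure Y om).restrict (disjointed U i)) := fun i => by
    rw [h2, chartMeasure, paramMeasure]
    infer_instance
  rw [h1]
  infer_instance

end Sublevel

section Calculus

/-- A test function on `(α, β)` is the derivative of a smooth function vanishing after `β`. -/
theorem exists_primitive {ψ : ℝ → ℝ} (hψ : ContDiff ℝ ∞ ψ) {α β : ℝ}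
    (hsupp : ∀ t, t ∉ Ioo α β → ψ t = 0) :
    ∃ l : ℝ → ℝ, ContDiff ℝ ∞ l ∧ (∀ t, HasDerivAt l (ψ t) t) ∧ (∃ M, ∀ t, |l t| ≤ M) ∧
      ∀ s, l s = - ∫ t in Ioo α β, if s < t then ψ t else 0 := by
  set l : ℝ → ℝ := fun s => (∫ t in α..s, ψ t) - ∫ t in α..β, ψ t with hl
  have hint : ∀ a b, IntervalIntegrable ψ volume a b := fun a b => hψ.continuous.intervalIntegrable a b
  have hder : ∀ t, HasDerivAt l (ψ t) t := fun t =>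
    (intervalIntegral.integral_hasDerivAt_right (hint _ _)
      hψ.continuous.aestronglyMeasurable.stronglyMeasurableAtFilter hψ.continuous.continuousAt).sub_const _
  have hls : ContDiff ℝ ∞ l := by
    rw [contDiff_infty_iff_deriv]
    refine ⟨fun t => (hder t).differentiableAt, ?_⟩
    rwa [show deriv l = ψ from funext fun t => (hder t).deriv]
  have hval : ∀ s, l s = - ∫ t in s..β, ψ t := fun s => by
    rw [hl, ← intervalIntegral.integral_add_adjacent_intervals (hint α s) (hint s β)]
    ring
  have hform : ∀ s, l s = - ∫ t in Ioo α β, if s < t then ψ t else 0 := by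
    intro s
    rw [hval]
    congr 1
    have h1 : ∫ t in Ioo α β, (if s < t then ψ t else 0) = ∫ t in Ioi s, ψ t := by
      rw [← integral_indicator measurableSet_Ioo, ← integral_indicator measurableSet_Ioi]
      congr 1
      ext t
      by_cases ht : t ∈ Ioo α β
      · simp [ht, indicator_apply]
      · simp [ht, indicator_apply, hsupp t ht]
    rw [h1]
    have hz : ∀ a, β ≤ a → ∫ t in Ioi a, ψ t = 0 := fun a ha => by
      rw [setIntegral_congr_fun (g := fun _ => (0 : ℝ)) measurableSet_Ioi fun t ht =>
        hsupp t fun h => by have := h.2; have : a < t := ht; linarith]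
      simp
    rcases le_total s β with hs | hs
    · rw [intervalIntegral.integral_of_le hs, ← Ioc_union_Ioi_eq_Ioi hs,
        setIntegral_union (Ioc_disjoint_Ioi le_rfl) measurableSet_Ioi, hz β le_rfl, add_zero]
      · exact (hint s β).1
      · refine (integrableOn_zero (ε' := ℝ)).congr_fun (fun t ht => ?_) measurableSet_Ioi
        exact (hsupp t fun h => by have := h.2; have : β < t := ht; linarith).symm
    · rw [hz s hs, intervalIntegral.integral_symm, intervalIntegral.integral_of_le hs,
        setIntegral_congr_fun (g := fun _ => (0 : ℝ)) measurableSet_Ioc fun t ht =>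
        hsupp t fun h => by have := h.2; have := ht.1; linarith]
      simp
  refine ⟨l, hls, hder, ⟨∫ t in Ioo α β, |ψ t|, fun s => ?_⟩, hform⟩
  have hψi : IntegrableOn (fun t => |ψ t|) (Ioo α β) :=
    ((hint α β).1.mono_set Ioo_subset_Ioc_self).norm
  rw [hform, abs_neg]
  refine (abs_integral_le_integral_abs).trans (integral_mono_of_nonneg
    (Filter.Eventually.of_forall fun _ => abs_nonneg _) hψi
    (Filter.Eventually.of_forall fun t => ?_))
  by_cases h : s < t <;> simp [h]

end Calculus

/-! ### The adjoint relation on complete manifolds -/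

section Adjoint

variable {n k : ℕ} {X : Type*} [TopologicalSpace X] [T2Space X] [SecondCountableTopology X]
  [ChartedSpace (Cn n) X] [IsManifold 𝓘(ℂ, Cn n) ω X] [MeasurableSpace X] [BorelSpace X]
  {F : X → Type*} [∀ x, AddCommGroup (F x)] [∀ x, Module ℂ (F x)] [∀ x, TopologicalSpace (F x)]
  [TopologicalSpace (TotalSpace ℂ F)] [FiberBundle ℂ F] [VectorBundle ℂ ℂ F]
  {Y : Set X} {om : X → Cn n [⋀^Fin 2]→L[ℝ] ℝ} {h : ∀ x, F x →ₗ[ℂ] F x →ₗ⋆[ℂ] ℂ}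

theorem pointInner_self_nonneg (hom : IsPositiveForm Y om) (hh : IsHermitianMetric (n := n) Y h)
    (u : ∀ x : X, Cn n [⋀^Fin k]→L[ℝ] F x) {x : X} (hx : x ∈ Y) :
    0 ≤ (pointInner om h u u x).re :=
  formInner_self_nonneg (hom.isHermScalar hx) (hh.isPosSemi hx) _

theorem norm_pointInner_le (hom : IsPositiveForm Y om) (hh : IsHermitianMetric (n := n) Y h)
    (u v : ∀ x : X, Cn n [⋀^Fin k]→L[ℝ] F x) {x : X} (hx : x ∈ Y) :
    ‖pointInner om h u v x‖ ≤ ((pointInner om h u u x).re + (pointInner om h v v x).re) / 2 :=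
  norm_formInner_le (hom.isHermScalar hx) (hh.isPosSemi hx) _ _

theorem pointInner_smulForm (f : X → ℝ) (u v : ∀ x : X, Cn n [⋀^Fin k]→L[ℝ] F x) (x : X) :
    pointInner om h (smulForm f u) v x = f x * pointInner om h u v x :=
  formInner_smul_left _ _ _ (fun m => smulForm_apply f u x m) _

theorem integrableOn_pointInner_self (hY : IsOpen Y) (hom : IsPositiveForm Y om)
    (hh : IsHermitianMetric (n := n) Y h) {u : ∀ x : X, Cn n [⋀^Fin k]→L[ℝ] F x}
    (hu : IsContForm Y u) (hfin : FiniteL2Norm Y om h u) :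
    IntegrableOn (fun x => (pointInner om h u u x).re) Y (volumeMeasure Y om) := by
  refine ⟨((Complex.continuous_re.comp_continuousOn
    (continuousOn_pointInner hY hom hh hu hu)).aestronglyMeasurable hY.measurableSet), ?_⟩
  rw [hasFiniteIntegral_iff_ofReal]
  · exact hfin
  · filter_upwards [ae_restrict_mem hY.measurableSet] with x hx
    exact pointInner_self_nonneg hom hh u hx

theorem integrableOn_pointInner (hY : IsOpen Y) (hom : IsPositiveForm Y om)
    (hh : IsHermitianMetric (n := n) Y h) {u v : ∀ x : X, Cn n [⋀^Fin k]→L[ℝ] F x}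
    (hu : IsContForm Y u) (hv : IsContForm Y v) (hufin : FiniteL2Norm Y om h u)
    (hvfin : FiniteL2Norm Y om h v) :
    IntegrableOn (pointInner om h u v) Y (volumeMeasure Y om) := by
  refine Integrable.mono' (((integrableOn_pointInner_self hY hom hh hu hufin).add
    (integrableOn_pointInner_self hY hom hh hv hvfin)).div_const 2)
    ((continuousOn_pointInner hY hom hh hu hv).aestronglyMeasurable hY.measurableSet) ?_
  filter_upwards [ae_restrict_mem hY.measurableSet] with x hx
  exact norm_pointInner_le hom hh u v hx

variable [ContMDiffVectorBundle ω ℂ F 𝓘(ℂ, Cn n)]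

theorem integrableOn_pointInner_dbarFunAdj (hY : IsOpen Y) (hom : IsPositiveForm Y om)
    (hh : IsHermitianMetric (n := n) Y h) {p q : ℕ} {u : ∀ x : X, Cn n [⋀^Fin k]→L[ℝ] F x}
    {v : ∀ x : X, Cn n [⋀^Fin (k + 1)]→L[ℝ] F x} (hu : IsSmoothForm Y p q u) (hv : IsContForm Y v)
    (hufin : FiniteL2Norm Y om h u) (hvfin : FiniteL2Norm Y om h v) {f : X → ℝ}
    (hf : ContMDiff 𝓘(ℝ, Cn n) 𝓘(ℝ, ℝ) ∞ f) {s : Set X} (hs : MeasurableSet s) (hsY : s ⊆ Y)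
    {C : ℝ} (hC : 0 ≤ C) (hfC : ∀ x ∈ s, ∀ w, |dReal f x w| ≤ C * √(metricOf om x w w)) :
    IntegrableOn (pointInner om h u (dbarFunAdj om f v)) s (volumeMeasure Y om) := by
  refine Integrable.mono' ((((integrableOn_pointInner_self hY hom hh hu.isContForm hufin).add
    (integrableOn_pointInner_self hY hom hh hv hvfin)).mono_set hsY).const_mul (C * (n + k + 1)))
    (((continuousOn_pointInner_dbarFunAdj hY hom hh hf hu hv).mono hsY).aestronglyMeasurable hs) ?_
  filter_upwards [ae_restrict_mem hs] with x hx
  exact norm_pointInner_dbarFunAdj_le hom hh hC u v (hsY hx) (hfC x hx)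

theorem exists_compact_exhaustion [LocallyCompactSpace X] (hY : IsOpen Y) :
    ∃ K : ℕ → Set X, (∀ j, IsCompact (K j)) ∧ (∀ j, K j ⊆ Y) ∧ ∀ x ∈ Y, ∀ᶠ j in atTop, x ∈ K j := by
  have : LocallyCompactSpace Y := hY.locallyCompactSpace
  refine ⟨fun j => Subtype.val '' compactCovering Y j,
    fun j => (isCompact_compactCovering Y j).image continuous_subtype_val,
    fun j => by rintro _ ⟨x, -, rfl⟩; exact x.2, fun x hx => ?_⟩
  have h1 : (⟨x, hx⟩ : Y) ∈ ⋃ j, compactCovering Y j := by rw [iUnion_compactCovering]; trivial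
  obtain ⟨j, hj⟩ := mem_iUnion.1 h1
  filter_upwards [eventually_ge_atTop j] with i hi
  exact ⟨⟨x, hx⟩, compactCovering_subset Y hi hj, rfl⟩

/-- On a complete manifold, the relation between `∂̄` and its formal adjoint extends from forms
with compact support to `L²` forms multiplied by a bounded function with bounded gradient. -/
theorem integral_adjoint_of_bounded_gradient (hY : IsOpen Y) (hom : IsPositiveForm Y om)
    (hc : IsCompleteForm Y om) (hh : IsHermitianMetric (n := n) Y h) {p q : ℕ}
    {u : ∀ x : X, Cn n [⋀^Fin (p + q)]→L[ℝ] F x} {v : ∀ x : X, Cn n [⋀^Fin (p + q + 1)]→L[ℝ] F x}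
    {w : ∀ x : X, Cn n [⋀^Fin (p + q)]→L[ℝ] F x} (hu : IsSmoothForm Y p q u) (hv : IsContForm Y v)
    (hw : IsDbarAdjoint Y om h p q v w) (hufin : FiniteL2Norm Y om h u)
    (hvfin : FiniteL2Norm Y om h v) (hdufin : FiniteL2Norm Y om h (dbar u))
    (hwfin : FiniteL2Norm Y om h w) {l : X → ℝ} (hl : ContMDiff 𝓘(ℝ, Cn n) 𝓘(ℝ, ℝ) ∞ l) {M C : ℝ}
    (hlM : ∀ x, |l x| ≤ M) (hC : 0 ≤ C)
    (hlC : ∀ x ∈ Y, ∀ z, |dReal l x z| ≤ C * √(metricOf om x z z)) :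
    ∫ x in Y, (l x * (pointInner om h (dbar u) v x - pointInner om h u w x) +
      pointInner om h u (dbarFunAdj om l v) x) ∂(volumeMeasure Y om) = 0 := by
  rcases isEmpty_or_nonempty X with hX | ⟨⟨x₁⟩⟩
  · rw [Measure.eq_zero_of_isEmpty (volumeMeasure Y om)]
    simp
  have hM : 0 ≤ M := (abs_nonneg _).trans (hlM x₁)
  set V := volumeMeasure Y om
  have hYm : MeasurableSet Y := hY.measurableSet
  set f₁ := pointInner om h (dbar u) v with hf₁
  set f₂ := pointInner om h u w with hf₂
  have hdu := hu.isContForm_dbar hY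
  have hi₁ : IntegrableOn f₁ Y V := integrableOn_pointInner hY hom hh hdu hv hdufin hvfin
  have hi₂ : IntegrableOn f₂ Y V := integrableOn_pointInner hY hom hh hu.isContForm
    hw.isSmoothForm.isContForm hufin hwfin
  have hNi := (integrableOn_pointInner_self hY hom hh hu.isContForm hufin).add
    (integrableOn_pointInner_self hY hom hh hv hvfin)
  set N : X → ℝ := fun x => (pointInner om h u u x).re + (pointInner om h v v x).re with hN
  have hN0 : ∀ x ∈ Y, 0 ≤ N x := fun x hx =>
    add_nonneg (pointInner_self_nonneg hom hh u hx) (pointInner_self_nonneg hom hh v hx)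
  set κ : ℝ := n + (p + q : ℕ) + 1 with hκ
  have hκ0 : 0 ≤ κ := by positivity
  have hgc : ∀ f : X → ℝ, ContMDiff 𝓘(ℝ, Cn n) 𝓘(ℝ, ℝ) ∞ f →
      AEStronglyMeasurable (pointInner om h u (dbarFunAdj om f v)) (V.restrict Y) := fun f hf =>
    (continuousOn_pointInner_dbarFunAdj hY hom hh hf hu hv).aestronglyMeasurable hYm
  have hgb : ∀ (f : X → ℝ) (ε : ℝ), 0 ≤ ε → ∀ x ∈ Y,
      (∀ z, |dReal f x z| ≤ ε * √(metricOf om x z z)) →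
      ‖pointInner om h u (dbarFunAdj om f v) x‖ ≤ ε * κ * N x := fun f ε hε x hx hf =>
    norm_pointInner_dbarFunAdj_le hom hh hε u v hx hf
  -- cut-off functions with differentials tending to zero
  have : LocallyCompactSpace X := ChartedSpace.locallyCompactSpace (Cn n) X
  obtain ⟨K, hK, hKY, hKx⟩ := exists_compact_exhaustion hY
  have hε : ∀ j : ℕ, (0 : ℝ) < 1 / (j + 1) ∧ (1 : ℝ) / (j + 1) ≤ 1 := fun j =>
    ⟨by positivity, by rw [div_le_one (by positivity)]; linarith [(Nat.cast_nonneg j : (0:ℝ) ≤ j)]⟩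
  choose χ hχs hχc hχ2 hχK hχd using fun j =>
    exists_cutoff hY hom hc (hK j) (hKY j) (hε j).1 (hε j).2
  have hχl : ∀ j, ContMDiff 𝓘(ℝ, Cn n) 𝓘(ℝ, ℝ) ∞ fun x => χ j x * l x := fun j => (hχs j).mul hl
  have hmd : ∀ {f : X → ℝ}, ContMDiff 𝓘(ℝ, Cn n) 𝓘(ℝ, ℝ) ∞ f → ∀ x,
      MDifferentiableAt 𝓘(ℝ, Cn n) 𝓘(ℝ, ℝ) f x := fun hf x => hf.mdifferentiable (by simp) x
  have hsplit : ∀ j x, pointInner om h u (dbarFunAdj om (fun x => χ j x * l x) v) x =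
      χ j x * pointInner om h u (dbarFunAdj om l v) x +
        l x * pointInner om h u (dbarFunAdj om (χ j) v) x := fun j x =>
    pointInner_dbarFunAdj_linear om h u v fun z => dReal_mul (hmd (hχs j) x) (hmd hl x) z
  set G : ℕ → X → ℂ := fun j x => (χ j x * l x : ℝ) * (f₁ x - f₂ x) +
    (χ j x * pointInner om h u (dbarFunAdj om l v) x +
      l x * pointInner om h u (dbarFunAdj om (χ j) v) x) with hG
  have hχlm : ∀ j, AEStronglyMeasurable (fun x => ((χ j x * l x : ℝ) : ℂ)) (V.restrict Y) := fun j =>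
    (Complex.continuous_ofReal.comp (hχl j).continuous).aestronglyMeasurable
  have hχlb : ∀ j, ∀ x ∈ Y, ‖((χ j x * l x : ℝ) : ℂ)‖ ≤ 2 * M := fun j x hx => by
    rw [Complex.norm_real, norm_mul]
    exact mul_le_mul (hχ2 j x hx) (hlM x) (norm_nonneg _) zero_le_two
  have hχi : ∀ j (f : X → ℂ), IntegrableOn f Y V →
      IntegrableOn (fun x => ((χ j x * l x : ℝ) : ℂ) * f x) Y V := fun j f hf => by
    refine Integrable.bdd_mul (c := 2 * M) hf (hχlm j) ?_
    filter_upwards [ae_restrict_mem hYm] with x hx using hχlb j x hx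
  -- the gradient terms are dominated uniformly in `j`: `|χ j| ≤ 2` and `|d(χ j)| ≤ 1`
  have hgrad : ∀ j, ∀ x ∈ Y, ‖(χ j x * pointInner om h u (dbarFunAdj om l v) x +
      l x * pointInner om h u (dbarFunAdj om (χ j) v) x : ℂ)‖ ≤ (2 * C + M) * κ * N x := by
    intro j x hx
    have h1 := hgb l C hC x hx (hlC x hx)
    have h2 := hgb (χ j) 1 zero_le_one x hx fun z => (hχd j x hx z).trans
      (mul_le_mul_of_nonneg_right (hε j).2 (Real.sqrt_nonneg _))
    refine (norm_add_le _ _).trans ?_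
    rw [norm_mul, norm_mul, Complex.norm_real, Complex.norm_real]
    have h3 := mul_le_mul (hχ2 j x hx) h1 (norm_nonneg _) zero_le_two
    have h4 := mul_le_mul (hlM x) h2 (norm_nonneg _) hM
    simp only [Real.norm_eq_abs]
    linarith
  have hgm : ∀ j, AEStronglyMeasurable (fun x => (χ j x * pointInner om h u (dbarFunAdj om l v) x +
      l x * pointInner om h u (dbarFunAdj om (χ j) v) x : ℂ)) (V.restrict Y) := fun j => by
    refine ((Complex.continuous_ofReal.comp (hχs j).continuous).aestronglyMeasurable.mul
      (hgc l hl)).add ((Complex.continuous_ofReal.comp hl.continuous).aestronglyMeasurable.mul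
      (hgc _ (hχs j)))
  have hgi : ∀ j, IntegrableOn (fun x => (χ j x * pointInner om h u (dbarFunAdj om l v) x +
      l x * pointInner om h u (dbarFunAdj om (χ j) v) x : ℂ)) Y V := fun j => by
    refine Integrable.mono' (hNi.const_mul ((2 * C + M) * κ)) (hgm j) ?_
    filter_upwards [ae_restrict_mem hYm] with x hx using hgrad j x hx
  -- the formal adjoint, applied to `χ j * l * u`
  have hzero : ∀ j, ∫ x in Y, G j x ∂V = 0 := by
    intro j
    have hφ := isSmoothForm_smulForm (hχl j) hu
    obtain ⟨K', hK'Y, hK', hχ0⟩ := hχc j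
    have h1 := hw.adjoint (smulForm (fun x => χ j x * l x) u) hφ ⟨K', hK'Y, hK', fun x hx m => by
      rw [smulForm_apply, hχ0 x hx]; simp⟩
    have h2 : ∫ x in Y, pointInner om h (dbar (smulForm (fun x => χ j x * l x) u)) v x ∂V =
        ∫ x in Y, (((χ j x * l x : ℝ) : ℂ) * f₁ x +
          (χ j x * pointInner om h u (dbarFunAdj om l v) x +
            l x * pointInner om h u (dbarFunAdj om (χ j) v) x)) ∂V := by
      refine setIntegral_congr_fun hYm fun x hx => ?_
      rw [pointInner_dbar_smulForm hY om h (hχl j) hu.smooth v hx, hsplit]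
    have h3 : ∫ x in Y, pointInner om h (smulForm (fun x => χ j x * l x) u) w x ∂V =
        ∫ x in Y, ((χ j x * l x : ℝ) : ℂ) * f₂ x ∂V := by
      refine setIntegral_congr_fun hYm fun x hx => ?_
      rw [pointInner_smulForm]
    have h4 := integral_sub ((hχi j f₁ hi₁).add (hgi j)) (hχi j f₂ hi₂)
    simp only [Pi.add_apply] at h4
    rw [h2, h3, ← sub_eq_zero, ← h4] at h1
    rw [← h1]
    refine integral_congr_ae (Filter.Eventually.of_forall fun x => ?_)
    simp only [hG]
    ring
  have hlim : Tendsto (fun j => ∫ x in Y, G j x ∂V) atTop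
      (𝓝 (∫ x in Y, (l x * (f₁ x - f₂ x) + pointInner om h u (dbarFunAdj om l v) x) ∂V)) := by
    refine tendsto_integral_of_dominated_convergence
      (fun x => 2 * M * (‖f₁ x‖ + ‖f₂ x‖) + (2 * C + M) * κ * N x) (fun j => ?_) ?_ (fun j => ?_) ?_
    · exact ((hχlm j).mul (hi₁.1.sub hi₂.1)).add (hgm j)
    · exact ((hi₁.norm.add hi₂.norm).const_mul _).add (hNi.const_mul _)
    · filter_upwards [ae_restrict_mem hYm] with x hx
      refine (norm_add_le _ _).trans (add_le_add ?_ (hgrad j x hx))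
      rw [norm_mul]
      exact mul_le_mul (hχlb j x hx) (norm_sub_le _ _) (norm_nonneg _) (by positivity)
    · filter_upwards [ae_restrict_mem hYm] with x hx
      have hε0 : Tendsto (fun j : ℕ => (1 : ℝ) / (j + 1)) atTop (𝓝 0) :=
        tendsto_one_div_add_atTop_nhds_zero_nat
      have hχ1 : Tendsto (fun j => ((χ j x : ℝ) : ℂ)) atTop (𝓝 ((1 : ℝ) : ℂ)) := by
        refine (Complex.continuous_ofReal.tendsto 1).comp ?_
        rw [tendsto_iff_dist_tendsto_zero]
        refine squeeze_zero' (Filter.Eventually.of_forall fun _ => dist_nonneg) ?_ hε0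
        filter_upwards [hKx x hx] with j hj
        rw [Real.dist_eq]
        exact hχK j x hj
      have hg0 : Tendsto (fun j => pointInner om h u (dbarFunAdj om (χ j) v) x) atTop (𝓝 0) := by
        refine squeeze_zero_norm (fun j => hgb (χ j) _ (hε j).1.le x hx (hχd j x hx)) ?_
        have := (hε0.mul_const κ).mul_const (N x)
        simpa using this
      have h1 := ((hχ1.mul_const (l x : ℂ)).mul_const (f₁ x - f₂ x)).add
        ((hχ1.mul_const (pointInner om h u (dbarFunAdj om l v) x)).add (hg0.const_mul (l x : ℂ)))
      simp only [Complex.ofReal_one, one_mul, mul_zero, add_zero] at h1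
      refine h1.congr fun j => ?_
      simp only [hG, Complex.ofReal_mul]
  simp only [hzero] at hlim
  exact (tendsto_nhds_unique hlim tendsto_const_nhds)

end Adjoint

/-! ### Disintegration over the values of the exhaustion function -/

section Sublevel

variable {X : Type*} [MeasurableSpace X] {V : Measure X} {Φ : X → ℝ} {f : X → ℂ} {α β : ℝ}

theorem integrable_sublevel [SFinite V] (hΦ : Measurable Φ) (hf : Integrable f V) (α β : ℝ) :
    Integrable (fun p : ℝ × X => {p : ℝ × X | Φ p.2 < p.1}.indicator (fun p => f p.2) p)
      ((volume.restrict (Ioo α β)).prod V) :=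
  (hf.comp_snd (volume.restrict (Ioo α β))).indicator
    (measurableSet_lt (hΦ.comp measurable_snd) measurable_fst)

theorem integral_indicator_sublevel (hΦ : Measurable Φ) (f : X → ℂ) (t : ℝ) :
    ∫ x, {p : ℝ × X | Φ p.2 < p.1}.indicator (fun p => f p.2) (t, x) ∂V =
      ∫ x in {x | Φ x < t}, f x ∂V := by
  rw [← integral_indicator (measurableSet_lt hΦ measurable_const)]
  rfl

theorem integrableOn_integral_sublevel [SFinite V] (hΦ : Measurable Φ) (hf : Integrable f V) :
    IntegrableOn (fun t => ∫ x in {x | Φ x < t}, f x ∂V) (Ioo α β) := by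
  have h1 := (integrable_sublevel hΦ hf α β).integral_prod_left
  simp only [integral_indicator_sublevel hΦ f] at h1
  exact h1

/-- Fubini's theorem for the representation of `l` as an integral of `ψ = l'`: the integral of `l ∘ Φ` against a density is
expressed through the integrals of this density over the sublevel sets of `Φ`. -/
theorem integral_primitive_mul [SFinite V] (hΦ : Measurable Φ) (hf : Integrable f V) {ψ l : ℝ → ℝ}
    (hψ : Continuous ψ) {M : ℝ} (hM : ∀ t, |ψ t| ≤ M)
    (hl : ∀ s, l s = -∫ t in Ioo α β, if s < t then ψ t else 0) :
    ∫ x, (l (Φ x) : ℂ) * f x ∂V =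
      -∫ t in Ioo α β, (ψ t : ℂ) * ∫ x in {x | Φ x < t}, f x ∂V := by
  set S : Set (ℝ × X) := {p | Φ p.2 < p.1} with hS
  have hi : Integrable (fun p : ℝ × X => (ψ p.1 : ℂ) * S.indicator (fun p => f p.2) p)
      ((volume.restrict (Ioo α β)).prod V) := by
    refine Integrable.bdd_mul (c := M) (integrable_sublevel hΦ hf α β) ?_ ?_
    · exact ((Complex.measurable_ofReal.comp hψ.measurable).comp
        measurable_fst).aestronglyMeasurable
    · exact Filter.Eventually.of_forall fun p => by rw [Complex.norm_real]; exact hM _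
  have h1 := integral_integral_swap (f := fun t x => (ψ t : ℂ) * S.indicator (fun p => f p.2) (t, x))
    (μ := volume.restrict (Ioo α β)) (ν := V) hi
  simp_rw [integral_const_mul, hS, integral_indicator_sublevel hΦ f] at h1
  rw [h1, ← integral_neg]
  refine integral_congr_ae (Filter.Eventually.of_forall fun x => ?_)
  beta_reduce
  rw [hl, Complex.ofReal_neg, neg_mul, neg_inj, ← integral_complex_ofReal, ← integral_mul_const]
  refine integral_congr_ae (Filter.Eventually.of_forall fun t => ?_)
  by_cases ht : Φ x < t <;> simp [indicator, ht]

/-- A density whose integral against `l ∘ Φ` equals `-∫ l' G` for all `l` with derivative supported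
in an interval has integral `G d` over almost every sublevel set `{Φ < d}`, `d` in the interval. -/
theorem ae_integral_sublevel_eq [SFinite V] (hΦ : Measurable Φ) (hf : Integrable f V) {G : ℝ → ℂ}
    (hG : Integrable G)
    (H : ∀ ψ l : ℝ → ℝ, Continuous ψ → (∀ t ∉ Ioo α β, ψ t = 0) → (∃ M, ∀ t, |ψ t| ≤ M) →
      ContDiff ℝ ∞ l → (∀ t, HasDerivAt l (ψ t) t) → (∃ M, ∀ t, |l t| ≤ M) →
      ∫ x, (l (Φ x) : ℂ) * f x ∂V + ∫ t, (ψ t : ℂ) * G t = 0) :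
    ∀ᵐ d : ℝ, d ∈ Ioo α β → ∫ x in {x | Φ x < d}, f x ∂V = G d := by
  have hA := integrableOn_integral_sublevel (α := α) (β := β) hΦ hf
  have h0 : ∀ᵐ d : ℝ, d ∈ Ioo α β → (∫ x in {x | Φ x < d}, f x ∂V) - G d = 0 := by
    refine isOpen_Ioo.ae_eq_zero_of_integral_contDiff_smul_eq_zero
      (hA.sub hG.integrableOn).locallyIntegrableOn fun ψ hψ hψc hψs => ?_
    have hψ0 : ∀ t, t ∉ Ioo α β → ψ t = 0 := fun t ht =>
      image_eq_zero_of_notMem_tsupport fun h => ht (hψs h)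
    obtain ⟨M, hM⟩ := hψ.continuous.bounded_above_of_compact_support hψc
    obtain ⟨l, hl, hlψ, hlM, hlI⟩ := exists_primitive hψ hψ0
    have h1 := H ψ l hψ.continuous hψ0 ⟨M, hM⟩ hl hlψ hlM
    rw [integral_primitive_mul hΦ hf hψ.continuous hM hlI] at h1
    have hbd : ∀ E : ℝ → ℂ, IntegrableOn E (Ioo α β) →
        IntegrableOn (fun t => (ψ t : ℂ) * E t) (Ioo α β) := fun E hE =>
      Integrable.bdd_mul (c := M) hE
        (Complex.continuous_ofReal.comp hψ.continuous).aestronglyMeasurable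
        (Filter.Eventually.of_forall fun t => by rw [Complex.norm_real]; exact hM t)
    have h2 : ∫ t, (ψ t : ℂ) * G t = ∫ t in Ioo α β, (ψ t : ℂ) * G t :=
      (setIntegral_eq_integral_of_forall_compl_eq_zero fun t ht => by rw [hψ0 t ht]; simp).symm
    rw [← setIntegral_eq_integral_of_forall_compl_eq_zero (s := Ioo α β) fun t ht => by
      rw [hψ0 t ht, zero_smul]]
    simp only [Complex.real_smul, mul_sub]
    rw [integral_sub (hbd _ hA) (hbd _ hG.integrableOn), ← h2, ← neg_eq_zero, neg_sub,
      sub_eq_neg_add]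
    exact h1
  filter_upwards [h0] with d hd hdI using sub_eq_zero.1 (hd hdI)

end Sublevel

section Chain

variable {n : ℕ} {X : Type*} [TopologicalSpace X] [ChartedSpace (Cn n) X] {Φ : X → ℝ}

theorem dReal_comp {l : ℝ → ℝ} {l' : ℝ} {x : X} (hl : HasDerivAt l l' (Φ x))
    (hΦ : MDifferentiableAt 𝓘(ℝ, Cn n) 𝓘(ℝ, ℝ) Φ x) (w : Cn n) :
    dReal (fun x => l (Φ x)) x w = l' * dReal Φ x w := by
  have h1 : HasMFDerivAt 𝓘(ℝ, Cn n) 𝓘(ℝ, ℝ) (l ∘ Φ) x _ :=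
    hl.hasFDerivAt.hasMFDerivAt.comp x hΦ.hasMFDerivAt
  have h2 : mfderiv 𝓘(ℝ, Cn n) 𝓘(ℝ, ℝ) (fun x => l (Φ x)) x = _ := h1.mfderiv
  rw [dReal, h2]
  change (dReal Φ x w) * l' = _
  rw [mul_comm]

end Chain

section Coarea

variable {n : ℕ} {X : Type*} [TopologicalSpace X] [T2Space X] [SecondCountableTopology X]
  [ChartedSpace (Cn n) X] [IsManifold 𝓘(ℂ, Cn n) ω X] [MeasurableSpace X] [BorelSpace X]
  {Y : Set X} {om : X → Cn n [⋀^Fin 2]→L[ℝ] ℝ} {Φ : X → ℝ}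

/-- The integral over a level set of `Φ` of a function multiplied by `ψ ∘ Φ`. -/
theorem integral_comp_mul_levelMeasure (hY : IsOpen Y) (hΦ : Continuous Φ) (ψ : ℝ → ℝ) (g : X → ℂ)
    (C : Set X) (t : ℝ) :
    ∫ x in C, (ψ (Φ x) : ℂ) * g x ∂(levelMeasure Y om Φ t) =
      (ψ t : ℂ) * ∫ x in C, g x ∂(levelMeasure Y om Φ t) := by
  rw [← integral_const_mul]
  refine integral_congr_ae (ae_restrict_of_ae ?_)
  have h1 : ∀ᵐ x ∂(levelMeasure Y om Φ t), Φ x = t := by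
    rw [ae_iff]; exact levelMeasure_preimage_compl hY hΦ t
  filter_upwards [h1] with x hx
  rw [hx]

end Coarea

section Boundary

variable {n k : ℕ} {X : Type*} [TopologicalSpace X] [T2Space X] [SecondCountableTopology X]
  [ChartedSpace (Cn n) X] [IsManifold 𝓘(ℂ, Cn n) ω X] [MeasurableSpace X] [BorelSpace X]
  {F : X → Type*} [∀ x, AddCommGroup (F x)] [∀ x, Module ℂ (F x)] [∀ x, TopologicalSpace (F x)]
  [TopologicalSpace (TotalSpace ℂ F)] [FiberBundle ℂ F] [VectorBundle ℂ ℂ F]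
  [ContMDiffVectorBundle ω ℂ F 𝓘(ℂ, Cn n)]
  {Y : Set X} {om : X → Cn n [⋀^Fin 2]→L[ℝ] ℝ} {h : ∀ x, F x →ₗ[ℂ] F x →ₗ⋆[ℂ] ℂ}

/-- The boundary formula on the sublevel sets of a function `Φ` whose values in an interval are
taken on a compact set of regular points, with differential bounded for the metric. -/
theorem ae_integral_sublevel_boundary (hY : IsOpen Y) (hom : IsPositiveForm Y om)
    (hc : IsCompleteForm Y om) (hh : IsHermitianMetric (n := n) Y h) {p q : ℕ}
    {u : ∀ x : X, Cn n [⋀^Fin (p + q)]→L[ℝ] F x} {v : ∀ x : X, Cn n [⋀^Fin (p + q + 1)]→L[ℝ] F x}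
    {w : ∀ x : X, Cn n [⋀^Fin (p + q)]→L[ℝ] F x} (hu : IsSmoothForm Y p q u) (hv : IsContForm Y v)
    (hw : IsDbarAdjoint Y om h p q v w) (hufin : FiniteL2Norm Y om h u)
    (hvfin : FiniteL2Norm Y om h v) (hdufin : FiniteL2Norm Y om h (dbar u))
    (hwfin : FiniteL2Norm Y om h w) {Φ : X → ℝ} (hΦ : ContMDiff 𝓘(ℝ, Cn n) 𝓘(ℝ, ℝ) ∞ Φ) {α β : ℝ}
    (hL : IsCompact (Φ ⁻¹' Icc α β)) (hreg : ∀ x ∈ Φ ⁻¹' Icc α β, dReal (n := n) Φ x ≠ 0) {C : ℝ}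
    (hC : 0 ≤ C)
    (hΦC : ∀ x ∈ Φ ⁻¹' Icc α β ∩ Y, ∀ z, |dReal Φ x z| ≤ C * √(metricOf om x z z)) :
    ∀ᵐ d : ℝ, d ∈ Ioo α β →
      IntegrableOn (pointInner om h (dbar u) v) ({x | Φ x < d} ∩ Y) (volumeMeasure Y om) ∧
      IntegrableOn (pointInner om h u w) ({x | Φ x < d} ∩ Y) (volumeMeasure Y om) ∧
      IntegrableOn (pointInner om h u (dbarFunAdj om Φ v)) (Φ ⁻¹' {d} ∩ Y)
        (levelMeasure Y om Φ d) ∧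
      ∫ x in {x | Φ x < d} ∩ Y, pointInner om h (dbar u) v x ∂(volumeMeasure Y om) =
        ∫ x in {x | Φ x < d} ∩ Y, pointInner om h u w x ∂(volumeMeasure Y om) +
        ∫ x in Φ ⁻¹' {d} ∩ Y, pointInner om h u (dbarFunAdj om Φ v) x
          ∂(levelMeasure Y om Φ d) := by
  have := sFinite_volumeMeasure hY hom
  have hYm := hY.measurableSet
  have hΦm : Measurable Φ := hΦ.continuous.measurable
  have hmd : ∀ x, MDifferentiableAt 𝓘(ℝ, Cn n) 𝓘(ℝ, ℝ) Φ x := fun x => hΦ.mdifferentiable (by simp) x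
  set V := volumeMeasure Y om with hV
  set f₁ := pointInner om h (dbar u) v with hf₁
  set f₂ := pointInner om h u w with hf₂
  set g := pointInner om h u (dbarFunAdj om Φ v) with hg
  have hi₁ : IntegrableOn f₁ Y V :=
    integrableOn_pointInner hY hom hh (hu.isContForm_dbar hY) hv hdufin hvfin
  have hi₂ : IntegrableOn f₂ Y V :=
    integrableOn_pointInner hY hom hh hu.isContForm hw.isSmoothForm.isContForm hufin hwfin
  set D : Set X := Y ∩ Φ ⁻¹' Ioo α β with hD
  have hDm : MeasurableSet D := hYm.inter (hΦm measurableSet_Ioo)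
  have hDL : D ⊆ Φ ⁻¹' Icc α β := fun x hx => Ioo_subset_Icc_self hx.2
  have hgc : ContinuousOn g Y := continuousOn_pointInner_dbarFunAdj hY hom hh hΦ hu hv
  have hgi : IntegrableOn g D V := integrableOn_pointInner_dbarFunAdj hY hom hh hu hv hufin hvfin hΦ
    hDm inter_subset_left hC fun x hx => hΦC x ⟨hDL hx, hx.1⟩
  obtain ⟨hgl, hGi, -⟩ := coareaOn_of_isCompact hY hom hΦ hL hreg hgc hDm inter_subset_left hDL hgi
  have key := ae_integral_sublevel_eq (V := V.restrict Y) (α := α) (β := β) hΦm (hi₁.sub hi₂) hGi ?_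
  · filter_upwards [hgl, key] with d hd1 hd2 hd
    have e := levelMeasure_restrict_preimage (om := om) hY hΦ.continuous hd
    have hS : MeasurableSet {x | Φ x < d} := hΦm measurableSet_Iio
    have j₁ : IntegrableOn f₁ ({x | Φ x < d} ∩ Y) V := hi₁.mono_set inter_subset_right
    have j₂ : IntegrableOn f₂ ({x | Φ x < d} ∩ Y) V := hi₂.mono_set inter_subset_right
    refine ⟨j₁, j₂, ?_, ?_⟩
    · rw [IntegrableOn, ← e]
      exact hd1
    · have h1 := hd2 hd
      rw [Measure.restrict_restrict hS] at h1
      simp only [Pi.sub_apply] at h1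
      rw [integral_sub j₁ j₂, sub_eq_iff_eq_add'] at h1
      rw [h1, ← e]
  -- the adjoint relation for the cut-off function `l ∘ Φ`
  · rintro ψ l hψ hψ0 ⟨M, hM⟩ hl hlψ ⟨M', hM'⟩
    have hM0 : 0 ≤ M := (abs_nonneg _).trans (hM 0)
    have hlΦ : ContMDiff 𝓘(ℝ, Cn n) 𝓘(ℝ, ℝ) ∞ fun x => l (Φ x) := hl.contMDiff.comp hΦ
    have hdl : ∀ x z, dReal (fun x => l (Φ x)) x z = ψ (Φ x) * dReal Φ x z := fun x z =>
      dReal_comp (hlψ (Φ x)) (hmd x) z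
    have hgl : ∀ x ∈ Y, ∀ z,
        |dReal (fun x => l (Φ x)) x z| ≤ M * C * √(metricOf om x z z) := by
      intro x hx z
      rw [hdl, abs_mul]
      by_cases hxI : Φ x ∈ Ioo α β
      · rw [mul_assoc]
        exact mul_le_mul (hM _) (hΦC x ⟨Ioo_subset_Icc_self hxI, hx⟩ z) (abs_nonneg _) hM0
      · rw [hψ0 _ hxI, abs_zero, zero_mul]
        positivity
    have hadj : ∀ x, pointInner om h u (dbarFunAdj om (fun x => l (Φ x)) v) x = ψ (Φ x) * g x :=
      fun x => by
        have := pointInner_dbarFunAdj_linear om h (f := fun x => l (Φ x)) (f₁ := Φ) (f₂ := Φ)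
          (a := ψ (Φ x)) (b := 0) u v (x := x) fun z => by rw [hdl, zero_mul, add_zero]
        simpa using this
    have h1 := integral_adjoint_of_bounded_gradient hY hom hc hh hu hv hw hufin hvfin hdufin hwfin
      hlΦ (fun x => hM' (Φ x)) (mul_nonneg hM0 hC) hgl
    have hk₁ : IntegrableOn (fun x => (l (Φ x) : ℂ) * (f₁ x - f₂ x)) Y V :=
      Integrable.bdd_mul (c := M') (hi₁.sub hi₂)
        (Complex.continuous_ofReal.comp hlΦ.continuous).aestronglyMeasurable
        (Filter.Eventually.of_forall fun x => by rw [Complex.norm_real]; exact hM' _)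
    have hk₂ : IntegrableOn (fun x => (ψ (Φ x) : ℂ) * g x) Y V := by
      have h2 := integrableOn_pointInner_dbarFunAdj hY hom hh hu hv hufin hvfin hlΦ hYm
        Subset.rfl (mul_nonneg hM0 hC) hgl
      exact h2.congr (Filter.Eventually.of_forall hadj)
    simp only [hadj] at h1
    rw [integral_add hk₁ hk₂] at h1
    have hψg : ContinuousOn (fun x => (ψ (Φ x) : ℂ) * g x) Y :=
      (Complex.continuous_ofReal.comp (hψ.comp hΦ.continuous)).continuousOn.mul hgc
    obtain ⟨-, -, h2⟩ := coareaOn_of_isCompact hY hom hΦ hL hreg hψg hDm inter_subset_left hDL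
      (hk₂.mono_set inter_subset_left)
    have h3 : ∫ x in Y, (ψ (Φ x) : ℂ) * g x ∂V = ∫ x in D, (ψ (Φ x) : ℂ) * g x ∂V :=
      setIntegral_eq_of_subset_of_forall_sdiff_eq_zero hYm inter_subset_left fun x hx => by
        rw [hψ0 _ fun hxI => hx.2 ⟨hx.1, hxI⟩, Complex.ofReal_zero, zero_mul]
    rw [h3, h2] at h1
    simp only [integral_comp_mul_levelMeasure hY hΦ.continuous] at h1
    exact h1

end Boundary

end DbarBoundary

end

theorem proposition2p3 {n : ℕ} {X : Type*} [TopologicalSpace X] [T2Space X]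
    [SecondCountableTopology X] [ChartedSpace (Cn n) X] [IsManifold 𝓘(ℂ, Cn n) ω X]
    [MeasurableSpace X] [BorelSpace X]
    (F : X → Type*) [∀ x, AddCommGroup (F x)] [∀ x, Module ℂ (F x)]
    [∀ x, TopologicalSpace (F x)] [TopologicalSpace (TotalSpace ℂ F)] [FiberBundle ℂ F]
    [VectorBundle ℂ ℂ F] [ContMDiffVectorBundle ω ℂ F 𝓘(ℂ, Cn n)]
    (Φ : X → ℝ) (hΦ : ContMDiff 𝓘(ℝ, Cn n) 𝓘(ℝ, ℝ) ∞ Φ) (c : ℝ)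
    (hcompact : ∃ c' > c, IsCompact (closure {x | Φ x < c'}))
    (hregular : ∀ x, Φ x = c → mfderiv 𝓘(ℝ, Cn n) 𝓘(ℝ, ℝ) Φ x ≠ 0) :
    ∃ a > 0,
      (∀ d ∈ Ioo (c - a) (c + a), ∀ x ∈ frontier {x | Φ x < d},
        mfderiv 𝓘(ℝ, Cn n) 𝓘(ℝ, ℝ) Φ x ≠ 0) ∧
      ∀ (Y : Set X) (_ : IsZariskiOpen (n := n) Y)
        (h : ∀ x, F x →ₗ[ℂ] F x →ₗ⋆[ℂ] ℂ) (_ : IsHermitianMetric (n := n) Y h)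
        (om : X → Cn n [⋀^Fin 2]→L[ℝ] ℝ) (_ : IsPositiveForm Y om) (_ : IsCompleteForm Y om)
        (_ : ∃ om₀ : X → Cn n [⋀^Fin 2]→L[ℝ] ℝ, IsPositiveForm univ om₀ ∧
          ∀ x ∈ Y, ∀ ξ : Cn n, metricOf om₀ x ξ ξ ≤ metricOf om x ξ ξ)
        (p q : ℕ) (u : ∀ x : X, Cn n [⋀^Fin (p + q)]→L[ℝ] F x)
        (v : ∀ x : X, Cn n [⋀^Fin (p + q + 1)]→L[ℝ] F x)
        (dbarStar_v : ∀ x : X, Cn n [⋀^Fin (p + q)]→L[ℝ] F x),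
        IsSmoothForm Y p q u → IsSmoothForm Y p (q + 1) v →
        IsDbarAdjoint Y om h p q v dbarStar_v →
        FiniteL2Norm Y om h u → FiniteL2Norm Y om h v →
        FiniteL2Norm Y om h (dbar u) → FiniteL2Norm Y om h dbarStar_v →
        ∀ᵐ d : ℝ, d ∈ Ioo (c - a) (c + a) →
          IntegrableOn (pointInner om h (dbar u) v) ({x | Φ x < d} ∩ Y) (volumeMeasure Y om) ∧
          IntegrableOn (pointInner om h u dbarStar_v) ({x | Φ x < d} ∩ Y) (volumeMeasure Y om) ∧
          IntegrableOn (pointInner om h u (dbarFunAdj om Φ v)) (frontier {x | Φ x < d} ∩ Y)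
            (levelMeasure Y om Φ d) ∧
          ∫ x in {x | Φ x < d} ∩ Y, pointInner om h (dbar u) v x ∂(volumeMeasure Y om) =
            ∫ x in {x | Φ x < d} ∩ Y, pointInner om h u dbarStar_v x ∂(volumeMeasure Y om) +
            ∫ x in frontier {x | Φ x < d} ∩ Y, pointInner om h u (dbarFunAdj om Φ v) x
              ∂(levelMeasure Y om Φ d) := by
  obtain ⟨c', hcc', hK⟩ := hcompact
  obtain ⟨a, ha, hL, hreg⟩ := exists_regular_interval hΦ hcc' hK hregular
  have hfr : ∀ d ∈ Ioo (c - a) (c + a), frontier {x | Φ x < d} = Φ ⁻¹' {d} := fun d hd =>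
    frontier_sublevel hΦ fun x hx => hreg x (by
      rw [mem_preimage, hx]; exact Ioo_subset_Icc_self hd)
  refine ⟨a, ha, fun d hd x hx => ?_, ?_⟩
  · rw [hfr d hd] at hx
    refine hreg x ?_
    rw [mem_preimage, show Φ x = d from hx]
    exact Ioo_subset_Icc_self hd
  · rintro Y hY h hh om hom hc ⟨om₀, hom₀, hle⟩ p q u v w hu hv hw hufin hvfin hdufin hwfin
    obtain ⟨C, hC, hΦC⟩ := exists_dReal_le_of_isCompact isOpen_univ hom₀ hΦ hL (subset_univ _)
    have hb : ∀ x ∈ Φ ⁻¹' Icc (c - a) (c + a) ∩ Y, ∀ z,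
        |dReal Φ x z| ≤ C * √(metricOf om x z z) := fun x hx z =>
      (hΦC x hx.1 z).trans
        (mul_le_mul_of_nonneg_left (Real.sqrt_le_sqrt (hle x hx.2 z)) hC)
    filter_upwards [ae_integral_sublevel_boundary hY.isOpen hom hc hh hu hv.isContForm hw hufin
      hvfin hdufin hwfin hΦ hL hreg hC hb] with d hd hdI
    rw [hfr d hdI]
    exact hd hdI
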